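/- Let $d\ge 2$ be an integer, let $\alpha\in(1,2)$, put $s=d-\alpha+1$, and let $E\subset\mathbb{R}^d$ be a compact set. Then $E$ is $\alpha$-removable in the Lipschitz category if and only if $\gamma_s(E)=0$. Here the notions are as follows. For a Schwartz function $f$ on $\mathbb{R}^d$ put $(-\Delta)^{\alpha/2}f=\mathcal{F}^{-1}(|\xi|^{\alpha}\widehat f(\xi))$. The set $E$ is called *$\alpha$-removable in the Lipschitz category* if the following holds for every open set $U\supset E$ and every measurable function $u:\mathbb{R}^d\to\mathbb{R}$ that is Lipschitz continuous on $U$ and satisfies $\int_{\mathbb{R}^d}\frac{|u(x)|}{(1+|x|)^{d+\alpha}}\,dx<\infty$: if $$\int_{\mathbb{R}^d}u\,(-\Delta)^{\alpha/2}f\,dx=0\quad\text{for all } f\in C^\infty_0(U)\text{ with }\operatorname{supp}(f)\cap E=\varnothing,$$ then this equality holds for all $f\in C_0^\infty(U)$. Let $K(x)=\frac{x}{|x|^{s+1}}$. Then $$\gamma_s(E)=\sup\bigl\{\langle T,1\rangle:\ T \text{ is a real distribution on }\mathbb{R}^d,\ \operatorname{supp}(T)\subset E,\ K*T\in L^\infty(\mathbb{R}^d;\mathbb{R}^d),\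 \|K*T\|_{L^\infty}\le 1\bigr\},$$ where a compactly supported distribution $T$ is extended to all smooth functions $g$ by $\langle T,g\rangle=\langle T,h\rangle$ for any $h\in C_0^\infty(\mathbb{R}^d)$ that equals $g$ in a neighbourhood of $\operatorname{supp}(T)$, and $K*T$ is the vector-valued distribution $\langle K*T,\varphi\rangle=\bigl\langle T,\ x\mapsto\int_{\mathbb{R}^d}K(y-x)\varphi(y)\,dy\bigr\rangle$, $\varphi\in C_0^\infty(\mathbb{R}^d)$. -/

import Mathlib

open MeasureTheory Topology TopologicalSpace
open scoped Distributions FourierTransform ENNReal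

noncomputable section

/-- The fractional Laplacian `(-Δ)^(α/2) f = 𝓕⁻¹ (|ξ|^α 𝓕 f)` of a Schwartz function `f`. In Mathlib
`𝓕 f η = ∫ exp (-2 π i ⟪x, η⟫) f x dx`, so that the frequency `ξ` is `2 π η`. -/
def fracLaplacian {d : ℕ} (α : ℝ) (f : EuclideanSpace ℝ (Fin d) → ℂ) :
    EuclideanSpace ℝ (Fin d) → ℂ :=
  𝓕⁻ (fun η : EuclideanSpace ℝ (Fin d) => (((2 * Real.pi * ‖η‖) ^ α : ℝ) : ℂ) * 𝓕 f η)

/-- The value `⟨(-Δ)^(α/2) u, f⟩ = ∫ u (-Δ)^(α/2) f dx` of the distributional fractional Laplacian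
of `u` at the real test function `f`. -/
def fracLaplacianPairing {d : ℕ} (α : ℝ) (u f : EuclideanSpace ℝ (Fin d) → ℝ) : ℂ :=
  ∫ x, (u x : ℂ) * fracLaplacian α (fun y => (f y : ℂ)) x

/-- `E` is `α`-removable in the Lipschitz category: if `u` is Lipschitz in an open neighbourhood `U`
of `E`, grows slowly at infinity, and `(-Δ)^(α/2) u = 0` in `U \ E` in the sense of distributions,
then `(-Δ)^(α/2) u = 0` in `U`. -/
def IsLipRemovable {d : ℕ} (α : ℝ) (E : Set (EuclideanSpace ℝ (Fin d))) : Prop :=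
  ∀ (U : Opens (EuclideanSpace ℝ (Fin d))) (u : EuclideanSpace ℝ (Fin d) → ℝ),
    E ⊆ U →
    (∃ L, LipschitzOnWith L u U) →
    Integrable (fun x => u x / (1 + ‖x‖) ^ ((d : ℝ) + α)) volume →
    (∀ f : 𝓓(U, ℝ), tsupport f ∩ E = ∅ → fracLaplacianPairing α u f = 0) →
    ∀ f : 𝓓(U, ℝ), fracLaplacianPairing α u f = 0

/-- The `s`-Riesz kernel `K x = x / |x|^(s+1)` on `ℝ^d`. -/
def rieszKernel {d : ℕ} (s : ℝ) (x : EuclideanSpace ℝ (Fin d)) : EuclideanSpace ℝ (Fin d) :=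
  (‖x‖ ^ (s + 1))⁻¹ • x

/-- `⟨T, g⟩ = c` for a compactly supported distribution `T` and a smooth function `g`, not
necessarily with compact support: `⟨T, g⟩` is the value of `T` at a test function that coincides
with `g` near the support of `T` (it does not depend on the choice of this test function). -/
def PairsTo {d : ℕ} (T : 𝓓'((⊤ : Opens (EuclideanSpace ℝ (Fin d))), ℝ))
    (g : EuclideanSpace ℝ (Fin d) → ℝ) (c : ℝ) : Prop :=
  ∃ h : 𝓓((⊤ : Opens (EuclideanSpace ℝ (Fin d))), ℝ),
    (∀ᶠ x in 𝓝ˢ (Distribution.dsupport T), h x = g x) ∧ T h = c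

/-- The `ℝ^d`-valued distribution `K * T`, where `K` is the `s`-Riesz kernel and `T` is a compactly
supported distribution, is the function `G`. Here `⟨K * T, φ⟩ = ⟨T, x ↦ ∫ K (y - x) φ y dy⟩`,
coordinate by coordinate. -/
def RieszConvEq {d : ℕ} (s : ℝ) (T : 𝓓'((⊤ : Opens (EuclideanSpace ℝ (Fin d))), ℝ))
    (G : EuclideanSpace ℝ (Fin d) → EuclideanSpace ℝ (Fin d)) : Prop :=
  ∀ (φ : 𝓓((⊤ : Opens (EuclideanSpace ℝ (Fin d))), ℝ)) (i : Fin d),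
    PairsTo T (fun x => ∫ y, rieszKernel s (y - x) i * φ y) (∫ y, G y i * φ y)

/-- The capacity `γ_s(E)`: the supremum of `⟨T, 1⟩` over all (real) distributions `T` with
`supp T ⊆ E` such that `K * T` is an `L^∞` function of norm at most `1`. -/
def rieszCapacity {d : ℕ} (s : ℝ) (E : Set (EuclideanSpace ℝ (Fin d))) : EReal :=
  sSup {c : EReal | ∃ (T : 𝓓'((⊤ : Opens (EuclideanSpace ℝ (Fin d))), ℝ)) (t : ℝ),
    Distribution.dsupport T ⊆ E ∧
    (∃ G : EuclideanSpace ℝ (Fin d) → EuclideanSpace ℝ (Fin d),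
      MemLp G ∞ volume ∧ eLpNorm G ∞ volume ≤ 1 ∧ RieszConvEq s T G) ∧
    PairsTo T (fun _ => 1) t ∧ c = (t : EReal)}

end

/-!
The theorem rests on the fact that, for `p = n - α = s - 1`, the Riesz potential
`P φ = ‖·‖^(-p) * φ` inverts the fractional Laplacian up to a constant, while the Riesz kernel
`K(x) = x / ‖x‖^(s+1)` is a multiple of the gradient of `‖x‖^(-p)`. Hence, if `T` is a multiple of
the fractional Laplacian of `u`, then `K * T` is a multiple of the gradient of `u`, and `K * T` is
bounded exactly when `u` is Lipschitz.

*The operator.* On test functions, the Fourier multiplier `‖ξ‖^α` is a constant multiple of the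
absolutely convergent singular integral `Λf(x) = ∫ (2f(x) - f(x+h) - f(x-h)) ‖h‖^(-(n+α)) dh`
(`exists_singularLaplacian_eq_fourierInv`). The formulas `P Λ f = C f` and `Λ P φ = P Λ φ` are
`exists_rieszPotential_singularLaplacian` and `singularLaplacian_rieszPotential`; the first is
proved by writing powers as mixtures of Gaussians. The passage from `P (∂_v φ)` to the Riesz kernel
is `rieszPotential_fderiv`.

*Capacity zero implies removability.* Suppose that `u` is Lipschitz near `supp f₀`, that
`(-Δ)^(α/2) u = 0` off `E`, but `∫ u Λf₀ ≠ 0`. The distribution `ψ ↦ ∫ u Λ(f₀ ψ)` is supported in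
`E` and has a nonzero total mass. By the product rule for second differences it has the form
`∫ F Λψ + ∫ ψ g` with `F` Lipschitz with compact support and `g` bounded and integrable
(`exists_pairing`). On `ψ = K * φ`, the first term is a multiple of `∫ F ∂φ = -∫ φ ∂F`, and the
second one is `∫ (K * g) φ` up to a sign; so the convolution with `K` is bounded
(`exists_bounded_rieszTransform`), and the capacity of `E` is positive.

*Removability implies capacity zero.* Let `T` be supported in `E` with `‖K * T‖ ≤ 1`. Its potential
`u = ‖·‖^(-p) * T` should be a Lipschitz function with `Λu = C T`. To define it, `T` is paired with
translates of the mollified kernels `P ρ_n`, cut off by a function `χ` that equals `1` near `E`. The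
resulting functions are uniformly Lipschitz and converge uniformly (`exists_lipschitz_potential`).
This uses that distributions commute with integrals of families of test functions
(`Distribution.apply_integral_param`). As `Λu = C T` vanishes off `E`, removability, applied with
the whole space as neighbourhood, gives `⟨T, χ⟩ = 0`. -/

set_option linter.unusedSectionVars false

noncomputable section

/-! ### Distributions and integrals of families of test functions -/

section Distributions

variable {E : Type} [NormedAddCommGroup E] [NormedSpace ℝ E]

/-- The iterated derivatives in the second variable of a jointly smooth function are jointly
smooth. -/
theorem ContDiff.iteratedFDeriv_param {X : Type*} [NormedAddCommGroup X] [NormedSpace ℝ X]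
    {Φ : X → E → ℝ} (hΦ : ContDiff ℝ (⊤ : ℕ∞) (fun p : X × E => Φ p.1 p.2)) (i : ℕ) :
    ContDiff ℝ (⊤ : ℕ∞) (fun p : X × E => iteratedFDeriv ℝ i (Φ p.1) p.2) := by
  induction i with
  | zero =>
    simp only [iteratedFDeriv_zero_eq_comp, Function.comp_def]
    exact (continuousMultilinearCurryFin0 ℝ E ℝ).symm.contDiff.comp hΦ
  | succ i ih =>
    simp only [iteratedFDeriv_succ_eq_comp_left, Function.comp_def]
    have hL : ContDiff ℝ (⊤ : ℕ∞)
        (continuousMultilinearCurryLeftEquiv ℝ (fun _ : Fin (i + 1) => E) ℝ).symm := by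
      apply LinearIsometryEquiv.contDiff
    refine hL.comp ?_
    refine ContDiff.fderiv (m := (⊤ : ℕ∞)) (n := (⊤ : ℕ∞))
      (f := fun (p : X × E) (y : E) => iteratedFDeriv ℝ i (Φ p.1) y) (g := fun p => p.2) ?_
      contDiff_snd (by simp)
    exact ih.comp ((contDiff_fst.comp contDiff_fst).prodMk contDiff_snd)

/-- Differentiation under the integral sign, for vector-valued functions: it is applied to the
iterated derivatives of a scalar function. -/
theorem fderiv_integral_smul_param {X Z : Type*} [NormedAddCommGroup X] [NormedSpace ℝ X]
    [MeasurableSpace X] [BorelSpace X] [SecondCountableTopology X] [FiniteDimensional ℝ E]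
    [NormedAddCommGroup Z] [NormedSpace ℝ Z] [CompleteSpace Z]
    {ν : Measure X} {w : X → ℝ} (hw : Integrable w ν)
    {F : X → E → Z} (hF : ContDiff ℝ (⊤ : ℕ∞) (fun p : X × E => F p.1 p.2)) {C₀ C₁ : ℝ}
    (h0 : ∀ x y, ‖F x y‖ ≤ C₀) (h1 : ∀ x y, ‖fderiv ℝ (F x) y‖ ≤ C₁) (y v : E) :
    fderiv ℝ (fun y => ∫ x, w x • F x y ∂ν) y v = ∫ x, w x • fderiv ℝ (F x) y v ∂ν ∧
      Integrable (fun x => w x • fderiv ℝ (F x) y v) ν := by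
  have hint : ∀ y, Integrable (fun x => w x • F x y) ν := by
    intro y
    refine (hw.norm.mul_const C₀).mono' (hw.1.smul
      (hF.continuous.comp (Continuous.prodMk_left y)).aestronglyMeasurable)
      (ae_of_all _ fun x => ?_)
    rw [norm_smul]
    exact mul_le_mul_of_nonneg_left (h0 x y) (norm_nonneg _)
  have hcont : Continuous fun x => fderiv ℝ (F x) y := by
    have h : ContDiff ℝ (⊤ : ℕ∞) fun x => fderiv ℝ (F x) y :=
      ContDiff.fderiv (n := (⊤ : ℕ∞)) hF contDiff_const (by simp)
    exact h.continuous
  have hle : ∀ x y, ‖w x • fderiv ℝ (F x) y‖ ≤ ‖w x‖ * C₁ := fun x y => by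
    rw [norm_smul]
    exact mul_le_mul_of_nonneg_left (h1 x y) (norm_nonneg _)
  have hint' : Integrable (fun x => w x • fderiv ℝ (F x) y) ν :=
    (hw.norm.mul_const C₁).mono' (hw.1.smul hcont.aestronglyMeasurable)
        (ae_of_all _ fun x => hle x y)
  have hfd : ∀ x y, HasFDerivAt (fun y => w x • F x y) (w x • fderiv ℝ (F x) y) y := fun x y =>
    (((hF.comp (contDiff_prodMk_right x)).differentiable (by simp)) y).hasFDerivAt.const_smul (w x)
  have key := hasFDerivAt_integral_of_dominated_of_fderiv_le (μ := ν) (𝕜 := ℝ)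
    (F := fun y x => w x • F x y) (F' := fun y x => w x • fderiv ℝ (F x) y) (x₀ := y)
    (s := Set.univ) (bound := fun x => ‖w x‖ * C₁) Filter.univ_mem
    (Filter.Eventually.of_forall fun y => (hint y).1) (hint y) hint'.1
    (ae_of_all _ fun x y _ => hle x y) (hw.norm.mul_const C₁) (ae_of_all _ fun x y _ => hfd x y)
  refine ⟨?_, hint'.apply_continuousLinearMap v⟩
  rw [key.fderiv, ContinuousLinearMap.integral_apply hint']
  rfl

theorem iteratedFDeriv_integral_param {X : Type*} [NormedAddCommGroup X] [NormedSpace ℝ X]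
    [MeasurableSpace X] [BorelSpace X] [SecondCountableTopology X] [FiniteDimensional ℝ E]
    {ν : Measure X} {w : X → ℝ} (hw : Integrable w ν)
    {Φ : X → E → ℝ} (hΦ : ContDiff ℝ (⊤ : ℕ∞) (fun p : X × E => Φ p.1 p.2))
    (hb : ∀ i, ∃ C, ∀ x y, ‖iteratedFDeriv ℝ i (Φ x) y‖ ≤ C) (i : ℕ) (y : E) :
    iteratedFDeriv ℝ i (fun y => ∫ x, w x * Φ x y ∂ν) y =
      ∫ x, w x • iteratedFDeriv ℝ i (Φ x) y ∂ν := by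
  have hmeas : ∀ i y, AEStronglyMeasurable (fun x => iteratedFDeriv ℝ i (Φ x) y) ν := fun i y =>
    ((ContDiff.iteratedFDeriv_param hΦ i).continuous.comp
      (Continuous.prodMk_left y)).aestronglyMeasurable
  have hint : ∀ i y, Integrable (fun x => w x • iteratedFDeriv ℝ i (Φ x) y) ν := by
    intro i y
    obtain ⟨C, hC⟩ := hb i
    refine (hw.norm.mul_const C).mono' (hw.1.smul (hmeas i y)) (ae_of_all _ fun x => ?_)
    rw [norm_smul]
    exact mul_le_mul_of_nonneg_left (hC x y) (norm_nonneg _)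
  induction i generalizing y with
  | zero =>
    simp only [iteratedFDeriv_zero_eq_comp, Function.comp_def]
    refine ((continuousMultilinearCurryFin0 ℝ E ℝ).symm.toContinuousLinearEquiv.integral_comp_comm
      _).symm
  | succ i ih =>
    have ih' : iteratedFDeriv ℝ i (fun y => ∫ x, w x * Φ x y ∂ν) =
      fun y => ∫ x, w x • iteratedFDeriv ℝ i (Φ x) y ∂ν := funext ih
    obtain ⟨C₀, h0⟩ := hb i
    obtain ⟨C₁, h1⟩ := hb (i + 1)
    ext m
    obtain ⟨e1, e2⟩ := fderiv_integral_smul_param hw (ContDiff.iteratedFDeriv_param hΦ i) h0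
      (fun x y => (norm_fderiv_iteratedFDeriv (𝕜 := ℝ) (f := Φ x) (n := i) (x := y)).trans_le
        (h1 x y)) y (m 0)
    rw [iteratedFDeriv_succ_apply_left, ih', e1,
      ContinuousMultilinearMap.integral_apply (hint (i + 1) y)]
    exact (ContinuousMultilinearMap.integral_apply e2 _).trans rfl

/-- Hahn–Banach for a linear form that is dominated by the norm of a linear image. -/
theorem exists_strongDual_comp_eq {V Y : Type*} [AddCommGroup V] [Module ℝ V]
    [NormedAddCommGroup Y] [NormedSpace ℝ Y] (T : V →ₗ[ℝ] ℝ) (p : V →ₗ[ℝ] Y) (C : ℝ)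
    (h : ∀ v, |T v| ≤ C * ‖p v‖) : ∃ S : Y →L[ℝ] ℝ, ∀ v, S (p v) = T v := by
  have hker : LinearMap.ker p ≤ LinearMap.ker T := by
    intro v hv
    have := h v
    rw [LinearMap.mem_ker.1 hv, norm_zero, mul_zero] at this
    exact abs_eq_zero.1 (le_antisymm this (abs_nonneg _))
  let f : LinearMap.range p →ₗ[ℝ] ℝ :=
    (Submodule.liftQ _ T hker).comp (p.quotKerEquivRange.symm : LinearMap.range p →ₗ[ℝ] _)
  have hf : ∀ v, f ⟨p v, LinearMap.mem_range_self p v⟩ = T v := by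
    intro v
    have : (⟨p v, LinearMap.mem_range_self p v⟩ : LinearMap.range p) =
      p.quotKerEquivRange (Submodule.Quotient.mk v) := by
      ext; simp
    simp only [f, LinearMap.comp_apply, this, LinearEquiv.coe_coe, LinearEquiv.symm_apply_apply]
    exact Submodule.liftQ_apply _ _ _
  let g : LinearMap.range p →L[ℝ] ℝ := f.mkContinuous C (by
    rintro ⟨_, v, rfl⟩
    rw [hf]
    exact h v)
  obtain ⟨S, hS, -⟩ := exists_extension_norm_eq (LinearMap.range p) g
  exact ⟨S, fun v => (hS ⟨p v, LinearMap.mem_range_self p v⟩).trans (hf v)⟩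

/-- A linear form that is dominated by finitely many of the seminorms `v ↦ ‖p i v‖` commutes with
integrals of families that are continuous and bounded for these seminorms. -/
theorem LinearMap.apply_integral_of_seminorm_bound {V X : Type*} [AddCommGroup V] [Module ℝ V]
    {Y : ℕ → Type*} [∀ i, NormedAddCommGroup (Y i)] [∀ i, NormedSpace ℝ (Y i)]
    [∀ i, CompleteSpace (Y i)] (T : V →ₗ[ℝ] ℝ) (p : ∀ i, V →ₗ[ℝ] Y i) (s : Finset ℕ) (C : ℝ)
    (hT : ∀ v, ∀ B, 0 ≤ B → (∀ i ∈ s, ‖p i v‖ ≤ B) → |T v| ≤ |C| * B)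
    [TopologicalSpace X] [SecondCountableTopology X] [MeasurableSpace X] [OpensMeasurableSpace X]
    (Φ : X → V) (hc : ∀ i, Continuous fun x => p i (Φ x)) (hb : ∀ i, ∃ C, ∀ x, ‖p i (Φ x)‖ ≤ C) :
    Continuous (fun x => T (Φ x)) ∧ (∃ C, ∀ x, |T (Φ x)| ≤ C) ∧
    ∀ (ν : Measure X) (w : X → ℝ), Integrable w ν →
      ∀ J : V, (∀ i, Integrable (fun x => w x • p i (Φ x)) ν → p i J = ∫ x, w x • p i (Φ x) ∂ν) →
        T J = ∫ x, w x * T (Φ x) ∂ν := by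
  obtain ⟨S, hS⟩ := exists_strongDual_comp_eq T (LinearMap.pi fun i : s => p i) |C| fun v =>
    hT v _ (norm_nonneg _) fun i hi => norm_le_pi_norm (LinearMap.pi (fun i : s => p i) v) ⟨i, hi⟩
  set j : X → ∀ i : s, Y i := fun x => LinearMap.pi (fun i : s => p i) (Φ x) with hjdef
  have hj : Continuous j := continuous_pi fun i => hc i
  have hTj : ∀ x, T (Φ x) = S (j x) := fun x => (hS _).symm
  choose D hD using hb
  obtain ⟨M, hM⟩ : ∃ M, ∀ x, ‖j x‖ ≤ M := by
    refine ⟨∑ i ∈ s, |D i|, fun x => ?_⟩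
    rw [pi_norm_le_iff_of_nonneg (Finset.sum_nonneg fun _ _ => abs_nonneg _)]
    intro i
    refine (hD i x).trans ((le_abs_self _).trans ?_)
    exact Finset.single_le_sum (f := fun i => |D i|) (fun _ _ => abs_nonneg _) i.2
  refine ⟨?_, ⟨‖S‖ * M, fun x => ?_⟩, ?_⟩
  · simp only [hTj]
    exact S.continuous.comp hj
  · rw [hTj]
    exact (S.le_opNorm _).trans (mul_le_mul_of_nonneg_left (hM x) (norm_nonneg _))
  · intro ν w hw J hJ
    have hint : Integrable (fun x => w x • j x) ν := by
      refine (hw.norm.mul_const M).mono' (hw.1.smul hj.aestronglyMeasurable)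
        (ae_of_all _ fun x => ?_)
      rw [norm_smul]
      exact mul_le_mul_of_nonneg_left (hM x) (norm_nonneg _)
    have h1 : LinearMap.pi (fun i : s => p i) J = ∫ x, w x • j x ∂ν := by
      ext i
      rw [LinearMap.pi_apply, hJ i
        ((ContinuousLinearMap.proj (R := ℝ) (φ := fun i : s => Y i) i).integrable_comp hint)]
      exact (ContinuousLinearMap.proj (R := ℝ) (φ := fun i : s => Y i) i).integral_comp_comm hint
    rw [← hS, h1, ← S.integral_comp_comm hint]
    congr 1
    ext x
    rw [map_smul, hTj, smul_eq_mul]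

section Param

variable [FiniteDimensional ℝ E] {X : Type*} [NormedAddCommGroup X] [NormedSpace ℝ X]
  {K : Compacts E} {Φ : X → 𝓓((⊤ : Opens E), ℝ)}

/-- A distribution commutes with integrals of smooth families of test functions that are supported
in a fixed compact set `K` and have bounded derivatives: on the test functions supported in `K` it
is dominated by finitely many of the norms of the iterated derivatives in `C(K, E [×i]→L[ℝ] ℝ)`. The
integral `J` of the family is given as a test function. -/
theorem Distribution.apply_integral_param [MeasurableSpace X] [BorelSpace X]
    [SecondCountableTopology X] (T : 𝓓'((⊤ : Opens E), ℝ))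
    (hΦ : ContDiff ℝ (⊤ : ℕ∞) (fun p : X × E => Φ p.1 p.2))
    (hK : ∀ x, Function.support (Φ x) ⊆ K)
    (hb : ∀ i, ∃ C, ∀ x y, ‖iteratedFDeriv ℝ i (Φ x) y‖ ≤ C) :
    Continuous (fun x => T (Φ x)) ∧ (∃ C, ∀ x, |T (Φ x)| ≤ C) ∧
    ∀ (ν : Measure X) (w : X → ℝ), Integrable w ν →
      ∀ J : 𝓓((⊤ : Opens E), ℝ), (∀ y, J y = ∫ x, w x * Φ x y ∂ν) →
        T J = ∫ x, w x * T (Φ x) ∂ν := by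
  have hKtop : (K : Set E) ⊆ (⊤ : Opens E) := fun x _ => trivial
  let TK : 𝓓_{K}(E, ℝ) →L[ℝ] ℝ :=
    (show 𝓓((⊤ : Opens E), ℝ) →L[ℝ] ℝ from T).comp (TestFunction.ofSupportedInCLM ℝ hKtop)
  obtain ⟨s, C, hC⟩ : ∃ (s : Finset ℕ) (C : ℝ), ∀ f, |TK f| ≤
      C * (s.sup (ContDiffMapSupportedIn.seminorm ℝ E ℝ ⊤ K)) f := by
    obtain ⟨s, C, -, h⟩ := Seminorm.bound_of_continuous
      (ContDiffMapSupportedIn.withSeminorms ℝ E ℝ ⊤ K) ((normSeminorm ℝ ℝ).comp TK.toLinearMap)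
      (continuous_norm.comp TK.continuous)
    exact ⟨s, C, fun f => h f⟩
  let p : ∀ i : ℕ, 𝓓_{K}(E, ℝ) →ₗ[ℝ] C(K, E [×i]→L[ℝ] ℝ) := fun i =>
    { toFun := fun f => (ContDiffMapSupportedIn.structureMapLM ℝ ⊤ i f
          ).toContinuousMap.restrict (K : Set E)
      map_add' := fun f g => by rw [map_add]; rfl
      map_smul' := fun c f => by rw [map_smul]; rfl }
  have hp : ∀ f (i : ℕ) (x : K), p i f x = iteratedFDeriv ℝ i f x := by
    intro f i x
    change ContDiffMapSupportedIn.structureMapLM ℝ ⊤ i f x = _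
    rw [ContDiffMapSupportedIn.structureMapLM_top_apply]
  have hT : ∀ f, ∀ B, 0 ≤ B → (∀ i ∈ s, ‖p i f‖ ≤ B) → |TK f| ≤ |C| * B := by
    intro f B hB0 hB
    refine (hC f).trans ((mul_le_mul_of_nonneg_right (le_abs_self C) (apply_nonneg _ _)).trans ?_)
    refine mul_le_mul_of_nonneg_left (Seminorm.finset_sup_apply_le hB0
      fun i hi => ?_) (abs_nonneg _)
    rw [ContDiffMapSupportedIn.seminorm_top_le_iff ℝ hB0]
    intro x hx
    rw [← hp f i ⟨x, hx⟩]
    exact (ContinuousMap.norm_coe_le_norm _ _).trans (hB i hi)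
  let ΦK : X → 𝓓_{K}(E, ℝ) := fun x =>
    ContDiffMapSupportedIn.of_support_subset (Φ x).contDiff (hK x)
  have hj : ∀ i, Continuous fun x => p i (ΦK x) := by
    intro i
    let F : C(X × K, E [×i]→L[ℝ] ℝ) := ⟨fun q => iteratedFDeriv ℝ i (Φ q.1) q.2,
      (ContDiff.iteratedFDeriv_param (Φ := fun x => Φ x) hΦ i).continuous.comp
        (continuous_fst.prodMk (continuous_subtype_val.comp continuous_snd))⟩
    refine F.curry.continuous.congr fun x => ?_
    ext1 y
    rw [hp]
    rfl
  have hbK : ∀ i, ∃ C, ∀ x, ‖p i (ΦK x)‖ ≤ C := by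
    intro i
    obtain ⟨C, hC⟩ := hb i
    refine ⟨|C|, fun x => ?_⟩
    rw [ContinuousMap.norm_le _ (abs_nonneg _)]
    intro y
    rw [hp]
    exact (hC x y).trans (le_abs_self _)
  obtain ⟨h1, h2, h3⟩ := LinearMap.apply_integral_of_seminorm_bound
    (Y := fun i => C(K, E [×i]→L[ℝ] ℝ)) TK.toLinearMap p s C hT ΦK hj hbK
  refine ⟨h1, h2, fun ν w hw J hJ => ?_⟩
  have hJ' : (J : E → ℝ) = fun y => ∫ x, w x * Φ x y ∂ν := funext hJ
  have hsupp : Function.support J ⊆ K := by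
    intro y hy
    by_contra hyK
    refine hy ?_
    rw [hJ]
    have : ∀ x, Φ x y = 0 := fun x => Function.notMem_support.1 fun h => hyK (hK x h)
    simp [this]
  refine h3 ν w hw (ContDiffMapSupportedIn.of_support_subset J.contDiff hsupp) fun i hint => ?_
  ext1 y
  rw [hp]
  rw [ContinuousMap.integral_apply hint]
  change iteratedFDeriv ℝ i J y = _
  rw [hJ', iteratedFDeriv_integral_param hw hΦ hb]
  congr 1

end Param

/-- A distribution vanishes on the test functions that vanish near its support: a partition of unity
splits such a test function into pieces supported in open sets on which the distribution vanishes.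
-/
theorem Distribution.apply_eq_zero_of_eventuallyEq_zero [FiniteDimensional ℝ E]
    (T : 𝓓'((⊤ : Opens E), ℝ)) (h : 𝓓((⊤ : Opens E), ℝ))
    (hh : ∀ᶠ x in 𝓝ˢ (Distribution.dsupport T), h x = 0) : T h = 0 := by
  have hdisj : tsupport h ⊆ (Distribution.dsupport T)ᶜ := by
    intro x hx hxT
    have h1 : ∀ᶠ y in 𝓝 x, h y = 0 := hh.filter_mono (nhds_le_nhdsSet hxT)
    exact (notMem_tsupport_iff_eventuallyEq.2 h1) hx
  let ι := {a : Set E // Distribution.IsVanishingOn T a ∧ IsOpen a}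
  have hcov : tsupport h ⊆ ⋃ i : ι, (i : Set E) := by
    intro x hx
    have := hdisj hx
    rw [Distribution.dsupport_compl_eq] at this
    obtain ⟨a, ha, hxa⟩ := this
    exact Set.mem_iUnion.2 ⟨⟨a, ha⟩, hxa⟩
  obtain ⟨f, hf⟩ := SmoothPartitionOfUnity.exists_isSubordinate (modelWithCornersSelf ℝ E)
    (isClosed_tsupport h) (fun i : ι => (i : Set E)) (fun i => i.2.2) hcov
  have hfin := f.locallyFinite.finite_nonempty_inter_compact h.hasCompactSupport.isCompact
  let g : ι → 𝓓((⊤ : Opens E), ℝ) := fun i =>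
    ⟨fun x => f i x * h x, (f i).contMDiff.contDiff.mul h.contDiff, h.hasCompactSupport.mul_left,
      fun _ _ => trivial⟩
  have hsum : h = ∑ i ∈ hfin.toFinset, g i := by
    ext x
    rw [FunLike.coe_sum, Finset.sum_apply]
    change h x = ∑ i ∈ hfin.toFinset, f i x * h x
    by_cases hx : x ∈ tsupport h
    · rw [← Finset.sum_mul]
      have h1 := f.sum_eq_one hx
      rw [finsum_eq_sum_of_support_subset (s := hfin.toFinset)] at h1
      · rw [h1, one_mul]
      · intro i hi
        rw [Set.Finite.coe_toFinset]
        exact ⟨x, hi, hx⟩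
    · rw [image_eq_zero_of_notMem_tsupport hx]
      simp
  rw [hsum, map_sum]
  refine Finset.sum_eq_zero fun i _ => ?_
  refine i.2.1 (g i) ?_
  exact (tsupport_mul_subset_left (f := f i) (g := h)).trans (hf i)

end Distributions

/-! ### Kernels, second differences and the singular integral -/

section Kernels

open Metric

variable {E : Type} [NormedAddCommGroup E] [InnerProductSpace ℝ E] [FiniteDimensional ℝ E]
  [MeasurableSpace E] [BorelSpace E]

/-- The kernel `‖h‖^(-(n+α))` of the fractional Laplacian on an `n`-dimensional space. -/
def fracKernel (α : ℝ) (h : E) : ℝ := ‖h‖ ^ (-(Module.finrank ℝ E + α))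

/-- The symmetric second difference `2 f(x) - f(x+h) - f(x-h)`. -/
def secondDiff (f : E → ℝ) (x h : E) : ℝ := 2 * f x - f (x + h) - f (x - h)

/-- The fractional Laplacian as an absolutely convergent singular integral, up to a normalising
constant that depends on the dimension and on `α`. It is denoted `Λ` in comments. -/
def singularLaplacian (α : ℝ) (f : E → ℝ) (x : E) : ℝ := ∫ h, secondDiff f x h * fracKernel α h

/-- The Riesz potential: the convolution of `φ` with the kernel `‖z‖^(-p)`. The kernel is even, so
that the convolution may be written with `φ (x + z)`. It is denoted `P φ` in comments. -/
def rieszPotential (p : ℝ) (φ : E → ℝ) (x : E) : ℝ := ∫ z, ‖z‖ ^ (-p) * φ (x + z)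

theorem fracKernel_nonneg (α : ℝ) (h : E) : 0 ≤ fracKernel α h := Real.rpow_nonneg (norm_nonneg _) _

theorem fracKernel_neg (α : ℝ) (h : E) : fracKernel α (-h) = fracKernel α h := by
  simp [fracKernel]

theorem measurable_norm_rpow (p : ℝ) : Measurable fun z : E => ‖z‖ ^ p := by fun_prop

theorem measurable_fracKernel (α : ℝ) : Measurable (fracKernel α : E → ℝ) := by
  unfold fracKernel; fun_prop

theorem integrableOn_ball_norm_rpow [Nontrivial E] {p : ℝ} (hp : p < Module.finrank ℝ E) :
    IntegrableOn (fun z : E => ‖z‖ ^ (-p)) (ball 0 1) := by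
  rw [integrableOn_fun_norm_addHaar volume (f := fun r => r ^ (-p))]
  have hn : 1 ≤ Module.finrank ℝ E := Module.finrank_pos
  have h1 : IntegrableOn (fun r : ℝ => r ^ ((Module.finrank ℝ E : ℝ) - 1 - p)) (Set.Ioo 0 1) := by
    rw [intervalIntegral.integrableOn_Ioo_rpow_iff zero_lt_one]
    linarith
  refine h1.congr_fun (fun r hr => ?_) measurableSet_Ioo
  simp only [smul_eq_mul]
  rw [← Real.rpow_natCast, ← Real.rpow_add hr.1, Nat.cast_sub hn]
  congr 1
  push_cast
  ring

theorem integrable_min_sq_mul_fracKernel [Nontrivial E] {α : ℝ} (h0 : 0 < α) (h2 : α < 2) :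
    Integrable (fun h : E => min (‖h‖ ^ 2) 1 * fracKernel α h) := by
  unfold fracKernel
  rw [integrable_fun_norm_addHaar volume
    (f := fun r => min (r ^ 2) 1 * r ^ (-(Module.finrank ℝ E + α) : ℝ))]
  have hn : 1 ≤ Module.finrank ℝ E := Module.finrank_pos
  have hpow : ∀ r : ℝ, 0 < r → r ^ (Module.finrank ℝ E - 1) * r ^ (-(Module.finrank ℝ E + α) : ℝ) =
      r ^ (-1 - α) := by
    intro r hr
    rw [← Real.rpow_natCast, ← Real.rpow_add hr, Nat.cast_sub hn]
    congr 1
    push_cast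
    ring
  have hU : Set.Ioi (0 : ℝ) = Set.Ioc 0 1 ∪ Set.Ioi 1 :=
    (Set.Ioc_union_Ioi_eq_Ioi zero_le_one).symm
  rw [hU, integrableOn_union]
  constructor
  · have h1 : IntegrableOn (fun r : ℝ => r ^ (1 - α)) (Set.Ioc 0 1) := by
      rw [integrableOn_Ioc_iff_integrableOn_Ioo,
        intervalIntegral.integrableOn_Ioo_rpow_iff zero_lt_one]
      linarith
    refine h1.congr_fun (fun r hr => ?_) measurableSet_Ioc
    have hr2 : r ^ 2 ≤ 1 := pow_le_one₀ hr.1.le hr.2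
    simp only [smul_eq_mul]
    rw [min_eq_left hr2, mul_left_comm, hpow r hr.1, ← Real.rpow_natCast, ← Real.rpow_add hr.1]
    congr 1
    push_cast
    ring
  · have h1 : IntegrableOn (fun r : ℝ => r ^ (-1 - α)) (Set.Ioi 1) :=
      integrableOn_Ioi_rpow_of_lt (by linarith) zero_lt_one
    refine h1.congr_fun (fun r hr => ?_) measurableSet_Ioi
    have hr1 : (1 : ℝ) < r := hr
    have hr2 : 1 ≤ r ^ 2 := one_le_pow₀ hr1.le
    simp only [smul_eq_mul]
    rw [min_eq_right hr2, one_mul, hpow r (by linarith)]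

/-- The mass of `‖z‖^(-p)` on the unit ball. -/
def ballMass (E : Type) [NormedAddCommGroup E] [InnerProductSpace ℝ E] [FiniteDimensional ℝ E]
    [MeasurableSpace E] [BorelSpace E] (p : ℝ) : ℝ := ∫ z in ball (0 : E) 1, ‖z‖ ^ (-p)

theorem norm_rpow_mul_le {p : ℝ} (hp : 0 ≤ p) {a A : ℝ} (ha : |a| ≤ A) (z : E) :
    ‖z‖ ^ (-p) * |a| ≤ A * (ball (0 : E) 1).indicator (fun z => ‖z‖ ^ (-p)) z + |a| := by
  by_cases hz : z ∈ ball (0 : E) 1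
  · rw [Set.indicator_of_mem hz, mul_comm A]
    have := mul_le_mul_of_nonneg_left ha (Real.rpow_nonneg (norm_nonneg z) (-p))
    linarith [abs_nonneg a]
  · rw [Set.indicator_of_notMem hz, mul_zero, zero_add]
    have hz1 : 1 ≤ ‖z‖ := by simpa using hz
    have := Real.rpow_le_one_of_one_le_of_nonpos hz1 (neg_nonpos.2 hp)
    exact mul_le_of_le_one_left (abs_nonneg _) this

/-- A kernel bounded by `‖z‖^(-p)`, `p < n`, is integrable against bounded integrable functions. -/
theorem integrable_singular_mul [Nontrivial E] {p : ℝ} (hp : 0 ≤ p) (hpn : p < Module.finrank ℝ E)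
    {κ : E → ℝ} (hκ : Measurable κ) (hκp : ∀ z, |κ z| ≤ ‖z‖ ^ (-p)) {g : E → ℝ} (hg : Integrable g)
    {A : ℝ} (hA : ∀ z, |g z| ≤ A) :
    Integrable (fun z => κ z * g z) ∧ ∫ z, |κ z * g z| ≤ A * ballMass E p + ∫ z, |g z| := by
  have hind : Integrable ((ball (0 : E) 1).indicator fun z => ‖z‖ ^ (-p)) :=
    (integrable_indicator_iff measurableSet_ball).2 (integrableOn_ball_norm_rpow hpn)
  have hle : ∀ z, |κ z * g z| ≤
      A * (ball (0 : E) 1).indicator (fun z => ‖z‖ ^ (-p)) z + |g z| := by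
    intro z
    rw [abs_mul]
    exact (mul_le_mul_of_nonneg_right (hκp z) (abs_nonneg _)).trans (norm_rpow_mul_le hp (hA z) z)
  have hdom := (hind.const_mul A).add hg.abs
  have hint : Integrable (fun z => κ z * g z) :=
    hdom.mono' (hκ.aestronglyMeasurable.mul hg.1) (ae_of_all _ hle)
  refine ⟨hint, (integral_mono hint.abs hdom hle).trans_eq ?_⟩
  simp only [Pi.add_apply]
  rw [integral_add (hind.const_mul A) hg.abs, integral_const_mul, integral_indicator
      measurableSet_ball]
  rfl

theorem abs_secondDiff_le {f : E → ℝ} {A : ℝ} (hA : ∀ x, |f x| ≤ A) (x h : E) :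
    |secondDiff f x h| ≤ 4 * A := by
  have h1 := abs_le.1 (hA x)
  have h2 := abs_le.1 (hA (x + h))
  have h3 := abs_le.1 (hA (x - h))
  unfold secondDiff
  rw [abs_le]
  constructor <;> linarith

/-- `|secondDiff f x h| ≤ M min(‖h‖², 1)`, the bound that makes the singular integral converge
absolutely for `0 < α < 2`. It holds for all functions with bounded derivatives of order `0` and
`2`, without any decay at infinity. -/
def SecondDiffBound (f : E → ℝ) (M : ℝ) : Prop :=
  ∀ x h, |secondDiff f x h| ≤ M * min (‖h‖ ^ 2) 1

theorem secondDiffBound_of_iteratedFDeriv {f : E → ℝ} (hf : ContDiff ℝ 2 f) {A B : ℝ}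
    (hA : ∀ x, |f x| ≤ A) (hB : ∀ x, ‖iteratedFDeriv ℝ 2 f x‖ ≤ B) :
    SecondDiffBound f (4 * A + 2 * B) := by
  have hA0 : 0 ≤ A := (abs_nonneg _).trans (hA 0)
  have hB0 : 0 ≤ B := (norm_nonneg _).trans (hB 0)
  have hdiff : Differentiable ℝ f := hf.differentiable (by norm_num)
  have hlip : ∀ y z, ‖fderiv ℝ f y - fderiv ℝ f z‖ ≤ B * ‖y - z‖ := by
    intro y z
    refine Convex.norm_image_sub_le_of_norm_fderiv_le (𝕜 := ℝ) (s := Set.univ)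
      (fun x _ => (hf.fderiv_right (m := 1) (by norm_num)).differentiable (by norm_num) x)
      (fun x _ => ?_) convex_univ trivial trivial
    rw [← norm_iteratedFDeriv_one, norm_iteratedFDeriv_fderiv]
    exact hB x
  intro x h
  have h2 : |secondDiff f x h| ≤ 2 * B * ‖h‖ ^ 2 := by
    have hd : ∀ t : ℝ, HasDerivAt (fun t : ℝ => f (x + t • h) + f (x - t • h))
        (fderiv ℝ f (x + t • h) h - fderiv ℝ f (x - t • h) h) t := by
      intro t
      have e1 : HasDerivAt (fun t : ℝ => x + t • h) h t := by
        simpa using ((hasDerivAt_id t).smul_const h).const_add x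
      have e2 : HasDerivAt (fun t : ℝ => x - t • h) (-h) t := by
        simpa using ((hasDerivAt_id t).smul_const h).const_sub x
      have := ((hdiff _).hasFDerivAt.comp_hasDerivAt t e1).add
        ((hdiff _).hasFDerivAt.comp_hasDerivAt t e2)
      exact this.congr_deriv (by simp [sub_eq_add_neg])
    have := norm_image_sub_le_of_norm_deriv_le_segment_01' (C := 2 * B * ‖h‖ ^ 2)
      (fun t _ => (hd t).hasDerivWithinAt) (fun t ht => by
        rw [← _root_.sub_apply]
        refine (ContinuousLinearMap.le_opNorm _ _).trans ?_
        have h3 := hlip (x + t • h) (x - t • h)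
        have h4 : ‖x + t • h - (x - t • h)‖ ≤ 2 * ‖h‖ := by
          rw [show x + t • h - (x - t • h) = (2 * t) • h by module, norm_smul]
          refine mul_le_mul_of_nonneg_right ?_ (norm_nonneg _)
          rw [Real.norm_eq_abs, abs_of_nonneg (by linarith [ht.1])]
          linarith [ht.2]
        calc _ ≤ (B * (2 * ‖h‖)) * ‖h‖ := mul_le_mul_of_nonneg_right
              (h3.trans (mul_le_mul_of_nonneg_left h4 hB0)) (norm_nonneg _)
          _ = _ := by ring)
    rw [Real.norm_eq_abs] at this
    simp only [one_smul, zero_smul, add_zero, sub_zero] at this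
    refine le_trans (le_of_eq ?_) this
    rw [← abs_neg, secondDiff]
    congr 1
    ring
  rcases le_total (‖h‖ ^ 2) 1 with hh | hh
  · rw [min_eq_left hh]
    have := mul_nonneg hA0 (sq_nonneg ‖h‖)
    linarith
  · rw [min_eq_right hh]
    have := abs_secondDiff_le hA x h
    linarith

theorem ContDiff.exists_secondDiffBound {f : E → ℝ} (hf : ContDiff ℝ 2 f)
    (hc : HasCompactSupport f) :
    ∃ A M : ℝ, (∀ x, |f x| ≤ A) ∧ SecondDiffBound f M := by
  obtain ⟨A, hA⟩ := hf.continuous.bounded_above_of_compact_support hc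
  obtain ⟨B, hB⟩ := (hf.continuous_iteratedFDeriv (m := 2) le_rfl).bounded_above_of_compact_support
    (hc.iteratedFDeriv 2)
  exact ⟨A, _, hA, secondDiffBound_of_iteratedFDeriv hf hA hB⟩

theorem SecondDiffBound.nonneg {f : E → ℝ} {M : ℝ} [Nontrivial E] (h : SecondDiffBound f M) :
    0 ≤ M := by
  obtain ⟨v, hv⟩ := exists_ne (0 : E)
  have h1 := (abs_nonneg _).trans (h 0 v)
  have h2 : 0 < min (‖v‖ ^ 2) 1 := lt_min (by positivity) one_pos
  exact nonneg_of_mul_nonneg_left h1 h2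

/-- The constant `∫ min(‖h‖², 1) ‖h‖^(-(n+α)) dh`. -/
def levyMass (E : Type) [NormedAddCommGroup E] [InnerProductSpace ℝ E] [FiniteDimensional ℝ E]
    [MeasurableSpace E] [BorelSpace E] (α : ℝ) : ℝ := ∫ h : E, min (‖h‖ ^ 2) 1 * fracKernel α h

theorem levyMass_nonneg (α : ℝ) : 0 ≤ levyMass E α :=
  integral_nonneg fun _ => mul_nonneg (le_min (sq_nonneg _) zero_le_one) (fracKernel_nonneg _ _)

theorem continuous_secondDiff {f : E → ℝ} (hf : Continuous f) :
    Continuous fun q : E × E => secondDiff f q.1 q.2 := by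
  unfold secondDiff; fun_prop

theorem integrable_secondDiff_mul [Nontrivial E] {α : ℝ} (h0 : 0 < α) (h2 : α < 2) {f : E → ℝ}
    (hf : Continuous f) {M : ℝ} (hM : SecondDiffBound f M) (x : E) :
    Integrable fun h => secondDiff f x h * fracKernel α h := by
  refine ((integrable_min_sq_mul_fracKernel h0 h2).const_mul M).mono'
    (((continuous_secondDiff hf).comp (Continuous.prodMk_right x)).aestronglyMeasurable.mul
      (measurable_fracKernel α).aestronglyMeasurable) (ae_of_all _ fun h => ?_)
  rw [norm_mul, Real.norm_eq_abs, Real.norm_eq_abs, abs_of_nonneg (fracKernel_nonneg α h),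
    ← mul_assoc]
  exact mul_le_mul_of_nonneg_right (hM x h) (fracKernel_nonneg α h)

theorem abs_singularLaplacian_le [Nontrivial E] {α : ℝ} (h0 : 0 < α) (h2 : α < 2) {f : E → ℝ}
    {M : ℝ} (hM : SecondDiffBound f M) (x : E) :
    |singularLaplacian α f x| ≤ M * levyMass E α := by
  rw [levyMass, ← integral_const_mul, singularLaplacian, ← Real.norm_eq_abs]
  refine norm_integral_le_of_norm_le ((integrable_min_sq_mul_fracKernel (E := E) h0 h2).const_mul M)
    (ae_of_all _ fun h => ?_)
  rw [norm_mul, Real.norm_eq_abs, Real.norm_eq_abs, abs_of_nonneg (fracKernel_nonneg α h),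
    ← mul_assoc]
  exact mul_le_mul_of_nonneg_right (hM x h) (fracKernel_nonneg α h)

theorem continuous_singularLaplacian [Nontrivial E] {α : ℝ} (h0 : 0 < α) (h2 : α < 2) {f : E → ℝ}
    (hf : Continuous f) {M : ℝ} (hM : SecondDiffBound f M) :
    Continuous (singularLaplacian α f) := by
  refine continuous_of_dominated (fun x => (integrable_secondDiff_mul h0 h2 hf hM x).1)
    (bound := fun h => M * (min (‖h‖ ^ 2) 1 * fracKernel α h)) (fun x => ae_of_all _ fun h => ?_)
    ((integrable_min_sq_mul_fracKernel h0 h2).const_mul M) (ae_of_all _ fun h => ?_)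
  · rw [norm_mul, Real.norm_eq_abs, Real.norm_eq_abs, abs_of_nonneg (fracKernel_nonneg α h),
      ← mul_assoc]
    exact mul_le_mul_of_nonneg_right (hM x h) (fracKernel_nonneg α h)
  · exact ((continuous_secondDiff hf).comp (Continuous.prodMk_left h)).mul continuous_const

/-- At a positive distance from the support of `f`, the singular integral is minus twice the
convolution with the kernel. -/
theorem singularLaplacian_of_eq_zero [Nontrivial E] {α : ℝ} (h0 : 0 < α) {f : E → ℝ}
    (hf : Integrable f) {x : E} {r : ℝ} (hr : 0 < r) (hx : ∀ y, ‖y - x‖ < r → f y = 0) :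
    Integrable (fun y => f y * fracKernel α (y - x)) ∧
      singularLaplacian α f x = -2 * ∫ y, f y * fracKernel α (y - x) := by
  have hβ : -(Module.finrank ℝ E + α) ≤ 0 := by
    have : (0 : ℝ) ≤ Module.finrank ℝ E := Nat.cast_nonneg _
    linarith
  have h1 : Integrable (fun y => f y * fracKernel α (y - x)) := by
    refine (hf.norm.mul_const (r ^ (-(Module.finrank ℝ E + α)))).mono'
      (hf.1.mul ((measurable_fracKernel α).comp (measurable_sub_const x)).aestronglyMeasurable)
      (ae_of_all _ fun y => ?_)
    rw [norm_mul]
    by_cases hy : ‖y - x‖ < r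
    · simp [hx y hy]
    · refine mul_le_mul_of_nonneg_left ?_ (norm_nonneg _)
      rw [Real.norm_of_nonneg (fracKernel_nonneg _ _)]
      exact Real.rpow_le_rpow_of_nonpos hr (not_lt.1 hy) hβ
  have hx0 : f x = 0 := hx x (by simpa using hr)
  have h2 : Integrable (fun h => f (x + h) * fracKernel α h) := by
    have := h1.comp_add_left x
    simpa using this
  have h3 : Integrable (fun h => f (x - h) * fracKernel α h) := by
    have := h2.comp_neg
    simpa [fracKernel_neg, ← sub_eq_add_neg] using this
  have e2 : ∫ h, f (x + h) * fracKernel α h = ∫ y, f y * fracKernel α (y - x) := by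
    rw [← integral_add_left_eq_self (fun y => f y * fracKernel α (y - x)) x]
    simp
  have e3 : ∫ h, f (x - h) * fracKernel α h = ∫ h, f (x + h) * fracKernel α h := by
    rw [← integral_neg_eq_self (fun h => f (x + h) * fracKernel α h)]
    simp [fracKernel_neg, ← sub_eq_add_neg]
  refine ⟨h1, ?_⟩
  have : singularLaplacian α f x =
      ∫ h, (-(f (x + h) * fracKernel α h) - f (x - h) * fracKernel α h) := by
    refine integral_congr_ae (ae_of_all _ fun h => ?_)
    simp only [secondDiff, hx0]
    ring
  have h2' : Integrable (fun h => -(f (x + h) * fracKernel α h)) := h2.neg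
  rw [this, integral_sub h2' h3, integral_neg, e3, e2]
  ring

/-- Uniform decay of the fractional Laplacian of functions supported in a fixed ball. -/
theorem exists_singularLaplacian_decay [Nontrivial E] {α : ℝ} (h0 : 0 < α) (h2 : α < 2) (R : ℝ) :
    ∃ C : ℝ, 0 ≤ C ∧ ∀ f : E → ℝ, Continuous f → (∀ x, R < ‖x‖ → f x = 0) → ∀ A M : ℝ,
      (∀ x, |f x| ≤ A) → SecondDiffBound f M →
      ∀ x, |singularLaplacian α f x| ≤ C * (A + M) * (1 + ‖x‖) ^ (-(Module.finrank ℝ E + α)) := by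
  wlog hR : 1 ≤ R generalizing R
  · obtain ⟨C, hC0, hC⟩ := this (max R 1) (le_max_right _ _)
    exact ⟨C, hC0, fun f hf hs => hC f hf fun x hx => hs x ((le_max_left _ _).trans_lt hx)⟩
  set β : ℝ := Module.finrank ℝ E + α with hβdef
  have hβ : 0 < β := by
    have : (0 : ℝ) ≤ Module.finrank ℝ E := Nat.cast_nonneg _
    linarith
  have hJ := levyMass_nonneg (E := E) α
  set V : ℝ := volume.real (closedBall (0 : E) R)
  have hV : 0 ≤ V := measureReal_nonneg
  refine ⟨levyMass E α * (1 + 2 * R) ^ β + 2 * V * 4 ^ β, by positivity, ?_⟩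
  intro f hf hs A M hA hM x
  have hA0 : 0 ≤ A := (abs_nonneg _).trans (hA 0)
  have hM0 : 0 ≤ M := hM.nonneg
  have hx0 := norm_nonneg x
  have hfc : HasCompactSupport f := HasCompactSupport.intro (isCompact_closedBall (0 : E) R)
    fun y hy => hs y (by simpa using hy)
  have hpos : 0 < (1 + ‖x‖) ^ (-β) := Real.rpow_pos_of_pos (by linarith) _
  rcases lt_or_ge ‖x‖ (2 * R) with hx | hx
  · have h3 : 1 ≤ (1 + 2 * R) ^ β * (1 + ‖x‖) ^ (-β) := by
      rw [Real.rpow_neg (by linarith), ← div_eq_mul_inv, one_le_div (by positivity)]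
      exact Real.rpow_le_rpow (by linarith) (by linarith) hβ.le
    calc |singularLaplacian α f x| ≤ M * levyMass E α := abs_singularLaplacian_le h0 h2 hM x
      _ ≤ M * levyMass E α * ((1 + 2 * R) ^ β * (1 + ‖x‖) ^ (-β)) :=
          le_mul_of_one_le_right (by positivity) h3
      _ = levyMass E α * (1 + 2 * R) ^ β * M * (1 + ‖x‖) ^ (-β) := by ring
      _ ≤ _ := by
          refine mul_le_mul_of_nonneg_right ?_ hpos.le
          refine mul_le_mul (le_add_of_nonneg_right (by positivity)) (by linarith) hM0
              (by positivity)
  · have hxr : ∀ y, ‖y - x‖ < R → f y = 0 := by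
      intro y hy
      refine hs y ?_
      have := norm_sub_norm_le x y
      rw [norm_sub_rev] at this
      linarith
    obtain ⟨h3, h4⟩ := singularLaplacian_of_eq_zero h0 (hf.integrable_of_hasCompactSupport hfc)
      (by linarith) hxr
    have hle : ∀ y, ‖f y * fracKernel α (y - x)‖ ≤
        (closedBall (0 : E) R).indicator (fun _ => A * (4 ^ β * (1 + ‖x‖) ^ (-β))) y := by
      intro y
      by_cases hy : y ∈ closedBall (0 : E) R
      · rw [Set.indicator_of_mem hy, norm_mul, Real.norm_of_nonneg (fracKernel_nonneg _ _)]
        refine mul_le_mul (hA y) ?_ (fracKernel_nonneg _ _) hA0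
        have hy' : ‖y‖ ≤ R := by simpa using hy
        have h5 : (1 + ‖x‖) / 4 ≤ ‖y - x‖ := by
          have := norm_sub_norm_le x y
          rw [norm_sub_rev] at this
          linarith
        calc fracKernel α (y - x) ≤ ((1 + ‖x‖) / 4) ^ (-β) :=
              Real.rpow_le_rpow_of_nonpos (by linarith) h5 (by linarith)
          _ = 4 ^ β * (1 + ‖x‖) ^ (-β) := by
              rw [Real.div_rpow (by linarith) (by norm_num), Real.rpow_neg
                  (by norm_num : (0:ℝ) ≤ 4),
                div_inv_eq_mul, mul_comm]
      · rw [Set.indicator_of_notMem hy, hs y (by simpa using hy)]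
        simp
    have h6 : |∫ y, f y * fracKernel α (y - x)| ≤ V * (A * (4 ^ β * (1 + ‖x‖) ^ (-β))) := by
      refine (norm_integral_le_of_norm_le ((integrable_indicator_iff measurableSet_closedBall).2
        (integrableOn_const measure_closedBall_lt_top.ne)) (ae_of_all _ hle)).trans_eq ?_
      rw [integral_indicator measurableSet_closedBall, setIntegral_const, smul_eq_mul]
    rw [h4, abs_mul, abs_neg, abs_two]
    calc 2 * |∫ y, f y * fracKernel α (y - x)| ≤ 2 * (V * (A * (4 ^ β * (1 + ‖x‖) ^ (-β)))) := by
          linarith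
      _ = 2 * V * 4 ^ β * A * (1 + ‖x‖) ^ (-β) := by ring
      _ ≤ _ := by
          refine mul_le_mul_of_nonneg_right ?_ hpos.le
          refine mul_le_mul (le_add_of_nonneg_left (by positivity)) (by linarith) hA0
              (by positivity)

theorem ContDiff.singularLaplacian_decay [Nontrivial E] {α : ℝ} (h0 : 0 < α) (h2 : α < 2)
    {f : E → ℝ} (hf : ContDiff ℝ 2 f) (hc : HasCompactSupport f) :
    Continuous (singularLaplacian α f) ∧
    ∃ C, ∀ x, |singularLaplacian α f x| ≤ C * (1 + ‖x‖) ^ (-(Module.finrank ℝ E + α)) := by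
  obtain ⟨A, M, hA, hM⟩ := hf.exists_secondDiffBound hc
  refine ⟨continuous_singularLaplacian h0 h2 hf.continuous hM, ?_⟩
  obtain ⟨R, hR⟩ := hc.isCompact.isBounded.subset_closedBall (0 : E)
  obtain ⟨C, -, hC⟩ := exists_singularLaplacian_decay (E := E) h0 h2 R
  exact ⟨C * (A + M), hC f hf.continuous (fun x hx => image_eq_zero_of_notMem_tsupport fun h => by
    have := hR h
    rw [mem_closedBall_zero_iff] at this
    linarith) A M hA hM⟩

theorem ContDiff.integrable_singularLaplacian [Nontrivial E] {α : ℝ} (h0 : 0 < α) (h2 : α < 2)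
    {f : E → ℝ} (hf : ContDiff ℝ 2 f) (hc : HasCompactSupport f) :
    Integrable (singularLaplacian α f) := by
  obtain ⟨h1, C, hC⟩ := hf.singularLaplacian_decay h0 h2 hc
  refine ((integrable_one_add_norm (E := E) (r := Module.finrank ℝ E + α) (by linarith)).const_mul
    C).mono' h1.aestronglyMeasurable (ae_of_all _ hC)

end Kernels

/-! ### The singular integral as a Fourier multiplier -/

section Symbol

open Metric
open scoped RealInnerProductSpace

variable {E : Type} [NormedAddCommGroup E] [InnerProductSpace ℝ E] [FiniteDimensional ℝ E]
  [MeasurableSpace E] [BorelSpace E]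

theorem two_sub_two_cos_nonneg (t : ℝ) : 0 ≤ 2 - 2 * Real.cos t := by
  linarith [Real.cos_le_one t]

theorem two_sub_two_cos_inner_le (ξ h : E) :
    2 - 2 * Real.cos ⟪ξ, h⟫ ≤ (‖ξ‖ ^ 2 + 4) * min (‖h‖ ^ 2) 1 := by
  have h1 : 2 - 2 * Real.cos ⟪ξ, h⟫ ≤ ‖ξ‖ ^ 2 * ‖h‖ ^ 2 := by
    have h2 := Real.one_sub_sq_div_two_le_cos (x := ⟪ξ, h⟫)
    have h3 : ⟪ξ, h⟫ ^ 2 ≤ (‖ξ‖ * ‖h‖) ^ 2 := sq_le_sq' (by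
      linarith [(abs_le.1 (abs_real_inner_le_norm ξ h)).1]) (real_inner_le_norm ξ h)
    nlinarith
  rcases le_total (‖h‖ ^ 2) 1 with hh | hh
  · rw [min_eq_left hh]
    nlinarith [sq_nonneg ‖h‖]
  · rw [min_eq_right hh]
    nlinarith [Real.neg_one_le_cos ⟪ξ, h⟫, sq_nonneg ‖ξ‖]

theorem integrable_two_sub_two_cos_mul [Nontrivial E] {α : ℝ} (h0 : 0 < α) (h2 : α < 2) (ξ : E) :
    Integrable fun h => (2 - 2 * Real.cos ⟪ξ, h⟫) * fracKernel α h := by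
  refine ((integrable_min_sq_mul_fracKernel h0 h2).const_mul (‖ξ‖ ^ 2 + 4)).mono'
    (AEStronglyMeasurable.mul (by fun_prop) (measurable_fracKernel α).aestronglyMeasurable)
    (ae_of_all _ fun h => ?_)
  rw [norm_mul, Real.norm_of_nonneg (two_sub_two_cos_nonneg _),
    Real.norm_of_nonneg (fracKernel_nonneg _ _), ← mul_assoc]
  exact mul_le_mul_of_nonneg_right (two_sub_two_cos_inner_le ξ h) (fracKernel_nonneg _ _)

/-- The symbol of the singular integral: rotation invariance and scaling force it to be a positive
multiple of `‖ξ‖^α`. -/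
theorem exists_integral_two_sub_two_cos_mul [Nontrivial E] {α : ℝ} (h0 : 0 < α) (h2 : α < 2) :
    ∃ c : ℝ, 0 < c ∧ ∀ ξ : E,
      ∫ h, (2 - 2 * Real.cos ⟪ξ, h⟫) * fracKernel α h = c * ‖ξ‖ ^ α := by
  obtain ⟨e, he⟩ := exists_norm_eq E zero_le_one
  refine ⟨∫ h, (2 - 2 * Real.cos ⟪e, h⟫) * fracKernel α h, ?_, fun ξ => ?_⟩
  · rw [integral_pos_iff_support_of_nonneg
      (fun h => mul_nonneg (two_sub_two_cos_nonneg _) (fracKernel_nonneg _ _))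
      (integrable_two_sub_two_cos_mul h0 h2 e)]
    have hopen : IsOpen {h : E | Real.cos ⟪e, h⟫ ≠ 1} :=
      isOpen_ne_fun (by fun_prop) continuous_const
    refine (hopen.measure_pos volume ⟨e, ?_⟩).trans_le (measure_mono fun h hh => ?_)
    · simp only [Set.mem_ofPred_eq, real_inner_self_eq_norm_sq, he, one_pow]
      have := Real.cos_lt_cos_of_nonneg_of_le_pi le_rfl (by linarith [Real.pi_gt_three]) zero_lt_one
      rw [Real.cos_zero] at this
      exact this.ne
    · simp only [Set.mem_ofPred_eq] at hh
      have hne : h ≠ 0 := by rintro rfl; simp at hh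
      refine mul_ne_zero (fun h3 => hh (by linarith)) ?_
      exact (Real.rpow_pos_of_pos (norm_pos_iff.2 hne) _).ne'
  · rcases eq_or_ne ξ 0 with rfl | hξ
    · simp [Real.zero_rpow h0.ne']
    have hr : 0 < ‖ξ‖ := norm_pos_iff.2 hξ
    set r := ‖ξ‖ with hrdef
    set e' : E := r⁻¹ • ξ with he'
    have he'1 : ‖e'‖ = ‖e‖ := by
      rw [he', norm_smul, he, Real.norm_of_nonneg (by positivity), ← hrdef, inv_mul_cancel₀ hr.ne']
    have hξe : ξ = r • e' := by rw [he', smul_smul, mul_inv_cancel₀ hr.ne', one_smul]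
    -- a reflection carries `e'` to `e`
    have hrot : ∫ h, (2 - 2 * Real.cos ⟪e', h⟫) * fracKernel α h =
        ∫ h, (2 - 2 * Real.cos ⟪e, h⟫) * fracKernel α h := by
      set A := (ℝ ∙ (e' - e))ᗮ.reflection
      have hA : A e' = e := Submodule.reflection_sub he'1
      rw [← MeasurePreserving.integral_comp A.measurePreserving
        A.toHomeomorph.measurableEmbedding (fun h => (2 - 2 * Real.cos ⟪e, h⟫) * fracKernel α h)]
      refine integral_congr_ae (ae_of_all _ fun h => ?_)
      have : ⟪e, A h⟫ = ⟪e', h⟫ := by rw [← hA, A.inner_map_map]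
      simp only
      rw [this, fracKernel, fracKernel, A.norm_map]
    rw [← hrot]
    have hsc := Measure.integral_comp_smul (volume : Measure E)
      (fun h => (2 - 2 * Real.cos ⟪e', h⟫) * fracKernel α h) r
    have h4 : ∀ h : E, (2 - 2 * Real.cos ⟪e', r • h⟫) * fracKernel α (r • h) =
        r ^ (-(Module.finrank ℝ E + α)) * ((2 - 2 * Real.cos ⟪ξ, h⟫) * fracKernel α h) := by
      intro h
      have : ⟪e', r • h⟫ = ⟪ξ, h⟫ := by
        rw [inner_smul_right, ← real_inner_smul_left, ← hξe]
      rw [this, fracKernel, fracKernel, norm_smul, Real.norm_of_nonneg hr.le,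
        Real.mul_rpow hr.le (norm_nonneg _)]
      ring
    simp only [h4] at hsc
    rw [integral_const_mul, smul_eq_mul, abs_of_nonneg (by positivity)] at hsc
    have h5 : r ^ (-(Module.finrank ℝ E + α)) = (r ^ α)⁻¹ * (r ^ Module.finrank ℝ E)⁻¹ := by
      rw [neg_add, Real.rpow_add hr, Real.rpow_neg hr.le, Real.rpow_neg hr.le, Real.rpow_natCast,
        mul_comm]
    rw [h5] at hsc
    have h6 : r ^ α ≠ 0 := (Real.rpow_pos_of_pos hr _).ne'
    have h7 : r ^ Module.finrank ℝ E ≠ 0 := by positivity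
    have h8 : (r ^ α)⁻¹ * ∫ h, (2 - 2 * Real.cos ⟪ξ, h⟫) * fracKernel α h =
        ∫ h, (2 - 2 * Real.cos ⟪e', h⟫) * fracKernel α h := by
      refine mul_left_cancel₀ (inv_ne_zero h7) ?_
      rw [← hsc]
      ring
    rw [← h8]
    field_simp

/-- The fractional Laplacian as a Fourier multiplier equals the singular integral, up to a
positive constant: insert the Fourier inversion formula in the singular integral. -/
theorem exists_singularLaplacian_eq_fourierInv [Nontrivial E] {α : ℝ} (h0 : 0 < α) (h2 : α < 2) :
    ∃ c : ℝ, 0 < c ∧ ∀ f : E → ℝ, ContDiff ℝ (⊤ : ℕ∞) f → HasCompactSupport f →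
      Integrable (𝓕 (fun y => (f y : ℂ))) ∧ (∀ x, 𝓕⁻ (𝓕 (fun y => (f y : ℂ))) x = f x) ∧
      Integrable (fun η : E => (((2 * Real.pi * ‖η‖) ^ α : ℝ) : ℂ) * 𝓕 (fun y => (f y : ℂ)) η) ∧
      ∀ x, (singularLaplacian α f x : ℂ) =
        c * 𝓕⁻ (fun η : E => (((2 * Real.pi * ‖η‖) ^ α : ℝ) : ℂ) * 𝓕 (fun y => (f y : ℂ)) η) x := by
  obtain ⟨c, hc0, hc⟩ := exists_integral_two_sub_two_cos_mul (E := E) h0 h2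
  refine ⟨c, hc0, fun f hf hs => ?_⟩
  have hs' : HasCompactSupport (fun y => (f y : ℂ)) := hs.comp_left (g := ((↑) : ℝ → ℂ)) rfl
  have hf' : ContDiff ℝ (⊤ : ℕ∞) (fun y => (f y : ℂ)) := Complex.ofRealCLM.contDiff.comp hf
  set g := hs'.toSchwartzMap hf' with hg
  set F : E → ℂ := 𝓕 (fun y => (f y : ℂ)) with hF
  have hFg : F = (𝓕 g : SchwartzMap E ℂ) := rfl
  have hF0 : Integrable F := by rw [hFg]; exact (𝓕 g).integrable
  have hF2 : Integrable (fun η => ‖η‖ ^ 2 * ‖F η‖) := by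
    rw [hFg]; exact (𝓕 g).integrable_pow_mul volume 2
  have hFcont : Continuous F := by rw [hFg]; exact (𝓕 g).continuous
  have hinv : ∀ x, 𝓕⁻ F x = f x := fun x =>
    congrFun (Continuous.fourierInv_fourier_eq (by fun_prop)
      (by exact g.integrable) hF0) x
  have hpi := Real.pi_pos
  have hm : Integrable (fun η : E => (((2 * Real.pi * ‖η‖) ^ α : ℝ) : ℂ) * F η) := by
    refine ((hF2.const_mul ((2 * Real.pi) ^ 2)).add hF0.norm).mono' (AEStronglyMeasurable.mul
      (Continuous.aestronglyMeasurable (Complex.continuous_ofReal.comp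
        (Continuous.rpow_const (by fun_prop) fun _ => Or.inr h0.le))) hF0.1)
            (ae_of_all _ fun η => ?_)
    rw [norm_mul, Complex.norm_real, Real.norm_of_nonneg (by positivity), Pi.add_apply]
    have : (2 * Real.pi * ‖η‖) ^ α ≤ (2 * Real.pi * ‖η‖) ^ 2 + 1 := by
      rcases le_total (2 * Real.pi * ‖η‖) 1 with h | h
      · have := Real.rpow_le_one (by positivity) h h0.le
        nlinarith [sq_nonneg (2 * Real.pi * ‖η‖)]
      · have := Real.rpow_le_rpow_of_exponent_le h h2.le
        rw [Real.rpow_two] at this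
        linarith
    have := mul_le_mul_of_nonneg_right this (norm_nonneg (F η))
    linarith
  refine ⟨hF0, hinv, hm, fun x => ?_⟩
  have hexp : ∀ z : E,
      Integrable (fun η => Complex.exp (↑(2 * Real.pi * ⟪η, z⟫) * Complex.I) • F η) := by
    intro z
    have hcont : Continuous fun η : E => Complex.exp (↑(2 * Real.pi * ⟪η, z⟫) * Complex.I) := by
      fun_prop
    refine hF0.norm.mono' (hcont.aestronglyMeasurable.smul hF0.1) (ae_of_all _ fun η => ?_)
    rw [norm_smul, Complex.norm_exp_ofReal_mul_I, one_mul]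
  have hsec : ∀ h : E, (secondDiff f x h : ℂ) = ∫ η, (2 - 2 * Real.cos ⟪(2 * Real.pi) • η, h⟫ : ℝ) *
      (Complex.exp (↑(2 * Real.pi * ⟪η, x⟫) * Complex.I) • F η) := by
    intro h
    rw [secondDiff]
    push_cast
    rw [← hinv x, ← hinv (x + h), ← hinv (x - h), Real.fourierInv_eq', Real.fourierInv_eq',
      Real.fourierInv_eq', ← integral_const_mul, ← integral_sub ((hexp x).const_mul 2)
          (hexp (x + h)),
      ← integral_sub (by exact ((hexp x).const_mul 2).sub (hexp (x + h))) (hexp (x - h))]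
    refine integral_congr_ae (ae_of_all _ fun η => ?_)
    simp only [smul_eq_mul, inner_add_right, inner_sub_right, inner_smul_left]
    rw [show ((↑(2 * Real.pi * (⟪η, x⟫ + ⟪η, h⟫)) : ℂ) * Complex.I) =
        ↑(2 * Real.pi * ⟪η, x⟫) * Complex.I + ↑(2 * Real.pi * ⟪η, h⟫) *
            Complex.I by push_cast; ring,
      show ((↑(2 * Real.pi * (⟪η, x⟫ - ⟪η, h⟫)) : ℂ) * Complex.I) =
        ↑(2 * Real.pi * ⟪η, x⟫) * Complex.I + -↑(2 * Real.pi * ⟪η, h⟫) *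
            Complex.I by push_cast; ring,
      Complex.exp_add, Complex.exp_add]
    have := Complex.two_cos (2 * Real.pi * ⟪η, h⟫ : ℝ)
    simp only [conj_trivial]
    push_cast at this ⊢
    rw [this]
    ring
  have hJ : Integrable (Function.uncurry fun h η : E =>
      ((2 - 2 * Real.cos ⟪(2 * Real.pi) • η, h⟫ : ℝ) *
      (Complex.exp (↑(2 * Real.pi * ⟪η, x⟫) * Complex.I) • F η)) * (fracKernel α h : ℂ))
      (volume.prod volume) := by
    have hb : Integrable (fun η => (‖(2 * Real.pi) • η‖ ^ 2 + 4) * ‖F η‖) := by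
      refine ((hF2.const_mul ((2 * Real.pi) ^ 2)).add (hF0.norm.const_mul 4)).congr
        (ae_of_all _ fun η => ?_)
      simp only [Pi.add_apply, norm_smul, Real.norm_of_nonneg (by positivity : 0 ≤ 2 * Real.pi)]
      ring
    refine ((integrable_min_sq_mul_fracKernel (E := E) h0 h2).mul_prod hb).mono' ?_
      (ae_of_all _ fun q => ?_)
    · refine AEStronglyMeasurable.mul (Continuous.aestronglyMeasurable ?_)
        (Measurable.aestronglyMeasurable ?_)
      · simp only [smul_eq_mul]
        fun_prop
      · exact Complex.measurable_ofReal.comp ((measurable_fracKernel α).comp measurable_fst)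
    · simp only [Function.uncurry, norm_mul, norm_smul, Complex.norm_exp_ofReal_mul_I,
        Complex.norm_real, Real.norm_of_nonneg (fracKernel_nonneg α q.1),
        Real.norm_of_nonneg (two_sub_two_cos_nonneg _), one_mul]
      have := mul_le_mul_of_nonneg_right (mul_le_mul_of_nonneg_right
        (two_sub_two_cos_inner_le ((2 * Real.pi) • q.2) q.1) (norm_nonneg (F q.2)))
        (fracKernel_nonneg α q.1)
      rw [norm_smul, norm_mul] at this
      linarith
  have hstart : (singularLaplacian α f x : ℂ) = ∫ h, ∫ η,
      ((2 - 2 * Real.cos ⟪(2 * Real.pi) • η, h⟫ : ℝ) *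
      (Complex.exp (↑(2 * Real.pi * ⟪η, x⟫) * Complex.I) • F η)) * (fracKernel α h : ℂ) := by
    rw [singularLaplacian, ← integral_complex_ofReal]
    refine integral_congr_ae (ae_of_all _ fun h => ?_)
    simp only
    rw [Complex.ofReal_mul, hsec, integral_mul_const]
  rw [hstart, integral_integral_swap hJ, Real.fourierInv_eq', ← integral_const_mul]
  refine integral_congr_ae (ae_of_all _ fun η => ?_)
  simp only
  rw [show (∫ h, ((2 - 2 * Real.cos ⟪(2 * Real.pi) • η, h⟫ : ℝ) *
      (Complex.exp (↑(2 * Real.pi * ⟪η, x⟫) * Complex.I) • F η)) * (fracKernel α h : ℂ)) =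
      (∫ h, (((2 - 2 * Real.cos ⟪(2 * Real.pi) • η, h⟫) * fracKernel α h : ℝ) : ℂ)) *
      (Complex.exp (↑(2 * Real.pi * ⟪η, x⟫) * Complex.I) • F η) by
    rw [← integral_mul_const]
    refine integral_congr_ae (ae_of_all _ fun h => ?_)
    push_cast
    ring, integral_complex_ofReal, hc, norm_smul, Real.norm_of_nonneg (by positivity)]
  push_cast
  simp only [smul_eq_mul]
  ring

end Symbol

/-! ### Inversion of the singular integral by a Riesz potential -/

section Subordination

open Metric
open scoped RealInnerProductSpace

variable {E : Type} [NormedAddCommGroup E] [InnerProductSpace ℝ E] [FiniteDimensional ℝ E]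
  [MeasurableSpace E] [BorelSpace E]

/-- Subordination: `Γ(q) r^(-q) = ∫_0^∞ t^(q-1) e^(-t r) dt`, integrated against a function. -/
theorem integral_subordination {q : ℝ} (hq : 0 < q) {r : E → ℝ} (hr : Measurable r)
    (hr0 : ∀ᵐ z, 0 < r z) {F : E → ℂ} (hF : Integrable (fun z => ((r z ^ (-q) : ℝ) : ℂ) * F z))
    (hF1 : AEStronglyMeasurable F) :
    ∫ t in Set.Ioi (0 : ℝ), ((t ^ (q - 1) : ℝ) : ℂ) * ∫ z, (Real.exp (-(t * r z)) : ℂ) * F z =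
      Real.Gamma q * ∫ z, ((r z ^ (-q) : ℝ) : ℂ) * F z := by
  have hval : ∀ z, 0 < r z → ∫ t in Set.Ioi (0 : ℝ), t ^ (q - 1) * Real.exp (-(t * r z)) =
      Real.Gamma q * r z ^ (-q) := by
    intro z hz
    have := Real.integral_rpow_mul_exp_neg_mul_Ioi hq hz
    simp only [mul_comm (r z)] at this
    rw [this, one_div, Real.inv_rpow hz.le, Real.rpow_neg hz.le, mul_comm]
  have hΓ := Real.Gamma_pos_of_pos hq
  have hintt : ∀ z, 0 < r z → IntegrableOn (fun t => t ^ (q - 1) * Real.exp (-(t * r z)))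
      (Set.Ioi (0 : ℝ)) := by
    intro z hz
    refine Integrable.of_integral_ne_zero ?_
    rw [hval z hz]
    exact (mul_pos hΓ (Real.rpow_pos_of_pos hz _)).ne'
  have hJ : Integrable (Function.uncurry fun (t : ℝ) (z : E) =>
      ((t ^ (q - 1) * Real.exp (-(t * r z)) : ℝ) : ℂ) * F z)
      ((volume.restrict (Set.Ioi 0)).prod volume) := by
    rw [integrable_prod_iff']
    · constructor
      · filter_upwards [hr0] with z hz
        exact Integrable.mul_const (Integrable.ofReal (𝕜 := ℂ) (hintt z hz)) (F z)
      · refine (hF.norm.const_mul (Real.Gamma q)).congr ?_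
        filter_upwards [hr0] with z hz
        simp only [Function.uncurry, norm_mul, Complex.norm_real]
        rw [integral_mul_const, Real.norm_of_nonneg (Real.rpow_nonneg hz.le _), ← mul_assoc,
          ← hval z hz]
        congr 1
        refine setIntegral_congr_fun measurableSet_Ioi fun t ht => ?_
        have ht : 0 < t := ht
        rw [← norm_mul, Real.norm_of_nonneg (by positivity)]
    · refine AEStronglyMeasurable.mul (Measurable.aestronglyMeasurable ?_) hF1.comp_snd
      refine Complex.measurable_ofReal.comp (Measurable.mul (by fun_prop) ?_)
      exact Real.measurable_exp.comp (measurable_fst.mul (hr.comp measurable_snd)).neg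
  have e1 : ∀ t : ℝ, ((t ^ (q - 1) : ℝ) : ℂ) * ∫ z, (Real.exp (-(t * r z)) : ℂ) * F z =
      ∫ z, ((t ^ (q - 1) * Real.exp (-(t * r z)) : ℝ) : ℂ) * F z := by
    intro t
    rw [← integral_const_mul]
    refine integral_congr_ae (ae_of_all _ fun z => ?_)
    push_cast
    ring
  simp only [e1]
  rw [integral_integral_swap hJ, ← integral_const_mul]
  refine integral_congr_ae ?_
  filter_upwards [hr0] with z hz
  rw [integral_mul_const, integral_complex_ofReal, hval z hz]
  push_cast
  ring

/-- Parseval's identity for a Gaussian and an inverse Fourier transform. -/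
theorem integral_mul_fourierInv_gaussian {m : E → ℂ} (hm : Integrable m) {t : ℝ} (ht : 0 < t) :
    ∫ z : E, (Real.exp (-(t * ‖z‖ ^ 2)) : ℂ) * 𝓕⁻ m z =
      (((Real.pi / t) ^ ((Module.finrank ℝ E : ℝ) / 2) : ℝ) : ℂ) *
        ∫ η : E, (Real.exp (-(t⁻¹ * (Real.pi ^ 2 * ‖η‖ ^ 2))) : ℂ) * m η := by
  set G : E → ℂ := fun z => Complex.exp (-(t : ℂ) * ‖z‖ ^ 2) with hGdef
  have hG : Integrable G := by
    have := GaussianFourier.integrable_cexp_neg_mul_sq_norm_add (V := E) (b := t) (by simpa) 0 0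
    simpa [hGdef] using this
  have hflip : (-innerₗ E).flip = -innerₗ E := by
    ext x y
    simp [real_inner_comm]
  have hfl := VectorFourier.integral_fourierIntegral_smul_eq_flip (μ := volume) (ν := volume)
    (L := -innerₗ E) Real.continuous_fourierChar (by simp; fun_prop) hm hG
  rw [hflip] at hfl
  have hGinv : ∀ η, VectorFourier.fourierIntegral Real.fourierChar volume (-innerₗ E) G η =
      (((Real.pi / t) ^ ((Module.finrank ℝ E : ℝ) / 2) : ℝ) : ℂ) *
        (Real.exp (-(t⁻¹ * (Real.pi ^ 2 * ‖η‖ ^ 2))) : ℂ) := by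
    intro η
    have h1 : VectorFourier.fourierIntegral Real.fourierChar volume (-innerₗ E) G η = 𝓕⁻ G η := rfl
    rw [h1, Real.fourierInv_eq_fourier_neg, hGdef, fourier_gaussian_innerProductSpace (by simpa),
      Complex.ofReal_cpow (by positivity)]
    push_cast
    rw [norm_neg]
    congr 2
    field_simp
  have h2 : ∀ z : E, (Real.exp (-(t * ‖z‖ ^ 2)) : ℂ) = G z := by
    intro z; simp [hGdef]
  simp only [hGinv, smul_eq_mul] at hfl
  have h3 : ∫ z : E, (Real.exp (-(t * ‖z‖ ^ 2)) : ℂ) * 𝓕⁻ m z = ∫ z, 𝓕⁻ m z * G z := by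
    refine integral_congr_ae (ae_of_all _ fun z => ?_)
    simp only
    rw [h2, mul_comm]
  rw [h3, ← integral_const_mul]
  refine Eq.trans hfl (integral_congr_ae (ae_of_all _ fun z => ?_))
  simp only
  ring

/-- The value at the origin of the inversion formula for the Riesz potential of order `α`. The
kernel `‖z‖^(-(n-α))` and the power `(π² ‖η‖²)^(-α/2)` are written as mixtures of Gaussians by
`integral_subordination`, and the Fourier transform exchanges the Gaussians of parameters `t` and
`t⁻¹`. -/
theorem exists_integral_rpow_mul_singularLaplacian [Nontrivial E] {α : ℝ} (h0 : 0 < α) (h2 : α < 2)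
    (hn : α < Module.finrank ℝ E) :
    ∃ C : ℝ, 0 < C ∧ ∀ f : E → ℝ, ContDiff ℝ (⊤ : ℕ∞) f → HasCompactSupport f →
      ∫ z, ‖z‖ ^ (-(Module.finrank ℝ E - α)) * singularLaplacian α f z = C * f 0 := by
  obtain ⟨c, hc0, hc⟩ := exists_singularLaplacian_eq_fourierInv (E := E) h0 h2
  have hpi := Real.pi_pos
  set n : ℝ := ((Module.finrank ℝ E : ℕ) : ℝ) with hndef
  have hp : 0 < (n - α) / 2 := by linarith
  have hΓ1 := Real.Gamma_pos_of_pos hp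
  have hΓ2 := Real.Gamma_pos_of_pos (half_pos h0)
  refine ⟨(Real.Gamma ((n - α) / 2))⁻¹ * (c * Real.pi ^ (n / 2) * (Real.Gamma (α / 2) * 2 ^ α)),
    by positivity, fun f hf hs => ?_⟩
  obtain ⟨hF0, hinv, hm, hΛ⟩ := hc f hf hs
  set F : E → ℂ := 𝓕 (fun y => (f y : ℂ)) with hF
  set m : E → ℂ := fun η => (((2 * Real.pi * ‖η‖) ^ α : ℝ) : ℂ) * F η with hmdef
  have hf2 : ContDiff ℝ 2 f := contDiff_infty.1 hf 2
  have hae : ∀ᵐ z : E, 0 < ‖z‖ := by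
    filter_upwards [compl_mem_ae_iff.2 (measure_singleton (μ := (volume : Measure E)) 0)] with z hz
    exact norm_pos_iff.2 hz
  have hΛint := hf2.integrable_singularLaplacian h0 h2 hs
  obtain ⟨A, M, hA, hM⟩ := hf2.exists_secondDiffBound hs
  have hpow1 : ∀ z : E, (‖z‖ ^ 2) ^ (-((n - α) / 2)) = ‖z‖ ^ (-(n - α)) := by
    intro z
    rw [← Real.rpow_natCast, ← Real.rpow_mul (norm_nonneg _)]
    congr 1
    push_cast
    ring
  have hint1 : Integrable (fun z : E => ‖z‖ ^ (-(n - α)) * singularLaplacian α f z) :=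
    (integrable_singular_mul (p := n - α) (by linarith) (by linarith) (measurable_norm_rpow _)
      (fun z => (abs_of_nonneg (Real.rpow_nonneg (norm_nonneg _) _)).le) hΛint
      (abs_singularLaplacian_le h0 h2 hM)).1
  have step1 := integral_subordination hp (r := fun z : E => ‖z‖ ^ 2) (by fun_prop)
    (by filter_upwards [hae] with z hz using by positivity)
    (F := fun z => (singularLaplacian α f z : ℂ))
    (by simp only [hpow1]; exact_mod_cast hint1.ofReal) hΛint.ofReal.1
  have hpow2 : ∀ η : E, 0 < ‖η‖ → (((Real.pi ^ 2 * ‖η‖ ^ 2) ^ (-(α / 2)) : ℝ) : ℂ) * m η =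
      ((2 ^ α : ℝ) : ℂ) * F η := by
    intro η hη
    have : (Real.pi ^ 2 * ‖η‖ ^ 2) ^ (-(α / 2)) * (2 * Real.pi * ‖η‖) ^ α = 2 ^ α := by
      rw [← mul_pow, ← Real.rpow_natCast, ← Real.rpow_mul (by positivity), mul_assoc 2,
        Real.mul_rpow (x := 2) (by positivity) (by positivity)]
      have h3 : (((2 : ℕ) : ℝ) * -(α / 2)) = -α := by push_cast; ring
      have h4 : (Real.pi * ‖η‖) ^ α ≠ 0 := (Real.rpow_pos_of_pos (by positivity) _).ne'
      rw [h3, Real.rpow_neg (by positivity)]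
      field_simp
    rw [hmdef]
    simp only
    rw [← mul_assoc, ← Complex.ofReal_mul, this]
  have step4 := integral_subordination (half_pos h0) (r := fun z : E => Real.pi ^ 2 * ‖z‖ ^ 2)
    (by fun_prop) (by filter_upwards [hae] with z hz using by positivity) (F := m)
    ((hF0.const_mul ((2 ^ α : ℝ) : ℂ)).congr (by
      filter_upwards [hae] with z hz using (hpow2 z hz).symm)) hm.1
  have hF00 : ∫ η, F η = f 0 := by
    rw [← hinv 0, Real.fourierInv_eq']
    simp
  have h5 : ∫ z : E, (((Real.pi ^ 2 * ‖z‖ ^ 2) ^ (-(α / 2)) : ℝ) : ℂ) * m z =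
      ((2 ^ α : ℝ) : ℂ) * f 0 := by
    rw [← hF00, ← integral_const_mul]
    refine integral_congr_ae ?_
    filter_upwards [hae] with z hz using hpow2 z hz
  rw [h5] at step4
  -- the Gaussians of parameters `t` and `t⁻¹` are matched by a change of variables
  set K : ℝ → ℂ := fun u => ∫ z, (Real.exp (-(u * (Real.pi ^ 2 * ‖z‖ ^ 2))) : ℂ) * m z with hK
  have step2 : ∀ t : ℝ, 0 < t → ∫ z, (Real.exp (-(t * ‖z‖ ^ 2)) : ℂ) *
      (singularLaplacian α f z : ℂ) =
      c * ((((Real.pi / t) ^ (n / 2) : ℝ) : ℂ) * K t⁻¹) := by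
    intro t ht
    rw [hK, ← integral_mul_fourierInv_gaussian hm ht, ← integral_const_mul]
    refine integral_congr_ae (ae_of_all _ fun z => ?_)
    simp only
    rw [hΛ]
    ring
  have step3 := integral_comp_rpow_Ioi (fun u => ((u ^ (α / 2 - 1) : ℝ) : ℂ) * K u)
    (p := -1) (by norm_num)
  have e1 : ∫ t in Set.Ioi (0 : ℝ), ((t ^ ((n - α) / 2 - 1) : ℝ) : ℂ) *
      ∫ z, (Real.exp (-(t * ‖z‖ ^ 2)) : ℂ) * (singularLaplacian α f z : ℂ) =
      (c * ((Real.pi ^ (n / 2) : ℝ) : ℂ)) *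
        ∫ t in Set.Ioi (0 : ℝ), ((t ^ (α / 2 - 1) : ℝ) : ℂ) * K t := by
    rw [← step3, ← integral_const_mul]
    refine setIntegral_congr_fun measurableSet_Ioi fun t ht => ?_
    have ht : 0 < t := ht
    have h6 : t ^ ((n - α) / 2 - 1) * (Real.pi / t) ^ (n / 2) =
        Real.pi ^ (n / 2) * (t ^ (-1 - 1 : ℝ) * t⁻¹ ^ (α / 2 - 1)) := by
      rw [Real.div_rpow hpi.le ht.le, Real.inv_rpow ht.le, ← Real.rpow_neg ht.le, ← Real.rpow_add
          ht,
        mul_div_left_comm, ← Real.rpow_sub ht]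
      congr 2
      ring
    rw [step2 t ht, Real.rpow_neg_one, abs_neg, abs_one, one_mul, Complex.real_smul]
    have h7 := congrArg (fun y : ℝ => (y : ℂ)) h6
    simp only [Complex.ofReal_mul] at h7
    linear_combination (c * K t⁻¹) * h7
  rw [e1, step4] at step1
  simp only [hpow1] at step1
  have h8 : ∫ z : E, ((‖z‖ ^ (-(n - α)) : ℝ) : ℂ) * (singularLaplacian α f z : ℂ) =
      ((∫ z : E, ‖z‖ ^ (-(n - α)) * singularLaplacian α f z : ℝ) : ℂ) := by
    rw [← integral_complex_ofReal]
    simp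
  rw [h8] at step1
  have h9 : c * Real.pi ^ (n / 2) * (Real.Gamma (α / 2) * (2 ^ α * f 0)) =
      Real.Gamma ((n - α) / 2) * ∫ z : E, ‖z‖ ^ (-(n - α)) * singularLaplacian α f z := by
    exact_mod_cast step1
  field_simp
  rw [mul_comm, ← h9]
  ring

theorem secondDiff_comp_add_left (f : E → ℝ) (x z h : E) :
    secondDiff (fun y => f (x + y)) z h = secondDiff f (x + z) h := by
  simp only [secondDiff, add_assoc, add_sub_assoc]

theorem singularLaplacian_comp_add_left (α : ℝ) (f : E → ℝ) (x z : E) :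
    singularLaplacian α (fun y => f (x + y)) z = singularLaplacian α f (x + z) := by
  simp only [singularLaplacian, secondDiff_comp_add_left]

/-- The Riesz potential of order `α` inverts the fractional Laplacian, up to a positive constant. -/
theorem exists_rieszPotential_singularLaplacian [Nontrivial E] {α : ℝ} (h0 : 0 < α) (h2 : α < 2)
    (hn : α < Module.finrank ℝ E) :
    ∃ C : ℝ, 0 < C ∧ ∀ f : E → ℝ, ContDiff ℝ (⊤ : ℕ∞) f → HasCompactSupport f → ∀ x,
      rieszPotential (Module.finrank ℝ E - α) (singularLaplacian α f) x = C * f x := by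
  obtain ⟨C, hC0, hC⟩ := exists_integral_rpow_mul_singularLaplacian (E := E) h0 h2 hn
  refine ⟨C, hC0, fun f hf hs x => ?_⟩
  have := hC (fun y => f (x + y)) (hf.comp (contDiff_const.add contDiff_id))
    (hs.comp_homeomorph (Homeomorph.addLeft x))
  simpa [singularLaplacian_comp_add_left, rieszPotential] using this

end Subordination

/-! ### Riesz potentials of test functions -/

section Potential

open Metric
open scoped RealInnerProductSpace

variable {E : Type} [NormedAddCommGroup E] [InnerProductSpace ℝ E] [FiniteDimensional ℝ E]
  [MeasurableSpace E] [BorelSpace E]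

/-- The integrability that justifies exchanging integrals with a singular kernel `κ`. -/
theorem integrable_singular_prod [Nontrivial E] {p : ℝ} (hp : 0 ≤ p) (hpn : p < Module.finrank ℝ E)
    {κ : E → ℝ} (hκ : Measurable κ) (hκp : ∀ z, |κ z| ≤ ‖z‖ ^ (-p)) {Ψ : E → E → ℝ}
    (hΨ : AEStronglyMeasurable (Function.uncurry Ψ) (volume.prod volume)) {A N : ℝ}
    (hA : ∀ x z, |Ψ x z| ≤ A) (hi : ∀ x, Integrable (Ψ x)) (hN : ∀ x, ∫ z, |Ψ x z| ≤ N)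
    {w : E → ℝ} (hw : Integrable w) :
    Integrable (Function.uncurry fun x z => κ z * Ψ x z * w x) (volume.prod volume) := by
  have hm : AEStronglyMeasurable (Function.uncurry fun x z => κ z * Ψ x z * w x)
      (volume.prod volume) :=
    ((hκ.comp measurable_snd).aestronglyMeasurable.mul hΨ).mul hw.1.comp_fst
  rw [integrable_prod_iff hm]
  have h := fun x => integrable_singular_mul hp hpn hκ hκp (hi x) (hA x)
  refine ⟨ae_of_all _ fun x => (h x).1.mul_const (w x), ?_⟩
  refine (hw.norm.const_mul (A * ballMass E p + N)).mono' hm.norm.integral_prod_right'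
    (ae_of_all _ fun x => ?_)
  simp only [Function.uncurry, norm_mul (_ * _)]
  rw [integral_mul_const, norm_mul, norm_norm]
  refine mul_le_mul_of_nonneg_right ?_ (norm_nonneg _)
  rw [Real.norm_of_nonneg (integral_nonneg fun _ => norm_nonneg _)]
  exact (h x).2.trans (add_le_add_right (hN x) _)

/-- Correlation with `κ` is the adjoint of convolution with `κ`. -/
theorem integral_singular_adjoint [Nontrivial E] {p : ℝ} (hp : 0 ≤ p)
    (hpn : p < Module.finrank ℝ E) {κ : E → ℝ} (hκ : Measurable κ) (hκp : ∀ z, |κ z| ≤ ‖z‖ ^ (-p))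
    {φ g : E → ℝ} (hφ : Continuous φ) (hφi : Integrable φ) {A B : ℝ} (hA : ∀ x, |φ x| ≤ A)
    (hg : Integrable g) (hB : ∀ x, |g x| ≤ B) :
    ∫ x, (∫ z, κ z * φ (x + z)) * g x = ∫ y, (∫ z, κ z * g (y - z)) * φ y := by
  have h1 := integrable_singular_prod hp hpn hκ hκp (Ψ := fun x z => φ (x + z)) (A := A)
    (N := ∫ z, |φ z|) (Continuous.aestronglyMeasurable (by fun_prop)) (fun x z => hA _)
    (fun x => hφi.comp_add_left x)
    (fun x => (integral_add_left_eq_self (fun z => |φ z|) x).le) hg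
  have h2 := integrable_singular_prod hp hpn hκ hκp (Ψ := fun y z => g (y - z)) (A := B)
    (N := ∫ z, |g z|)
    (hg.1.comp_quasiMeasurePreserving (quasiMeasurePreserving_sub_of_right_invariant _ _))
    (fun x z => hB _) (fun x => hg.comp_sub_left x)
    (fun x => (integral_sub_left_eq_self (fun z => |g z|) volume x).le) hφi
  calc ∫ x, (∫ z, κ z * φ (x + z)) * g x = ∫ x, ∫ z, κ z * φ (x + z) * g x := by
        simp only [integral_mul_const]
    _ = ∫ z, ∫ x, κ z * φ (x + z) * g x := integral_integral_swap h1
    _ = ∫ z, ∫ y, κ z * g (y - z) * φ y := by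
        refine integral_congr_ae (ae_of_all _ fun z => ?_)
        simp only
        rw [← integral_sub_right_eq_self (fun x => κ z * φ (x + z) * g x) z]
        refine integral_congr_ae (ae_of_all _ fun y => ?_)
        simp only [sub_add_cancel]
        ring
    _ = ∫ y, ∫ z, κ z * g (y - z) * φ y := (integral_integral_swap h2).symm
    _ = _ := by simp only [integral_mul_const]

/-- `∫ (P φ)(y - x) w(x) dx` is symmetric in `φ` and `w`. -/
theorem integral_rieszPotential_mul_comm [Nontrivial E] {p : ℝ} (hp : 0 ≤ p)
    (hpn : p < Module.finrank ℝ E) {φ w : E → ℝ} (hφ : Continuous φ) (hφi : Integrable φ) {A B : ℝ}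
    (hA : ∀ x, |φ x| ≤ A) (hw : Integrable w) (hB : ∀ x, |w x| ≤ B) (y : E) :
    ∫ x, w x * rieszPotential p φ (y - x) = ∫ x, φ x * rieszPotential p w (y - x) := by
  have h := integral_singular_adjoint hp hpn (measurable_norm_rpow (E := E) (-p))
    (fun z => (abs_of_nonneg (Real.rpow_nonneg (norm_nonneg _) _)).le) hφ hφi hA
    (hw.comp_sub_left y) (fun x => hB _)
  rw [← integral_sub_left_eq_self _ volume y] at h
  simp only [sub_sub_cancel] at h
  calc _ = ∫ x, (∫ z, ‖z‖ ^ (-p) * φ (y - x + z)) * w x := by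
        simp only [rieszPotential, mul_comm]
    _ = _ := h
    _ = _ := by
        refine integral_congr_ae (ae_of_all _ fun x => ?_)
        simp only [rieszPotential]
        rw [mul_comm]
        congr 1
        refine integral_congr_ae (ae_of_all _ fun z => ?_)
        simp only
        congr 2
        abel

/-- If `Q(·, h)` is dominated by `min(‖h‖², 1)`, bounded in mean and, for small `h`, supported in a
fixed ball, then `Q` is integrable against the kernel of the fractional Laplacian. -/
theorem integrable_levy_prod [Nontrivial E] {α : ℝ} (h0 : 0 < α) (h2 : α < 2) {Q : E → E → ℝ}
    (hQ : Continuous (Function.uncurry Q)) {R M N : ℝ}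
    (hM : ∀ x h, |Q x h| ≤ M * min (‖h‖ ^ 2) 1) (hR : ∀ x h, ‖h‖ ≤ 1 → R < ‖x‖ → Q x h = 0)
    (hi : ∀ h, Integrable fun x => Q x h) (hN : ∀ h, ∫ x, |Q x h| ≤ N) :
    (∃ C, ∀ h, ∫ x, |Q x h| ≤ C * min (‖h‖ ^ 2) 1) ∧
      Integrable (Function.uncurry fun x h => Q x h * fracKernel α h) (volume.prod volume) := by
  have hN0 : 0 ≤ N := (integral_nonneg fun _ => abs_nonneg _).trans (hN 0)
  have hM0 : 0 ≤ M := by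
    obtain ⟨v, hv⟩ := exists_ne (0 : E)
    exact nonneg_of_mul_nonneg_left ((abs_nonneg _).trans (hM 0 v))
      (lt_min (by positivity) one_pos)
  have hC : ∀ h, ∫ x, |Q x h| ≤ (M * volume.real (closedBall (0 : E) R) + N) * min (‖h‖ ^ 2) 1 := by
    intro h
    have hmin : 0 ≤ min (‖h‖ ^ 2) 1 := le_min (sq_nonneg _) zero_le_one
    rcases le_total ‖h‖ 1 with hh | hh
    · have hle : ∫ x, |Q x h| ≤ ∫ x, (closedBall (0 : E) R).indicator
          (fun _ => M * min (‖h‖ ^ 2) 1) x := by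
        refine integral_mono (hi h).abs ((integrable_indicator_iff measurableSet_closedBall).2
          (integrableOn_const measure_closedBall_lt_top.ne)) fun x => ?_
        by_cases hx : x ∈ closedBall (0 : E) R
        · simp only [Set.indicator_of_mem hx]
          exact hM x h
        · simp only [Set.indicator_of_notMem hx]
          rw [hR x h hh (by simpa using hx), abs_zero]
      rw [integral_indicator measurableSet_closedBall, setIntegral_const, smul_eq_mul] at hle
      nlinarith [mul_nonneg hN0 hmin]
    · rw [min_eq_right (one_le_pow₀ hh), mul_one]
      exact (hN h).trans (le_add_of_nonneg_left (mul_nonneg hM0 measureReal_nonneg))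
  refine ⟨⟨_, hC⟩, ?_⟩
  have hm : AEStronglyMeasurable (Function.uncurry fun x h => Q x h * fracKernel α h)
      (volume.prod volume) :=
    hQ.aestronglyMeasurable.mul
      ((measurable_fracKernel α).comp measurable_snd).aestronglyMeasurable
  rw [integrable_prod_iff' hm]
  refine ⟨ae_of_all _ fun h => (hi h).mul_const (fracKernel α h), ?_⟩
  refine ((integrable_min_sq_mul_fracKernel h0 h2).const_mul
    (M * volume.real (closedBall (0 : E) R) + N)).mono' hm.norm.prod_swap.integral_prod_right'
    (ae_of_all _ fun h => ?_)
  simp only [Function.uncurry, norm_mul]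
  rw [integral_mul_const, norm_mul, norm_norm, Real.norm_of_nonneg (fracKernel_nonneg _ _),
    Real.norm_of_nonneg (integral_nonneg fun _ => norm_nonneg _), ← mul_assoc]
  exact mul_le_mul_of_nonneg_right (hC h) (fracKernel_nonneg _ _)

theorem integrable_secondDiff {φ : E → ℝ} (hφ : Integrable φ) (h : E) :
    Integrable (fun x => secondDiff φ x h) ∧ ∫ x, |secondDiff φ x h| ≤ 4 * ∫ x, |φ x| := by
  have h1 := (hφ.const_mul 2).sub (hφ.comp_add_right h)
  have h2 := h1.sub (hφ.comp_sub_right h)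
  refine ⟨h2, ?_⟩
  have h3 := ((hφ.abs.const_mul 2).add (hφ.comp_add_right h).abs).add (hφ.comp_sub_right h).abs
  refine (integral_mono h2.abs h3 fun x => ?_).trans_eq ?_
  · simp only [Pi.sub_apply, Pi.add_apply]
    refine (abs_sub _ _).trans (add_le_add_left ((abs_sub _ _).trans_eq ?_) _)
    rw [abs_mul, abs_two]
  · rw [integral_add' ((hφ.abs.const_mul 2).add (hφ.comp_add_right h).abs)
      (hφ.comp_sub_right h).abs, integral_add' (hφ.abs.const_mul 2) (hφ.comp_add_right h).abs,
      integral_const_mul, integral_add_right_eq_self (fun x => |φ x|),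
      integral_sub_right_eq_self (fun x => |φ x|)]
    ring

theorem secondDiff_eq_zero {φ : E → ℝ} {R : ℝ} (hR : ∀ x, R < ‖x‖ → φ x = 0) {x h : E}
    (hh : ‖h‖ ≤ 1) (hx : R + 1 < ‖x‖) : secondDiff φ x h = 0 := by
  have h1 := norm_sub_norm_le x (-h)
  have h2 := norm_sub_norm_le x h
  rw [sub_neg_eq_add, norm_neg] at h1
  rw [secondDiff, hR x (by linarith), hR (x + h) (by linarith), hR (x - h) (by linarith)]
  ring

theorem HasCompactSupport.exists_norm_bound {φ : E → ℝ} (hs : HasCompactSupport φ) :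
    ∃ R : ℝ, ∀ x, R < ‖x‖ → φ x = 0 := by
  obtain ⟨R, hR⟩ := hs.isCompact.isBounded.subset_closedBall (0 : E)
  refine ⟨R, fun x hx => image_eq_zero_of_notMem_tsupport fun h => ?_⟩
  have := hR h
  rw [mem_closedBall_zero_iff] at this
  linarith

/-- The fractional Laplacian commutes with Riesz potentials. -/
theorem singularLaplacian_rieszPotential [Nontrivial E] {α p : ℝ} (h0 : 0 < α) (h2 : α < 2)
    (hp : 0 ≤ p) (hpn : p < Module.finrank ℝ E) {φ : E → ℝ} (hφ : ContDiff ℝ 2 φ)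
    (hs : HasCompactSupport φ) (x : E) :
    singularLaplacian α (rieszPotential p φ) x = rieszPotential p (singularLaplacian α φ) x := by
  obtain ⟨A, M, hA, hM⟩ := hφ.exists_secondDiffBound hs
  have hφi : Integrable φ := hφ.continuous.integrable_of_hasCompactSupport hs
  obtain ⟨R, hR⟩ := hs.exists_norm_bound
  obtain ⟨⟨C, hC⟩, -⟩ := integrable_levy_prod h0 h2 (Q := secondDiff φ) (R := R + 1)
    (continuous_secondDiff hφ.continuous) hM (fun x h hh hx => secondDiff_eq_zero hR hh hx)
    (fun h => (integrable_secondDiff hφi h).1) (fun h => (integrable_secondDiff hφi h).2)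
  have hk := measurable_norm_rpow (E := E) (-p)
  have hkp : ∀ z : E, |‖z‖ ^ (-p)| ≤ ‖z‖ ^ (-p) :=
    fun z => (abs_of_nonneg (Real.rpow_nonneg (norm_nonneg _) _)).le
  have hint : ∀ y, Integrable fun z => ‖z‖ ^ (-p) * φ (y + z) := fun y =>
    (integrable_singular_mul hp hpn hk hkp (hφi.comp_add_left y) (fun z => hA _)).1
  have hsd : ∀ h, secondDiff (rieszPotential p φ) x h =
      ∫ z, ‖z‖ ^ (-p) * secondDiff φ (x + z) h := by
    intro h
    unfold secondDiff rieszPotential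
    rw [← integral_const_mul, ← integral_sub ((hint x).const_mul 2) (hint (x + h)),
      ← integral_sub (by exact ((hint x).const_mul 2).sub (hint (x + h))) (hint (x - h))]
    refine integral_congr_ae (ae_of_all _ fun z => ?_)
    simp only [add_right_comm x h z, show x - h + z = x + z - h by abel]
    ring
  have hz : ∀ h, Integrable (fun z => ‖z‖ ^ (-p) * secondDiff φ (x + z) h) ∧
      ∫ z, |‖z‖ ^ (-p) * secondDiff φ (x + z) h| ≤
        (M * ballMass E p + C) * min (‖h‖ ^ 2) 1 := by
    intro h
    have h3 := integrable_singular_mul hp hpn hk hkp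
      ((integrable_secondDiff hφi h).1.comp_add_left x) (fun z => hM (x + z) h)
    refine ⟨h3.1, h3.2.trans ?_⟩
    rw [integral_add_left_eq_self (fun z => |secondDiff φ z h|)]
    linarith [hC h]
  have hJ : Integrable (Function.uncurry fun h z : E =>
      ‖z‖ ^ (-p) * secondDiff φ (x + z) h * fracKernel α h) (volume.prod volume) := by
    have hm : AEStronglyMeasurable (Function.uncurry fun h z : E =>
        ‖z‖ ^ (-p) * secondDiff φ (x + z) h * fracKernel α h) (volume.prod volume) := by
      refine AEStronglyMeasurable.mul (AEStronglyMeasurable.mul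
        (hk.comp measurable_snd).aestronglyMeasurable (Continuous.aestronglyMeasurable ?_))
        ((measurable_fracKernel α).comp measurable_fst).aestronglyMeasurable
      exact (continuous_secondDiff hφ.continuous).comp
        (Continuous.prodMk (by fun_prop : Continuous fun q : E × E => x + q.2) continuous_fst)
    rw [integrable_prod_iff hm]
    refine ⟨ae_of_all _ fun h => (hz h).1.mul_const (fracKernel α h), ?_⟩
    refine ((integrable_min_sq_mul_fracKernel h0 h2).const_mul (M * ballMass E p + C)).mono'
      hm.norm.integral_prod_right' (ae_of_all _ fun h => ?_)
    simp only [Function.uncurry, norm_mul (_ * _)]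
    rw [integral_mul_const, norm_mul, norm_norm, Real.norm_of_nonneg (fracKernel_nonneg _ _),
      Real.norm_of_nonneg (integral_nonneg fun _ => norm_nonneg _), ← mul_assoc]
    exact mul_le_mul_of_nonneg_right (hz h).2 (fracKernel_nonneg _ _)
  calc singularLaplacian α (rieszPotential p φ) x
      = ∫ h, ∫ z, ‖z‖ ^ (-p) * secondDiff φ (x + z) h * fracKernel α h := by
        simp only [singularLaplacian, hsd, integral_mul_const]
    _ = ∫ z, ∫ h, ‖z‖ ^ (-p) * secondDiff φ (x + z) h * fracKernel α h :=
        integral_integral_swap hJ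
    _ = _ := by simp only [rieszPotential, singularLaplacian, mul_assoc, integral_const_mul]

open scoped Convolution

theorem locallyIntegrable_norm_rpow [Nontrivial E] {p : ℝ} (hp : 0 ≤ p)
    (hpn : p < Module.finrank ℝ E) : LocallyIntegrable (fun z : E => ‖z‖ ^ (-p)) := by
  have h1 := (integrable_indicator_iff measurableSet_ball).2
      (integrableOn_ball_norm_rpow (E := E) hpn)
  have h3 : LocallyIntegrable
      (fun z : E => ‖z‖ ^ (-p) - (ball 0 1).indicator (fun z => ‖z‖ ^ (-p)) z) := by
    refine (locallyIntegrable_const (1 : ℝ)).mono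
        ((measurable_norm_rpow (-p)).aestronglyMeasurable.sub
      h1.1) (ae_of_all _ fun z => ?_)
    by_cases hz : z ∈ ball (0 : E) 1
    · simp [Set.indicator_of_mem hz]
    · rw [Set.indicator_of_notMem hz, sub_zero, norm_one,
        Real.norm_of_nonneg (Real.rpow_nonneg (norm_nonneg _) _)]
      exact Real.rpow_le_one_of_one_le_of_nonpos (by simpa using hz) (neg_nonpos.2 hp)
  have h4 := h3.add h1.locallyIntegrable
  refine h4.congr (ae_of_all _ fun z => ?_)
  simp

/-- Convolutions of test functions with `‖z‖^(-p)` have bounded derivatives of each order. The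
induction passes from `φ` to `fderiv ℝ φ`, hence the general target space. -/
theorem exists_iteratedFDeriv_convolution_le [Nontrivial E] {p : ℝ} (hp : 0 ≤ p)
    (hpn : p < Module.finrank ℝ E) (i : ℕ) : ∀ {F : Type} [NormedAddCommGroup F] [NormedSpace ℝ F]
    [CompleteSpace F] {φ : E → F}, ContDiff ℝ (⊤ : ℕ∞) φ → HasCompactSupport φ →
    ∃ C, ∀ x, ‖iteratedFDeriv ℝ i ((fun z : E => ‖z‖ ^ (-p)) ⋆[ContinuousLinearMap.lsmul ℝ ℝ] φ) x‖
      ≤ C := by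
  induction i with
  | zero =>
    intro F _ _ _ φ hφ hs
    obtain ⟨A, hA⟩ := hφ.continuous.bounded_above_of_compact_support hs
    have hφi : Integrable (fun z => ‖φ z‖) :=
      (hφ.continuous.integrable_of_hasCompactSupport hs).norm
    refine ⟨A * ballMass E p + ∫ z, ‖φ z‖, fun x => ?_⟩
    rw [norm_iteratedFDeriv_zero, convolution_def]
    refine (norm_integral_le_integral_norm _).trans ?_
    have h := integrable_singular_mul hp hpn (measurable_norm_rpow (E := E) (-p))
      (fun z => (abs_of_nonneg (Real.rpow_nonneg (norm_nonneg _) _)).le) (hφi.comp_sub_left x)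
      (A := A) (fun z => by rw [abs_norm]; exact hA _)
    rw [integral_sub_left_eq_self (fun z => |‖φ z‖|) volume x] at h
    simp only [abs_mul, abs_norm] at h
    simpa [norm_smul] using h.2
  | succ i ih =>
    intro F _ _ _ φ hφ hs
    obtain ⟨C, hC⟩ := ih (φ := fderiv ℝ φ) (hφ.fderiv_right (by simp)) (hs.fderiv ℝ)
    refine ⟨C, fun x => ?_⟩
    rw [← norm_iteratedFDeriv_fderiv]
    convert hC x using 3
    ext1 y
    exact (hs.hasFDerivAt_convolution_right _ (locallyIntegrable_norm_rpow hp hpn)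
      (contDiff_infty.1 hφ 1) y).fderiv

theorem rieszPotential_eq_convolution (p : ℝ) (φ : E → ℝ) :
    rieszPotential p φ = (fun z : E => ‖z‖ ^ (-p)) ⋆[ContinuousLinearMap.lsmul ℝ ℝ] φ := by
  ext x
  rw [rieszPotential, convolution_def, ← integral_neg_eq_self]
  simp [sub_eq_add_neg]

theorem rieszPotential_smooth [Nontrivial E] {p : ℝ} (hp : 0 ≤ p) (hpn : p < Module.finrank ℝ E)
    {φ : E → ℝ} (hφ : ContDiff ℝ (⊤ : ℕ∞) φ) (hs : HasCompactSupport φ) :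
    ContDiff ℝ (⊤ : ℕ∞) (rieszPotential p φ) ∧
      ∀ i, ∃ C, ∀ x, ‖iteratedFDeriv ℝ i (rieszPotential p φ) x‖ ≤ C := by
  rw [rieszPotential_eq_convolution]
  exact ⟨hs.contDiff_convolution_right _ (locallyIntegrable_norm_rpow hp hpn) hφ,
    fun i => exists_iteratedFDeriv_convolution_le hp hpn i hφ hs⟩

theorem abs_inner_mul_norm_rpow_le {v : E} (hv : ‖v‖ ≤ 1) (p : ℝ) (z : E) :
    |⟪v, z⟫ * ‖z‖ ^ (-(p + 2))| ≤ ‖z‖ ^ (-(p + 1)) := by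
  rcases eq_or_ne z 0 with rfl | hz
  · simpa using Real.zero_rpow_nonneg _
  have hz' := norm_pos_iff.2 hz
  rw [abs_mul, abs_of_nonneg (Real.rpow_nonneg (norm_nonneg z) _)]
  have h1 : |⟪v, z⟫| ≤ ‖z‖ := (abs_real_inner_le_norm v z).trans
    (mul_le_of_le_one_left (norm_nonneg _) hv)
  refine (mul_le_mul_of_nonneg_right h1 (Real.rpow_nonneg (norm_nonneg z) _)).trans_eq ?_
  nth_rewrite 1 [← Real.rpow_one ‖z‖]
  rw [← Real.rpow_add hz']
  congr 1
  ring

/-- In the Riesz potential of a derivative, the derivative can be moved to the kernel. The kernel is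
regularised to `(‖z‖² + ε²)^(-p/2)` for the integration by parts. -/
theorem rieszPotential_fderiv [Nontrivial E] {p : ℝ} (hp : 0 ≤ p)
    (hpn : p + 1 < Module.finrank ℝ E) {φ : E → ℝ} (hφ : ContDiff ℝ (⊤ : ℕ∞) φ)
    (hs : HasCompactSupport φ) {v : E} (hv : ‖v‖ ≤ 1) (x : E) :
    rieszPotential p (fun y => fderiv ℝ φ y v) x =
      p * ∫ z, (⟪v, z⟫ * ‖z‖ ^ (-(p + 2))) * φ (x + z) := by
  wlog hx : x = 0 generalizing x φ
  · have := this (φ := fun y => φ (x + y)) (hφ.comp (contDiff_const.add contDiff_id))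
      (hs.comp_homeomorph (Homeomorph.addLeft x)) 0 rfl
    simp only [rieszPotential, zero_add] at this ⊢
    rw [← this]
    simp only [fderiv_comp_add_left]
  subst hx
  simp only [rieszPotential, zero_add]
  set ψ : E → ℝ := fun y => fderiv ℝ φ y v with hψ
  have hψc : Continuous ψ := (hφ.continuous_fderiv (by simp)).clm_apply continuous_const
  have hψs : HasCompactSupport ψ := hs.fderiv_apply ℝ v
  obtain ⟨A, hA⟩ := hφ.continuous.bounded_above_of_compact_support hs
  obtain ⟨B, hB⟩ := hψc.bounded_above_of_compact_support hψs
  have hφi := hφ.continuous.integrable_of_hasCompactSupport (μ := volume) hs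
  have hψi := hψc.integrable_of_hasCompactSupport (μ := volume) hψs
  have hdiff : Differentiable ℝ φ := hφ.differentiable (by simp)
  have hq : ∀ ε : ℝ, 0 < ε → ∀ z : E, 0 < ‖z‖ ^ 2 + ε ^ 2 := fun ε hε z => by positivity
  have hpos : ∀ ε : ℝ, ∀ q : ℝ, 0 < ε → Continuous fun z : E => (‖z‖ ^ 2 + ε ^ 2) ^ q :=
    fun ε q hε => Continuous.rpow_const (by fun_prop) fun z => Or.inl (hq ε hε z).ne'
  have hfd : ∀ ε : ℝ, 0 < ε → ∀ z : E, HasFDerivAt (fun z : E => (‖z‖ ^ 2 + ε ^ 2) ^ (-(p / 2)))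
      ((-(p / 2) * (‖z‖ ^ 2 + ε ^ 2) ^ (-(p / 2) - 1)) • ((2 : ℝ) • innerSL ℝ z)) z := by
    intro ε hε z
    have h1 := (hasStrictFDerivAt_norm_sq z).hasFDerivAt.add_const (ε ^ 2)
    convert h1.rpow_const (p := -(p / 2)) (Or.inl (hq ε hε z).ne') using 1
    ext w
    simp
  -- integration by parts against the regularised kernel
  have key : ∀ ε : ℝ, 0 < ε → ∫ z, (‖z‖ ^ 2 + ε ^ 2) ^ (-(p / 2)) * ψ z =
      p * ∫ z, (⟪v, z⟫ * (‖z‖ ^ 2 + ε ^ 2) ^ (-(p / 2) - 1)) * φ z := by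
    intro ε hε
    have hfv : ∀ z : E, fderiv ℝ (fun z : E => (‖z‖ ^ 2 + ε ^ 2) ^ (-(p / 2))) z v =
        -p * (⟪v, z⟫ * (‖z‖ ^ 2 + ε ^ 2) ^ (-(p / 2) - 1)) := by
      intro z
      rw [(hfd ε hε z).fderiv]
      simp [real_inner_comm]
      ring
    have h := integral_mul_fderiv_eq_neg_fderiv_mul_of_integrable (μ := (volume : Measure E))
      (f := fun z : E => (‖z‖ ^ 2 + ε ^ 2) ^ (-(p / 2))) (g := φ) (v := v) ?_ ?_ ?_
      (fun z _ => (hfd ε hε z).differentiableAt) (fun z _ => hdiff z)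
    · rw [h, ← integral_const_mul, ← integral_neg]
      refine integral_congr_ae (ae_of_all _ fun z => ?_)
      simp only [hfv]
      ring
    · simp only [hfv]
      exact (Continuous.mul (continuous_const.mul ((continuous_const.inner continuous_id).mul
        (hpos ε _ hε))) hφ.continuous).integrable_of_hasCompactSupport hs.mul_left
    · exact ((hpos ε _ hε).mul hψc).integrable_of_hasCompactSupport hψs.mul_left
    · exact ((hpos ε _ hε).mul hφ.continuous).integrable_of_hasCompactSupport hs.mul_left
  have hae : ∀ᵐ z : E, z ≠ 0 :=
    compl_mem_ae_iff.2 (measure_singleton (μ := (volume : Measure E)) 0)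
  -- both sides converge as the regularisation is removed
  have hlim : ∀ q : ℝ, ∀ z : E, z ≠ 0 → Filter.Tendsto (fun ε : ℝ => (‖z‖ ^ 2 + ε ^ 2) ^ q)
      (𝓝[>] 0) (𝓝 (‖z‖ ^ (2 * q))) := by
    intro q z hz
    have hz' := norm_pos_iff.2 hz
    have h1 : Filter.Tendsto (fun ε : ℝ => ‖z‖ ^ 2 + ε ^ 2) (𝓝[>] 0) (𝓝 (‖z‖ ^ 2)) := by
      have : Continuous fun ε : ℝ => ‖z‖ ^ 2 + ε ^ 2 := by fun_prop
      have := this.tendsto 0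
      simp only [ne_eq, OfNat.ofNat_ne_zero, not_false_eq_true, zero_pow, add_zero] at this
      exact this.mono_left nhdsWithin_le_nhds
    have h2 := h1.rpow_const (p := q) (Or.inl (by positivity))
    have e : (‖z‖ ^ 2) ^ q = ‖z‖ ^ (2 * q) := by
      rw [← Real.rpow_two, ← Real.rpow_mul (norm_nonneg _)]
    rwa [e] at h2
  have hle : ∀ q : ℝ, q ≤ 0 → ∀ ε : ℝ, ∀ z : E, z ≠ 0 →
      (‖z‖ ^ 2 + ε ^ 2) ^ q ≤ ‖z‖ ^ (2 * q) := by
    intro q hq' ε z hz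
    have hz' := norm_pos_iff.2 hz
    have := Real.rpow_le_rpow_of_nonpos (x := ‖z‖ ^ 2) (y := ‖z‖ ^ 2 + ε ^ 2) (by positivity)
      (by linarith [sq_nonneg ε]) hq'
    have e : (‖z‖ ^ 2) ^ q = ‖z‖ ^ (2 * q) := by
      rw [← Real.rpow_two, ← Real.rpow_mul (norm_nonneg _)]
    rwa [e] at this
  have e1 : (2 : ℝ) * -(p / 2) = -p := by ring
  have e2 : (2 : ℝ) * (-(p / 2) - 1) = -(p + 2) := by ring
  have hL : Filter.Tendsto (fun ε : ℝ => ∫ z, (‖z‖ ^ 2 + ε ^ 2) ^ (-(p / 2)) * ψ z) (𝓝[>] 0)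
      (𝓝 (∫ z, ‖z‖ ^ (-p) * ψ z)) := by
    have hb := (integrable_singular_mul hp (by linarith) (measurable_norm_rpow (E := E) (-p))
      (fun z => (abs_of_nonneg (Real.rpow_nonneg (norm_nonneg _) _)).le) hψi hB).1.abs
    refine tendsto_integral_filter_of_dominated_convergence _ ?_ ?_ hb ?_
    · filter_upwards [self_mem_nhdsWithin] with ε hε
      exact ((hpos ε _ hε).mul hψc).aestronglyMeasurable
    · refine Filter.Eventually.of_forall fun ε => ?_
      filter_upwards [hae] with z hz
      rw [norm_mul, abs_mul, Real.norm_of_nonneg (by positivity),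
        abs_of_nonneg (Real.rpow_nonneg (norm_nonneg z) _), ← e1]
      exact mul_le_mul_of_nonneg_right (hle _ (by linarith) ε z hz) (abs_nonneg _)
    · filter_upwards [hae] with z hz
      rw [← e1]
      exact (hlim _ z hz).mul_const _
  have hRt : Filter.Tendsto (fun ε : ℝ => ∫ z, (⟪v, z⟫ * (‖z‖ ^ 2 + ε ^ 2) ^ (-(p / 2) - 1)) * φ z)
      (𝓝[>] 0) (𝓝 (∫ z, (⟪v, z⟫ * ‖z‖ ^ (-(p + 2))) * φ z)) := by
    have hb := (integrable_singular_mul (p := p + 1) (by linarith) hpn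
      (κ := fun z : E => ⟪v, z⟫ * ‖z‖ ^ (-(p + 2)))
      (by fun_prop) (abs_inner_mul_norm_rpow_le hv p) hφi hA).1.abs
    refine tendsto_integral_filter_of_dominated_convergence _ ?_ ?_ hb ?_
    · filter_upwards [self_mem_nhdsWithin] with ε hε
      exact (((continuous_const.inner continuous_id).mul (hpos ε _ hε)).mul
        hφ.continuous).aestronglyMeasurable
    · refine Filter.Eventually.of_forall fun ε => ?_
      filter_upwards [hae] with z hz
      rw [norm_mul, norm_mul, abs_mul, abs_mul, Real.norm_eq_abs, Real.norm_eq_abs,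
        Real.norm_eq_abs, abs_of_nonneg (a := (‖z‖ ^ 2 + ε ^ 2) ^ (-(p / 2) - 1)) (by positivity),
            abs_of_nonneg (Real.rpow_nonneg (norm_nonneg z) _), ← e2]
      exact mul_le_mul_of_nonneg_right (mul_le_mul_of_nonneg_left
        (hle _ (by linarith) ε z hz) (abs_nonneg _)) (abs_nonneg _)
    · filter_upwards [hae] with z hz
      rw [← e2]
      exact ((hlim _ z hz).const_mul _).mul_const _
  refine tendsto_nhds_unique hL ((hRt.const_mul p).congr' ?_)
  filter_upwards [self_mem_nhdsWithin] with ε hε using (key ε hε).symm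

end Potential

/-! ### Localisation of the fractional Laplacian of a Lipschitz function -/

section Pairing

open Metric
open scoped RealInnerProductSpace

variable {E : Type} [NormedAddCommGroup E] [InnerProductSpace ℝ E] [FiniteDimensional ℝ E]
  [MeasurableSpace E] [BorelSpace E]

theorem exists_smooth_cutoff {K : Set E} (hK : IsCompact K) {U : Set E} (hU : IsOpen U)
    (hKU : K ⊆ U) : ∃ χ : E → ℝ, ContDiff ℝ (⊤ : ℕ∞) χ ∧ HasCompactSupport χ ∧ tsupport χ ⊆ U ∧
      ∀ᶠ x in 𝓝ˢ K, χ x = 1 := by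
  obtain ⟨L, hL, hKL, hLU⟩ := exists_compact_between hK hU hKU
  obtain ⟨f, h1, h0, -⟩ := exists_contMDiffMap_one_nhds_of_subset_interior (n := (⊤ : ℕ∞))
    (modelWithCornersSelf ℝ E) hK.isClosed hKL
  have hsub : tsupport f ⊆ L := closure_minimal (fun x hx => by
    by_contra h; exact hx (h0 x h)) hL.isClosed
  exact ⟨f, f.contMDiff.contDiff, hL.of_isClosed_subset (isClosed_tsupport _) hsub,
    hsub.trans hLU, h1⟩

/-- Second differences are symmetric, by translation invariance of the integral. -/
theorem integral_mul_secondDiff_comm {F G : E → ℝ} (hF : Integrable F) (hG : Continuous G) {A : ℝ}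
    (hA : ∀ x, |G x| ≤ A) (h : E) :
    ∫ x, F x * secondDiff G x h = ∫ x, secondDiff F x h * G x := by
  have hi : ∀ a : E, Integrable fun x => F x * G (x + a) := fun a =>
    hF.mul_bdd (by fun_prop) (ae_of_all _ fun x => hA (x + a))
  have hi' : ∀ a : E, Integrable fun x => F (x + a) * G x := fun a =>
    (hF.comp_add_right a).mul_bdd hG.aestronglyMeasurable (ae_of_all _ hA)
  have hs : ∀ a : E, ∫ x, F x * G (x + a) = ∫ x, F (x + -a) * G x := fun a => by
    rw [← integral_add_right_eq_self (fun x => F (x + -a) * G x) a]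
    simp
  have h0 : Integrable fun x => F x * G x := by simpa using hi 0
  have e1 : ∀ x, F x * secondDiff G x h = 2 * (F x * G x) - F x * G (x + h) - F x * G (x + -h) := by
    intro x; simp only [secondDiff, sub_eq_add_neg]; ring
  have e2 : ∀ x, secondDiff F x h * G x = 2 * (F x * G x) - F (x + h) * G x - F (x + -h) * G x := by
    intro x; simp only [secondDiff, sub_eq_add_neg]; ring
  simp only [e1, e2]
  rw [integral_sub (by exact (h0.const_mul 2).sub (hi h)) (hi (-h)),
    integral_sub (h0.const_mul 2) (hi h),
    integral_sub (by exact (h0.const_mul 2).sub (hi' h)) (hi' (-h)),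
    integral_sub (h0.const_mul 2) (hi' h), hs h, hs (-h), neg_neg]
  ring

/-- The cross term in the product rule for second differences:
`secondDiff (f v) = f secondDiff v + v secondDiff f - crossDiff f v`. It is quadratic in `h` when
`f` and `v` are Lipschitz. -/
def crossDiff (f v : E → ℝ) (x h : E) : ℝ :=
  (f x - f (x + h)) * (v x - v (x + h)) + (f x - f (x - h)) * (v x - v (x - h))

theorem abs_crossDiff_le {f v : E → ℝ} {K L : NNReal} (hf : LipschitzWith K f)
    (hv : LipschitzWith L v) {A B : ℝ} (hA : ∀ x, |f x| ≤ A) (hB : ∀ x, |v x| ≤ B) (x h : E) :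
    |crossDiff f v x h| ≤ (2 * K * L + 8 * A * B) * min (‖h‖ ^ 2) 1 := by
  have hA0 : 0 ≤ A := (abs_nonneg _).trans (hA 0)
  have hB0 : 0 ≤ B := (abs_nonneg _).trans (hB 0)
  have hlip : ∀ {g : E → ℝ} {C : NNReal}, LipschitzWith C g → ∀ a b : E, ‖a - b‖ = ‖h‖ →
      |g a - g b| ≤ C * ‖h‖ := by
    intro g C hg a b hab
    have := hg.dist_le_mul a b
    rwa [Real.dist_eq, dist_eq_norm, hab] at this
  have hbd : ∀ {g : E → ℝ} {C : ℝ}, (∀ x, |g x| ≤ C) → ∀ a b : E, |g a - g b| ≤ 2 * C := by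
    intro g C hg a b
    refine (abs_sub _ _).trans ?_
    linarith [hg a, hg b]
  have hn1 : ‖x - (x + h)‖ = ‖h‖ := by simp
  have hn2 : ‖x - (x - h)‖ = ‖h‖ := by simp
  have hK0 : (0 : ℝ) ≤ K := K.2
  have hL0 : (0 : ℝ) ≤ L := L.2
  rw [crossDiff]
  refine (abs_add_le _ _).trans ?_
  rw [abs_mul, abs_mul]
  rcases le_total (‖h‖ ^ 2) 1 with hh | hh
  · rw [min_eq_left hh]
    have h1 := mul_le_mul (hlip hf _ _ hn1) (hlip hv _ _ hn1) (abs_nonneg _) (by positivity)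
    have h2 := mul_le_mul (hlip hf _ _ hn2) (hlip hv _ _ hn2) (abs_nonneg _) (by positivity)
    have : 0 ≤ 8 * A * B * ‖h‖ ^ 2 := by positivity
    nlinarith
  · rw [min_eq_right hh]
    have h1 := mul_le_mul (hbd hA x (x + h)) (hbd hB x (x + h)) (abs_nonneg _) (by positivity)
    have h2 := mul_le_mul (hbd hA x (x - h)) (hbd hB x (x - h)) (abs_nonneg _) (by positivity)
    have : 0 ≤ 2 * K * L := by positivity
    nlinarith

theorem continuous_crossDiff {f v : E → ℝ} (hf : Continuous f) (hv : Continuous v) :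
    Continuous fun q : E × E => crossDiff f v q.1 q.2 := by
  unfold crossDiff; fun_prop

theorem integral_levy_swap {α : ℝ} {Q : E → E → ℝ}
    (hQ : Integrable (Function.uncurry fun x h => Q x h * fracKernel α h) (volume.prod volume)) :
    Integrable (fun x => ∫ h, Q x h * fracKernel α h) ∧
    Integrable (fun h => (∫ x, Q x h) * fracKernel α h) ∧
      ∫ x, ∫ h, Q x h * fracKernel α h = ∫ h, (∫ x, Q x h) * fracKernel α h := by
  have h1 := hQ.integral_prod_right
  simp only [Function.uncurry, integral_mul_const] at h1
  refine ⟨hQ.integral_prod_left, h1, ?_⟩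
  rw [integral_integral_swap hQ]
  simp only [integral_mul_const]

/-- In `∫ v Λg`, the integration over the increment `h` of the second difference can be done last.
-/
theorem integral_mul_singularLaplacian [Nontrivial E] {α : ℝ} (h0 : 0 < α) (h2 : α < 2)
    {v g : E → ℝ} (hv : Continuous v) (hs : HasCompactSupport v) (hg : Continuous g) {A M : ℝ}
    (hA : ∀ x, |g x| ≤ A) (hM : SecondDiffBound g M) :
    Integrable (fun h => (∫ x, v x * secondDiff g x h) * fracKernel α h) ∧
    Integrable (fun x => v x * singularLaplacian α g x) ∧
      ∫ x, v x * singularLaplacian α g x =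
        ∫ h, (∫ x, v x * secondDiff g x h) * fracKernel α h := by
  obtain ⟨R, hR⟩ := hs.exists_norm_bound
  obtain ⟨B, hB⟩ := hv.bounded_above_of_compact_support hs
  have hB0 : 0 ≤ B := (norm_nonneg _).trans (hB 0)
  have hvi : Integrable v := hv.integrable_of_hasCompactSupport hs
  have hm : ∀ h, Continuous fun x => secondDiff g x h := fun h =>
    (continuous_secondDiff hg).comp (Continuous.prodMk_left h)
  have hi : ∀ h, Integrable fun x => v x * secondDiff g x h := fun h =>
    hvi.mul_bdd (hm h).aestronglyMeasurable (ae_of_all _ fun x => abs_secondDiff_le hA x h)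
  have h := (integrable_levy_prod h0 h2 (Q := fun x h => v x * secondDiff g x h) (R := R)
    (M := B * M) (N := (∫ x, |v x|) * (4 * A))
    ((hv.comp continuous_fst).mul (continuous_secondDiff hg)) (fun x h => by
      rw [abs_mul, mul_assoc]
      exact mul_le_mul (hB x) (hM x h) (abs_nonneg _) hB0)
    (fun x h _ hx => by rw [hR x hx, zero_mul]) hi (fun h => by
      rw [← integral_mul_const]
      refine integral_mono (hi h).abs (hvi.abs.mul_const _) fun x => ?_
      simp only [abs_mul]
      exact mul_le_mul_of_nonneg_left (abs_secondDiff_le hA x h) (abs_nonneg _))).2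
  obtain ⟨h3, h4, h5⟩ := integral_levy_swap h
  simp only [mul_assoc, integral_const_mul] at h3 h5
  refine ⟨h4, h3, h5⟩

/-- For a compactly supported Lipschitz function `v`, the pairing `∫ v Λ(f ψ)` equals `∫ (f v) Λψ`
up to an error that involves only the values of `ψ`. The density of the error is the singular
integral of `crossDiff f v` minus `v Λf`; it is bounded because `v` is Lipschitz and `α < 2`. -/
theorem exists_local_pairing [Nontrivial E] {α : ℝ} (h0 : 0 < α) (h2 : α < 2) {f v : E → ℝ}
    (hf : ContDiff ℝ 2 f) (hfs : HasCompactSupport f) {L : NNReal} (hv : LipschitzWith L v)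
    (hvs : HasCompactSupport v) :
    ∃ g : E → ℝ, Integrable g ∧ (∃ B, ∀ x, |g x| ≤ B) ∧ ∀ ψ : E → ℝ, ContDiff ℝ 2 ψ →
      (∃ A, ∀ x, |ψ x| ≤ A) → (∃ M, SecondDiffBound ψ M) →
      Integrable (fun x => v x * singularLaplacian α (fun y => f y * ψ y) x) ∧
      ∫ x, v x * singularLaplacian α (fun y => f y * ψ y) x =
        (∫ x, (f x * v x) * singularLaplacian α ψ x) + ∫ x, ψ x * g x := by
  obtain ⟨A, M, hA, hM⟩ := hf.exists_secondDiffBound hfs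
  obtain ⟨B, hB⟩ := hv.continuous.bounded_above_of_compact_support hvs
  obtain ⟨K, hK⟩ := (hf.of_le one_le_two).lipschitzWith_of_hasCompactSupport hfs one_ne_zero
  have hA0 : 0 ≤ A := (abs_nonneg _).trans (hA 0)
  have hB0 : 0 ≤ B := (norm_nonneg _).trans (hB 0)
  have hcross := abs_crossDiff_le hK hv hA hB
  have hcc := continuous_crossDiff hf.continuous hv.continuous
  have hvi : Integrable v := hv.continuous.integrable_of_hasCompactSupport hvs
  obtain ⟨R₁, hR₁⟩ := hvs.exists_norm_bound
  have hcb : ∀ h, Integrable (fun x => |v x| + (|v (x + h)| + |v x|) + |v (x - h)|) := fun h =>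
    (hvi.abs.add ((hvi.abs.comp_add_right h).add hvi.abs)).add (hvi.abs.comp_sub_right h)
  have hcle : ∀ x h, |crossDiff f v x h| ≤
      2 * A * (|v x| + (|v (x + h)| + |v x|) + |v (x - h)|) := by
    intro x h
    have hb : ∀ a b : E, |f a - f b| ≤ 2 * A := fun a b =>
      (abs_sub _ _).trans (by linarith [hA a, hA b])
    rw [crossDiff]
    refine (abs_add_le _ _).trans ?_
    rw [abs_mul, abs_mul]
    have h3 := mul_le_mul (hb x (x + h)) (abs_sub (v x) (v (x + h))) (abs_nonneg _) (by linarith)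
    have h4 := mul_le_mul (hb x (x - h)) (abs_sub (v x) (v (x - h))) (abs_nonneg _) (by linarith)
    linarith
  have hci : ∀ h, Integrable fun x => crossDiff f v x h := fun h =>
    ((hcb h).const_mul (2 * A)).mono' (hcc.comp (Continuous.prodMk_left h)).aestronglyMeasurable
      (ae_of_all _ fun x => hcle x h)
  have hcN : ∀ h, ∫ x, |crossDiff f v x h| ≤ 8 * A * ∫ x, |v x| := by
    intro h
    refine (integral_mono (hci h).abs ((hcb h).const_mul (2 * A)) fun x => hcle x h).trans_eq ?_
    rw [integral_const_mul, integral_add (by exact hvi.abs.add ((hvi.abs.comp_add_right h).add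
        hvi.abs))
      (hvi.abs.comp_sub_right h), integral_add hvi.abs
          (by exact (hvi.abs.comp_add_right h).add hvi.abs),
      integral_add (hvi.abs.comp_add_right h) hvi.abs,
      integral_add_right_eq_self (fun x => |v x|), integral_sub_right_eq_self (fun x => |v x|)]
    ring
  have hcR : ∀ x h, ‖h‖ ≤ 1 → R₁ + 1 < ‖x‖ → crossDiff f v x h = 0 := by
    intro x h hh hx
    have h1 := norm_sub_norm_le x (-h)
    have h2 := norm_sub_norm_le x h
    rw [sub_neg_eq_add, norm_neg] at h1
    rw [crossDiff, hR₁ x (by linarith), hR₁ (x + h) (by linarith), hR₁ (x - h) (by linarith)]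
    ring
  have hJ : ∀ ψ : E → ℝ, Continuous ψ → (∃ C, ∀ x, |ψ x| ≤ C) →
      Integrable (Function.uncurry fun x h => (ψ x * crossDiff f v x h) * fracKernel α h)
        (volume.prod volume) := by
    rintro ψ hψ ⟨C, hC⟩
    have hC0 : 0 ≤ C := (abs_nonneg _).trans (hC 0)
    refine (integrable_levy_prod h0 h2 (R := R₁ + 1) (M := C * (2 * K * L + 8 * A * B))
      (N := C * (8 * A * ∫ x, |v x|)) ((hψ.comp continuous_fst).mul hcc) (fun x h => ?_)
      (fun x h hh hx => by rw [hcR x h hh hx, mul_zero])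
      (fun h => (hci h).bdd_mul hψ.aestronglyMeasurable (ae_of_all _ hC)) (fun h => ?_)).2
    · rw [abs_mul, mul_assoc]
      exact mul_le_mul (hC x) (hcross x h) (abs_nonneg _) hC0
    · refine le_trans ?_ (mul_le_mul_of_nonneg_left (hcN h) hC0)
      rw [← integral_const_mul]
      refine integral_mono ((hci h).bdd_mul hψ.aestronglyMeasurable (ae_of_all _ hC)).abs
        ((hci h).abs.const_mul C) fun x => ?_
      simp only [abs_mul]
      exact mul_le_mul_of_nonneg_right (hC x) (abs_nonneg _)
  set b : E → ℝ := fun x => ∫ h, crossDiff f v x h * fracKernel α h with hb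
  have hbi : Integrable b := by
    have := (integral_levy_swap (hJ (fun _ => 1) continuous_const ⟨1, by simp⟩)).1
    simpa only [one_mul] using this
  have hbb : ∀ x, |b x| ≤ (2 * K * L + 8 * A * B) * levyMass E α := by
    intro x
    rw [levyMass, ← integral_const_mul, hb, ← Real.norm_eq_abs]
    refine norm_integral_le_of_norm_le ((integrable_min_sq_mul_fracKernel (E := E) h0 h2).const_mul
      (2 * K * L + 8 * A * B)) (ae_of_all _ fun h => ?_)
    rw [norm_mul, Real.norm_eq_abs, Real.norm_eq_abs, abs_of_nonneg (fracKernel_nonneg α h),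
      ← mul_assoc]
    exact mul_le_mul_of_nonneg_right (hcross x h) (fracKernel_nonneg α h)
  have hΛc := continuous_singularLaplacian h0 h2 hf.continuous hM
  have hΛb := abs_singularLaplacian_le h0 h2 hM
  have hvΛ : Integrable fun x => v x * singularLaplacian α f x :=
    hvi.mul_bdd hΛc.aestronglyMeasurable (ae_of_all _ hΛb)
  refine ⟨fun x => b x - v x * singularLaplacian α f x, hbi.sub hvΛ,
    ⟨(2 * K * L + 8 * A * B) * levyMass E α + B * (M * levyMass E α), fun x => ?_⟩, ?_⟩
  · refine (abs_sub _ _).trans (add_le_add (hbb x) ?_)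
    rw [abs_mul]
    exact mul_le_mul (hB x) (hΛb x) (abs_nonneg _) hB0
  rintro ψ hψ ⟨C, hC⟩ ⟨M', hM'⟩
  have hfψ : ContDiff ℝ 2 fun y => f y * ψ y := hf.mul hψ
  have hfψs : HasCompactSupport fun y => f y * ψ y := hfs.mul_right
  obtain ⟨A₁, M₁, hA₁, hM₁⟩ := hfψ.exists_secondDiffBound hfψs
  have hfv : Continuous fun x => f x * v x := hf.continuous.mul hv.continuous
  have hfvs : HasCompactSupport fun x => f x * v x := hfs.mul_right
  obtain ⟨B₂, hB₂⟩ := hfv.bounded_above_of_compact_support hfvs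
  have hfvi : Integrable fun x => f x * v x := hfv.integrable_of_hasCompactSupport hfvs
  have hψv : Continuous fun x => ψ x * v x := hψ.continuous.mul hv.continuous
  have hψvs : HasCompactSupport fun x => ψ x * v x := hvs.mul_left
  have hψvi : Integrable fun x => ψ x * v x := hψv.integrable_of_hasCompactSupport hψvs
  obtain ⟨i1, j1, e1⟩ := integral_mul_singularLaplacian h0 h2 hv.continuous hvs hfψ.continuous
    hA₁ hM₁
  obtain ⟨i2, -, e2⟩ := integral_mul_singularLaplacian h0 h2 hfv hfvs hψ.continuous hC hM'
  obtain ⟨i3, j3, e3⟩ := integral_mul_singularLaplacian h0 h2 hψv hψvs hf.continuous hA hM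
  obtain ⟨j4, i4, e4⟩ := integral_levy_swap (hJ ψ hψ.continuous ⟨C, hC⟩)
  simp only [mul_assoc (ψ _) (crossDiff _ _ _ _), integral_const_mul] at e4 j4
  refine ⟨j1, ?_⟩
  have hsplit : ∫ x, ψ x * (b x - v x * singularLaplacian α f x) =
      (∫ x, ψ x * b x) - ∫ x, (ψ x * v x) * singularLaplacian α f x := by
    rw [hb, ← integral_sub j4 j3]
    refine integral_congr_ae (ae_of_all _ fun x => ?_)
    simp only
    ring
  rw [hsplit, e1, e2, e3, e4, ← integral_sub i4 i3, ← integral_add i2 (by exact i4.sub i3)]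
  refine integral_congr_ae (ae_of_all _ fun h => ?_)
  simp only
  rw [← sub_mul, ← add_mul]
  congr 1
  -- for fixed `h`, the identity follows from translation invariance and the product rule
  have hm : ∀ {g : E → ℝ}, Continuous g → Continuous fun x => secondDiff g x h := fun hg =>
    (continuous_secondDiff hg).comp (Continuous.prodMk_left h)
  have k1 : Integrable fun x => secondDiff (fun y => f y * v y) x h * ψ x :=
    (integrable_secondDiff hfvi h).1.mul_bdd hψ.continuous.aestronglyMeasurable (ae_of_all _ hC)
  have k2 : Integrable fun x => (ψ x * v x) * secondDiff f x h :=
    hψvi.mul_bdd (hm hf.continuous).aestronglyMeasurable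
      (ae_of_all _ fun x => abs_secondDiff_le hA x h)
  have k3 : Integrable fun x => ψ x * crossDiff f v x h :=
    (hci h).bdd_mul hψ.continuous.aestronglyMeasurable (ae_of_all _ hC)
  have := integral_mul_secondDiff_comm hvi hfψ.continuous hA₁ h
  rw [this]
  rw [integral_mul_secondDiff_comm hfvi hψ.continuous hC h, ← integral_sub k3 k2,
    ← integral_add k1 (by exact k3.sub k2)]
  refine integral_congr_ae (ae_of_all _ fun x => ?_)
  simp only [secondDiff, crossDiff]
  ring

/-- Pairing a function `w` that vanishes near the support of `f` with the fractional Laplacian of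
`f ψ`: the kernel is only evaluated away from its singularity. -/
theorem exists_far_pairing [Nontrivial E] {α : ℝ} (h0 : 0 < α) {f w : E → ℝ}
    (hf : Continuous f) (hfs : HasCompactSupport f) (hw : AEStronglyMeasurable w)
    (hwi : Integrable fun x => w x * (1 + ‖x‖) ^ (-(Module.finrank ℝ E + α))) {r : ℝ} (hr : 0 < r)
    (hfw : ∀ x y, f y ≠ 0 → ‖y - x‖ < r → w x = 0) :
    ∃ g : E → ℝ, Integrable g ∧ (∃ B, ∀ x, |g x| ≤ B) ∧ ∀ ψ : E → ℝ, Continuous ψ →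
      (∃ A, ∀ x, |ψ x| ≤ A) →
      Integrable (fun x => w x * singularLaplacian α (fun y => f y * ψ y) x) ∧
      ∫ x, w x * singularLaplacian α (fun y => f y * ψ y) x = ∫ x, ψ x * g x := by
  obtain ⟨R₀, hR₀⟩ := hfs.exists_norm_bound
  set R := max R₀ 0
  have hR : ∀ x, R < ‖x‖ → f x = 0 := fun x hx => hR₀ x ((le_max_left _ _).trans_lt hx)
  have hRpos : 0 ≤ R := le_max_right _ _
  obtain ⟨A, hA⟩ := hf.bounded_above_of_compact_support hfs
  have hA0 : 0 ≤ A := (norm_nonneg _).trans (hA 0)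
  have hfi : Integrable f := hf.integrable_of_hasCompactSupport hfs
  set β : ℝ := (Module.finrank ℝ E : ℝ) + α with hβdef
  have hβ : 0 ≤ β := by positivity
  set c : ℝ := (1 + R) / r + 1 with hcdef
  have hc : 0 < c := by positivity
  set H : E → E → ℝ := fun x y => w x * f y * fracKernel α (y - x) with hH
  have hHle : ∀ x y, ‖H x y‖ ≤ ‖w x * (1 + ‖x‖) ^ (-β)‖ * (c ^ β * ‖f y‖) := by
    intro x y
    have hrhs : 0 ≤ ‖w x * (1 + ‖x‖) ^ (-β)‖ * (c ^ β * ‖f y‖) := by positivity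
    by_cases hfy : f y = 0
    · simp [hH, hfy]
    by_cases hwx : w x = 0
    · simp [hH, hwx]
    have h1 : r ≤ ‖y - x‖ := not_lt.1 fun h => hwx (hfw x y hfy h)
    have h2 : ‖y‖ ≤ R := not_lt.1 fun h => hfy (hR y h)
    have h3 : 1 + ‖x‖ ≤ c * ‖y - x‖ := by
      have h4 := norm_sub_norm_le x y
      rw [norm_sub_rev] at h4
      have h5 : 1 + R ≤ (1 + R) / r * ‖y - x‖ := by
        rw [div_mul_eq_mul_div, le_div_iff₀ hr]
        exact mul_le_mul_of_nonneg_left h1 (by linarith)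
      rw [hcdef, add_mul, one_mul]
      linarith
    have h6 : fracKernel α (y - x) ≤ c ^ β * (1 + ‖x‖) ^ (-β) := by
      have h7 : (1 + ‖x‖) / c ≤ ‖y - x‖ := by rwa [div_le_iff₀ hc, mul_comm]
      have h8 : 0 < 1 + ‖x‖ := by positivity
      calc fracKernel α (y - x) ≤ ((1 + ‖x‖) / c) ^ (-β) :=
            Real.rpow_le_rpow_of_nonpos (by positivity) h7 (by linarith)
        _ = c ^ β * (1 + ‖x‖) ^ (-β) := by
            rw [Real.div_rpow h8.le hc.le, Real.rpow_neg hc.le, div_inv_eq_mul, mul_comm]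
    simp only [hH, norm_mul]
    rw [Real.norm_of_nonneg (fracKernel_nonneg _ _),
      Real.norm_of_nonneg (Real.rpow_nonneg (by positivity) (-β) : 0 ≤ (1 + ‖x‖) ^ (-β))]
    have := mul_le_mul_of_nonneg_left h6 (by positivity : 0 ≤ ‖w x‖ * ‖f y‖)
    linarith
  have hHi : Integrable (Function.uncurry H) (volume.prod volume) := by
    refine (hwi.norm.mul_prod (hfi.norm.const_mul (c ^ β))).mono' ?_
      (ae_of_all _ fun q => hHle q.1 q.2)
    exact (hw.comp_fst.mul hf.aestronglyMeasurable.comp_snd).mul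
      ((measurable_fracKernel α).comp (measurable_snd.sub measurable_fst)).aestronglyMeasurable
  refine ⟨fun y => -2 * ∫ x, H x y, hHi.integral_prod_right.const_mul (-2),
    ⟨2 * ((∫ x, ‖w x * (1 + ‖x‖) ^ (-β)‖) * (c ^ β * A)), fun y => ?_⟩, ?_⟩
  · rw [abs_mul, abs_neg, abs_two]
    refine mul_le_mul_of_nonneg_left ?_ zero_le_two
    rw [← integral_mul_const, ← Real.norm_eq_abs]
    refine norm_integral_le_of_norm_le (hwi.norm.mul_const _) (ae_of_all _ fun x => ?_)
    refine (hHle x y).trans (mul_le_mul_of_nonneg_left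
      (mul_le_mul_of_nonneg_left (hA y) (by positivity)) (norm_nonneg _))
  rintro ψ hψ ⟨C, hC⟩
  have hψH : Integrable (Function.uncurry fun x y => ψ y * H x y) (volume.prod volume) :=
    hHi.bdd_mul (hψ.comp continuous_snd).aestronglyMeasurable (ae_of_all _ fun q => hC q.2)
  have hfψi : Integrable fun y => f y * ψ y :=
    (hf.mul hψ).integrable_of_hasCompactSupport hfs.mul_right
  have hpt : ∀ x, w x * singularLaplacian α (fun y => f y * ψ y) x = -2 * ∫ y, ψ y * H x y := by
    intro x
    by_cases hwx : w x = 0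
    · simp [hH, hwx]
    rw [(singularLaplacian_of_eq_zero h0 hfψi hr (x := x) fun y hy => ?_).2, mul_left_comm,
      ← integral_const_mul]
    · congr 1
      refine integral_congr_ae (ae_of_all _ fun y => ?_)
      simp only [hH]
      ring
    · by_contra h
      exact hwx (hfw x y (left_ne_zero_of_mul h) hy)
  simp only [hpt]
  refine ⟨hψH.integral_prod_left.const_mul (-2), ?_⟩
  rw [integral_const_mul, integral_integral_swap hψH, ← integral_const_mul]
  refine integral_congr_ae (ae_of_all _ fun y => ?_)
  simp only [integral_const_mul]
  ring

theorem exists_lipschitzWith_cutoff_mul {U : Set E} {u χ : E → ℝ} (hχ : ContDiff ℝ 1 χ)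
    (hs : HasCompactSupport χ) (hsU : tsupport χ ⊆ U) {L : NNReal} (hu : LipschitzOnWith L u U) :
    ∃ L', LipschitzWith L' fun x => χ x * u x := by
  obtain ⟨K, hK⟩ := hχ.lipschitzWith_of_hasCompactSupport hs one_ne_zero
  obtain ⟨A, hA⟩ := hχ.continuous.bounded_above_of_compact_support hs
  obtain ⟨B, hB⟩ := hs.isCompact.exists_bound_of_continuousOn (hu.continuousOn.mono hsU)
  have hA0 : 0 ≤ A := (norm_nonneg _).trans (hA 0)
  have hK0 : (0 : ℝ) ≤ K := K.2
  have hL0 : (0 : ℝ) ≤ L := L.2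
  refine ⟨(A * L + |B| * K).toNNReal, LipschitzWith.of_dist_le_mul fun x y => ?_⟩
  rw [Real.coe_toNNReal _ (by positivity), Real.dist_eq]
  wlog hx : x ∈ tsupport χ generalizing x y
  · by_cases hy : y ∈ tsupport χ
    · rw [abs_sub_comm, dist_comm]
      exact this y x hy
    · rw [image_eq_zero_of_notMem_tsupport hx, image_eq_zero_of_notMem_tsupport hy]
      simp only [zero_mul, sub_self, abs_zero]
      positivity
  have hKxy : |χ x - χ y| ≤ K * dist x y := hK.dist_le_mul x y
  have hBx : |u x| ≤ |B| := (hB x hx).trans (le_abs_self B)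
  have hd := dist_nonneg (x := x) (y := y)
  by_cases hy : y ∈ tsupport χ
  · have hLxy : |u x - u y| ≤ L * dist x y := hu.dist_le_mul x (hsU hx) y (hsU hy)
    rw [show χ x * u x - χ y * u y = χ y * (u x - u y) + u x * (χ x - χ y) by ring]
    refine (abs_add_le _ _).trans ?_
    rw [abs_mul, abs_mul]
    have h1 := mul_le_mul (hA y) hLxy (abs_nonneg _) hA0
    rw [Real.norm_eq_abs] at h1
    have h2 := mul_le_mul hBx hKxy (abs_nonneg _) (abs_nonneg B)
    linarith
  · have h3 : χ y = 0 := image_eq_zero_of_notMem_tsupport hy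
    rw [h3, sub_zero] at hKxy
    rw [h3, zero_mul, sub_zero, abs_mul, mul_comm]
    have h2 := mul_le_mul hBx hKxy (abs_nonneg _) (abs_nonneg B)
    have h4 : 0 ≤ A * L * dist x y := by positivity
    linarith

/-- The localised pairing `ψ ↦ ∫ u Λ(f ψ)` is the fractional Laplacian of a compactly supported
Lipschitz function plus a bounded integrable function. -/
theorem exists_pairing [Nontrivial E] {α : ℝ} (h0 : 0 < α) (h2 : α < 2) {U : Set E}
    (hU : IsOpen U) {u : E → ℝ} {L : NNReal} (hu : LipschitzOnWith L u U)
    (hui : Integrable fun x => u x / (1 + ‖x‖) ^ (Module.finrank ℝ E + α)) {f : E → ℝ}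
    (hf : ContDiff ℝ 2 f) (hfs : HasCompactSupport f) (hfU : tsupport f ⊆ U) :
    ∃ F g : E → ℝ, (∃ L', LipschitzWith L' F) ∧ HasCompactSupport F ∧ Integrable g ∧
      (∃ B, ∀ x, |g x| ≤ B) ∧ ∀ ψ : E → ℝ, ContDiff ℝ 2 ψ → (∃ A, ∀ x, |ψ x| ≤ A) →
      (∃ M, SecondDiffBound ψ M) →
      ∫ x, u x * singularLaplacian α (fun y => f y * ψ y) x =
        (∫ x, F x * singularLaplacian α ψ x) + ∫ x, ψ x * g x := by
  obtain ⟨χ, hχ, hχs, hχU, hχ1⟩ := exists_smooth_cutoff hfs.isCompact hU hfU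
  obtain ⟨L₁, hL₁⟩ := exists_lipschitzWith_cutoff_mul (contDiff_infty.1 hχ 1) hχs hχU hu
  obtain ⟨A, hA⟩ := hχ.continuous.bounded_above_of_compact_support hχs
  obtain ⟨r, hr, hrsub⟩ : ∃ r, 0 < r ∧ ∀ x, (∃ y ∈ tsupport f, ‖y - x‖ < r) → χ x = 1 := by
    obtain ⟨V, hV, hKV, hV1⟩ := mem_nhdsSet_iff_exists.1 hχ1
    obtain ⟨r, hr, hrV⟩ := hfs.isCompact.exists_thickening_subset_open hV hKV
    refine ⟨r, hr, fun x ⟨y, hy, hyx⟩ => hV1 (hrV ?_)⟩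
    rw [mem_thickening_iff]
    exact ⟨y, hy, by rwa [dist_comm, dist_eq_norm]⟩
  have hpow : ∀ x : E, 0 < (1 + ‖x‖) ^ ((Module.finrank ℝ E : ℝ) + α) := fun x =>
    Real.rpow_pos_of_pos (by positivity) _
  have hpc : Continuous fun x : E => (1 + ‖x‖) ^ ((Module.finrank ℝ E : ℝ) + α) :=
    Continuous.rpow_const (by fun_prop) fun x => Or.inl (by positivity)
  have hum : AEStronglyMeasurable u := by
    refine (hui.1.mul hpc.aestronglyMeasurable).congr (ae_of_all _ fun x => ?_)
    simp only [Pi.mul_apply]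
    rw [div_mul_cancel₀ _ (hpow x).ne']
  have h1χ : Continuous fun x => 1 - χ x := continuous_const.sub hχ.continuous
  obtain ⟨g₂, hg₂, ⟨B₂, hB₂⟩, hw⟩ := exists_far_pairing h0 (w := fun x => (1 - χ x) * u x)
    hf.continuous hfs (h1χ.aestronglyMeasurable.mul hum) (by
      refine (hui.bdd_mul (c := 1 + A) h1χ.aestronglyMeasurable (ae_of_all _ fun x => ?_)).congr
        (ae_of_all _ fun x => ?_)
      · refine (norm_sub_le _ _).trans ?_
        rw [norm_one]
        linarith [hA x]
      · simp only
        rw [Real.rpow_neg (by positivity)]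
        ring) hr (fun x y hy hyx => by
      rw [hrsub x ⟨y, subset_tsupport _ hy, hyx⟩, sub_self, zero_mul])
  obtain ⟨g₁, hg₁, ⟨B₁, hB₁⟩, hv⟩ := exists_local_pairing h0 h2 hf hfs hL₁ hχs.mul_right
  obtain ⟨L₂, hL₂⟩ : ∃ L', LipschitzWith L' fun x => f x * (χ x * u x) :=
    exists_lipschitzWith_cutoff_mul (U := Set.univ) (hf.of_le one_le_two) hfs
      (Set.subset_univ _) hL₁.lipschitzOnWith
  refine ⟨fun x => f x * (χ x * u x), fun x => g₁ x + g₂ x, ⟨L₂, hL₂⟩, hfs.mul_right, hg₁.add hg₂,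
    ⟨B₁ + B₂, fun x => (abs_add_le _ _).trans (add_le_add (hB₁ x) (hB₂ x))⟩, ?_⟩
  rintro ψ hψ ⟨C, hC⟩ hM
  obtain ⟨i1, e1⟩ := hv ψ hψ ⟨C, hC⟩ hM
  obtain ⟨i2, e2⟩ := hw ψ hψ.continuous ⟨C, hC⟩
  have e3 : ∫ x, ψ x * (g₁ x + g₂ x) = (∫ x, ψ x * g₁ x) + ∫ x, ψ x * g₂ x := by
    simp only [mul_add]
    exact integral_add (hg₁.bdd_mul hψ.continuous.aestronglyMeasurable (ae_of_all _ hC))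
      (hg₂.bdd_mul hψ.continuous.aestronglyMeasurable (ae_of_all _ hC))
  rw [e3, ← add_assoc, ← e1, ← e2, ← integral_add i1 i2]
  refine integral_congr_ae (ae_of_all _ fun x => ?_)
  simp only
  ring

end Pairing

/-! ### The Riesz transform of the localised fractional Laplacian -/

section PairingDistribution

open Metric
open scoped RealInnerProductSpace

variable {E : Type} [NormedAddCommGroup E] [InnerProductSpace ℝ E] [FiniteDimensional ℝ E]
  [MeasurableSpace E] [BorelSpace E]

theorem singularLaplacian_const_mul (α c : ℝ) (f : E → ℝ) (x : E) :
    singularLaplacian α (fun y => c * f y) x = c * singularLaplacian α f x := by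
  rw [singularLaplacian, singularLaplacian, ← integral_const_mul]
  refine integral_congr_ae (ae_of_all _ fun h => ?_)
  simp only [secondDiff]
  ring

theorem singularLaplacian_add [Nontrivial E] {α : ℝ} (h0 : 0 < α) (h2 : α < 2) {f g : E → ℝ}
    (hf : ContDiff ℝ 2 f) (hfs : HasCompactSupport f) (hg : ContDiff ℝ 2 g)
    (hgs : HasCompactSupport g) (x : E) :
    singularLaplacian α (fun y => f y + g y) x =
      singularLaplacian α f x + singularLaplacian α g x := by
  obtain ⟨-, M, -, hM⟩ := hf.exists_secondDiffBound hfs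
  obtain ⟨-, M', -, hM'⟩ := hg.exists_secondDiffBound hgs
  simp only [singularLaplacian]
  rw [← integral_add (integrable_secondDiff_mul h0 h2 hf.continuous hM x)
    (integrable_secondDiff_mul h0 h2 hg.continuous hM' x)]
  refine integral_congr_ae (ae_of_all _ fun h => ?_)
  simp only [secondDiff]
  ring

/-- The linear form `ψ ↦ ∫ F Λψ + ∫ ψ g` on test functions is continuous. -/
theorem exists_distribution_eq_pairing [Nontrivial E] {α : ℝ} (h0 : 0 < α) (h2 : α < 2)
    {F g : E → ℝ} (hF : Integrable F) (hg : Integrable g) :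
    ∃ T : 𝓓'((⊤ : Opens E), ℝ), ∀ ψ : 𝓓((⊤ : Opens E), ℝ),
      T ψ = (∫ x, F x * singularLaplacian α ψ x) + ∫ x, ψ x * g x := by
  have hi : ∀ f : E → ℝ, ContDiff ℝ 2 f → HasCompactSupport f →
      Integrable (fun x => F x * singularLaplacian α f x) ∧ Integrable (fun x => f x * g x) := by
    intro f hf hfs
    obtain ⟨A, M, hA, hM⟩ := hf.exists_secondDiffBound hfs
    exact ⟨hF.mul_bdd (continuous_singularLaplacian h0 h2 hf.continuous hM).aestronglyMeasurable
      (ae_of_all _ (abs_singularLaplacian_le h0 h2 hM)),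
      hg.bdd_mul hf.continuous.aestronglyMeasurable (ae_of_all _ hA)⟩
  set I : (E → ℝ) → ℝ := fun f => (∫ x, F x * singularLaplacian α f x) + ∫ x, f x * g x with hI
  have hadd : ∀ f₁ f₂ : E → ℝ, ContDiff ℝ 2 f₁ → HasCompactSupport f₁ → ContDiff ℝ 2 f₂ →
      HasCompactSupport f₂ → I (fun y => f₁ y + f₂ y) = I f₁ + I f₂ := by
    intro f₁ f₂ h₁ s₁ h₂ s₂
    simp only [hI, singularLaplacian_add h0 h2 h₁ s₁ h₂ s₂, mul_add, add_mul]
    rw [integral_add (hi f₁ h₁ s₁).1 (hi f₂ h₂ s₂).1, integral_add (hi f₁ h₁ s₁).2 (hi f₂ h₂ s₂).2]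
    ring
  have hsmul : ∀ (c : ℝ) (f : E → ℝ), I (fun y => c * f y) = c * I f := by
    intro c f
    simp only [hI, singularLaplacian_const_mul, mul_left_comm _ c, mul_assoc c, integral_const_mul]
    ring
  have hN : 0 ≤ ∫ x, |F x| := integral_nonneg fun _ => abs_nonneg _
  have hN' : 0 ≤ ∫ x, |g x| := integral_nonneg fun _ => abs_nonneg _
  have hJ := levyMass_nonneg (E := E) α
  have hbound : ∀ (f : E → ℝ) (A : ℝ), ContDiff ℝ 2 f → HasCompactSupport f →
      (∀ x, |f x| ≤ A) → (∀ x, ‖iteratedFDeriv ℝ 2 f x‖ ≤ A) →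
      |I f| ≤ ((∫ x, |F x|) * (6 * levyMass E α) + ∫ x, |g x|) * A := by
    intro f A hf hfs hA hB
    have hM := secondDiffBound_of_iteratedFDeriv hf hA hB
    obtain ⟨i1, i2⟩ := hi f hf hfs
    refine (abs_add_le _ _).trans ?_
    rw [add_mul]
    refine add_le_add ?_ ?_
    · calc |∫ x, F x * singularLaplacian α f x| ≤ ∫ x, |F x| *
          ((4 * A + 2 * A) * levyMass E α) := by
            rw [← Real.norm_eq_abs]
            refine norm_integral_le_of_norm_le (hF.abs.mul_const _) (ae_of_all _ fun x => ?_)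
            rw [norm_mul]
            exact mul_le_mul_of_nonneg_left (abs_singularLaplacian_le h0 h2 hM x) (norm_nonneg _)
        _ = _ := by
            rw [integral_mul_const]
            ring
    · rw [← integral_mul_const, ← Real.norm_eq_abs]
      refine norm_integral_le_of_norm_le (hg.abs.mul_const _) (ae_of_all _ fun x => ?_)
      rw [norm_mul, mul_comm]
      exact mul_le_mul_of_nonneg_left (hA x) (norm_nonneg _)
  have hsemi : ∀ (K : Compacts E) (f : 𝓓_{K}(E, ℝ)), ‖I f‖ ≤
      ((∫ x, |F x|) * (6 * levyMass E α) + ∫ x, |g x|) *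
        (({0, 2} : Finset ℕ).sup fun i => ContDiffMapSupportedIn.seminorm ℝ E ℝ ⊤ K i) f := by
    intro K f
    refine hbound f _ (contDiff_infty.1 f.contDiff 2) f.hasCompactSupport (fun x => ?_)
        (fun x => ?_)
    · refine (ContDiffMapSupportedIn.norm_apply_le_seminorm ℝ (f := f) (x := x)).trans ?_
      exact Seminorm.le_def.1 (Finset.le_sup
        (f := fun i => ContDiffMapSupportedIn.seminorm ℝ E ℝ ⊤ K i)
        (by simp : 0 ∈ ({0, 2} : Finset ℕ))) f
    · refine (ContDiffMapSupportedIn.norm_iteratedFDeriv_apply_le_seminorm_top ℝ (f := f)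
          (x := x)).trans ?_
      exact Seminorm.le_def.1 (Finset.le_sup
        (f := fun i => ContDiffMapSupportedIn.seminorm ℝ E ℝ ⊤ K i)
        (by simp : 2 ∈ ({0, 2} : Finset ℕ))) f
  let TK : ∀ K : Compacts E, 𝓓_{K}(E, ℝ) →L[ℝ] ℝ := fun K =>
    ContDiffMapSupportedIn.mkCLMtoNormedSpace ℝ (fun f => I f)
      (fun f₁ f₂ => hadd f₁ f₂ (contDiff_infty.1 f₁.contDiff 2) f₁.hasCompactSupport
        (contDiff_infty.1 f₂.contDiff 2) f₂.hasCompactSupport)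
      (fun c f => hsmul c f) ⟨{0, 2}, _, by positivity, hsemi K⟩
  let T : 𝓓((⊤ : Opens E), ℝ) →L[ℝ] ℝ :=
    TestFunction.limitCLM ℝ (fun ψ => I ψ) (fun K _ => TK K) (fun K hK f => rfl)
  exact ⟨T, fun ψ => rfl⟩

/-- The correlation of `φ` with the component `⟪v, z⟫ ‖z‖^(-(p+2))` in the direction `v` of the
Riesz kernel of order `s = p + 1`. -/
def rieszTransform (p : ℝ) (v : E) (φ : E → ℝ) (x : E) : ℝ :=
  ∫ z, (⟪v, z⟫ * ‖z‖ ^ (-(p + 2))) * φ (x + z)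

theorem rieszTransform_eq [Nontrivial E] {p : ℝ} (hp : 0 < p)
    (hpn : p + 1 < Module.finrank ℝ E) {φ : E → ℝ} (hφ : ContDiff ℝ (⊤ : ℕ∞) φ)
    (hs : HasCompactSupport φ) {v : E} (hv : ‖v‖ ≤ 1) :
    rieszTransform p v φ = fun x => p⁻¹ * rieszPotential p (fun y => fderiv ℝ φ y v) x := by
  ext x
  rw [rieszPotential_fderiv hp.le hpn hφ hs hv, inv_mul_cancel_left₀ hp.ne', rieszTransform]

theorem contDiff_fderiv_apply {φ : E → ℝ} (hφ : ContDiff ℝ (⊤ : ℕ∞) φ) (v : E) :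
    ContDiff ℝ (⊤ : ℕ∞) fun y => fderiv ℝ φ y v :=
  (hφ.fderiv_right (m := (⊤ : ℕ∞)) (by simp)).clm_apply contDiff_const

theorem rieszPotential_bounds [Nontrivial E] {p : ℝ} (hp : 0 ≤ p)
    (hpn : p < Module.finrank ℝ E) {φ : E → ℝ} (hφ : ContDiff ℝ (⊤ : ℕ∞) φ)
    (hs : HasCompactSupport φ) : ContDiff ℝ (⊤ : ℕ∞) (rieszPotential p φ) ∧
      (∃ A, ∀ x, |rieszPotential p φ x| ≤ A) ∧ ∃ M, SecondDiffBound (rieszPotential p φ) M := by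
  obtain ⟨h1, h2⟩ := rieszPotential_smooth hp hpn hφ hs
  obtain ⟨A, hA⟩ := h2 0
  obtain ⟨B, hB⟩ := h2 2
  simp only [norm_iteratedFDeriv_zero] at hA
  exact ⟨h1, ⟨A, hA⟩, _, secondDiffBound_of_iteratedFDeriv (contDiff_infty.1 h1 2) hA hB⟩

theorem rieszTransform_bounds [Nontrivial E] {p : ℝ} (hp : 0 < p)
    (hpn : p + 1 < Module.finrank ℝ E) {φ : E → ℝ} (hφ : ContDiff ℝ (⊤ : ℕ∞) φ)
    (hs : HasCompactSupport φ) {v : E} (hv : ‖v‖ ≤ 1) :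
    ContDiff ℝ (⊤ : ℕ∞) (rieszTransform p v φ) ∧ (∃ A, ∀ x, |rieszTransform p v φ x| ≤ A) ∧
      ∃ M, SecondDiffBound (rieszTransform p v φ) M := by
  obtain ⟨h1, ⟨A, hA⟩, M, hM⟩ := rieszPotential_bounds hp.le (by linarith : p < Module.finrank ℝ E)
    (contDiff_fderiv_apply hφ v) (hs.fderiv_apply ℝ v)
  rw [rieszTransform_eq hp hpn hφ hs hv]
  have hp' : 0 ≤ p⁻¹ := by positivity
  refine ⟨contDiff_const.mul h1, ⟨p⁻¹ * A, fun x => ?_⟩, p⁻¹ * M, fun x h => ?_⟩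
  · rw [abs_mul, abs_of_nonneg hp']
    exact mul_le_mul_of_nonneg_left (hA x) hp'
  · have : secondDiff (fun x => p⁻¹ * rieszPotential p (fun y => fderiv ℝ φ y v) x) x h =
        p⁻¹ * secondDiff (rieszPotential p fun y => fderiv ℝ φ y v) x h := by
      simp only [secondDiff]
      ring
    rw [this, abs_mul, abs_of_nonneg hp', mul_assoc]
    exact mul_le_mul_of_nonneg_left (hM x h) hp'

/-- Tested against Riesz transforms, the functional `ψ ↦ ∫ F Λψ + ∫ ψ g` is a bounded function.
Since `rieszTransform p v φ` is a multiple of `P (∂_v φ)` and `Λ P` is a multiple of the identity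
for `p = n - α`, the first term becomes a derivative of the Lipschitz function `F`. -/
theorem exists_bounded_rieszTransform [Nontrivial E] {α : ℝ} (h1 : 1 < α) (h2 : α < 2)
    (hn : α < Module.finrank ℝ E) {F g : E → ℝ} {L : NNReal} (hF : LipschitzWith L F)
    (hg : Integrable g) {B : ℝ} (hB : ∀ x, |g x| ≤ B) {v : E}
    (hv : ‖v‖ ≤ 1) :
    ∃ G : E → ℝ, AEStronglyMeasurable G ∧ (∃ C, ∀ y, |G y| ≤ C) ∧ ∀ φ : E → ℝ,
      ContDiff ℝ (⊤ : ℕ∞) φ → HasCompactSupport φ →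
      (∫ x, F x * singularLaplacian α (rieszTransform (Module.finrank ℝ E - α) v φ) x) +
        ∫ x, rieszTransform (Module.finrank ℝ E - α) v φ x * g x = ∫ y, G y * φ y := by
  have h0 : 0 < α := by linarith
  obtain ⟨c, -, hc⟩ := exists_rieszPotential_singularLaplacian (E := E) h0 h2 hn
  set p : ℝ := (Module.finrank ℝ E : ℝ) - α with hpdef
  have hp : 0 < p := by linarith
  have hpn : p + 1 < Module.finrank ℝ E := by linarith
  set κ : E → ℝ := fun z => ⟪v, z⟫ * ‖z‖ ^ (-(p + 2)) with hκ
  have hκm : Measurable κ := by fun_prop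
  have hκp : ∀ z, |κ z| ≤ ‖z‖ ^ (-(p + 1)) := abs_inner_mul_norm_rpow_le hv p
  set W : E → ℝ := fun y => ∫ z, κ z * g (y - z) with hW
  have hWm : AEStronglyMeasurable W := by
    have : AEStronglyMeasurable (Function.uncurry fun y z : E => κ z * g (y - z))
        (volume.prod volume) :=
      (hκm.comp measurable_snd).aestronglyMeasurable.mul
        (hg.1.comp_quasiMeasurePreserving (quasiMeasurePreserving_sub_of_right_invariant _ _))
    exact this.integral_prod_right'
  have hWb : ∀ y, |W y| ≤ B * ballMass E (p + 1) + ∫ z, |g z| := by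
    intro y
    have := (integrable_singular_mul (by linarith) hpn hκm hκp (hg.comp_sub_left y)
      (fun z => hB (y - z))).2
    rw [integral_sub_left_eq_self (fun z => |g z|)] at this
    exact (abs_integral_le_integral_abs).trans this
  have hD : ∀ y, |lineDeriv ℝ F y v| ≤ L * ‖v‖ := fun y => norm_lineDeriv_le_of_lipschitz ℝ hF
  have hDm : AEStronglyMeasurable fun y => lineDeriv ℝ F y v :=
    (aemeasurable_lineDeriv hF.continuous volume).aestronglyMeasurable
  refine ⟨fun y => -(p⁻¹ * c) * lineDeriv ℝ F y v + W y, (hDm.const_mul _).add hWm,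
    ⟨|-(p⁻¹ * c)| * (L * ‖v‖) + (B * ballMass E (p + 1) + ∫ z, |g z|), fun y => ?_⟩,
    fun φ hφ hs => ?_⟩
  · refine (abs_add_le _ _).trans (add_le_add ?_ (hWb y))
    rw [abs_mul]
    exact mul_le_mul_of_nonneg_left (hD y) (abs_nonneg _)
  have hφi : Integrable φ := hφ.continuous.integrable_of_hasCompactSupport hs
  obtain ⟨A, hA⟩ := hφ.continuous.bounded_above_of_compact_support hs
  have hφv := contDiff_fderiv_apply hφ v
  have hφvs : HasCompactSupport fun y => fderiv ℝ φ y v := hs.fderiv_apply ℝ v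
  obtain ⟨D, hD'⟩ := (contDiff_infty.1 hφ 1).lipschitzWith_of_hasCompactSupport hs one_ne_zero
  have e1 : ∫ x, F x * singularLaplacian α (rieszTransform p v φ) x =
      ∫ y, -(p⁻¹ * c) * lineDeriv ℝ F y v * φ y := by
    have e2 : ∀ x, singularLaplacian α (rieszTransform p v φ) x = p⁻¹ * (c * fderiv ℝ φ x v) := by
      intro x
      rw [rieszTransform_eq hp hpn hφ hs hv, singularLaplacian_const_mul,
        singularLaplacian_rieszPotential h0 h2 hp.le (by linarith) (contDiff_infty.1 hφv 2) hφvs,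
        hc _ hφv hφvs]
    have e3 := LipschitzWith.integral_lineDeriv_mul_eq (μ := (volume : Measure E)) hF hD' hs v
    simp only [e2, mul_assoc]
    rw [integral_const_mul, e3, ← integral_const_mul]
    refine integral_congr_ae (ae_of_all _ fun x => ?_)
    simp only
    rw [((hφ.differentiable (by simp)) x).lineDeriv_eq_fderiv, map_neg]
    ring
  have e4 : ∫ x, rieszTransform p v φ x * g x = ∫ y, W y * φ y :=
    integral_singular_adjoint (by linarith) hpn hκm hκp hφ.continuous hφi hA hg hB
  rw [e1, e4, ← integral_add]
  · refine integral_congr_ae (ae_of_all _ fun x => ?_)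
    simp only
    ring
  · exact hφi.bdd_mul (hDm.const_mul _) (ae_of_all _ fun y => by
      rw [norm_mul]; exact mul_le_mul_of_nonneg_left (hD y) (norm_nonneg _))
  · exact hφi.bdd_mul hWm (ae_of_all _ hWb)

end PairingDistribution

/-! ### Sets of capacity zero are removable -/

section Euclidean

variable {d : ℕ}

theorem nontrivial_euclideanSpace (hd : 0 < d) : Nontrivial (EuclideanSpace ℝ (Fin d)) :=
  Module.nontrivial_of_finrank_pos (R := ℝ) (by rwa [finrank_euclideanSpace_fin])

/-- The pairing with the Fourier multiplier is a multiple of the pairing with the singular integral.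
No integrability of `u` is needed: both integrands agree pointwise up to the constant. -/
theorem exists_fracLaplacianPairing_eq (hd : 0 < d) {α : ℝ} (h0 : 0 < α) (h2 : α < 2) :
    ∃ c : ℝ, c ≠ 0 ∧ ∀ u f : EuclideanSpace ℝ (Fin d) → ℝ, ContDiff ℝ (⊤ : ℕ∞) f →
      HasCompactSupport f →
      fracLaplacianPairing α u f = ((c * ∫ x, u x * singularLaplacian α f x : ℝ) : ℂ) := by
  have := nontrivial_euclideanSpace hd
  obtain ⟨c, hc0, hc⟩ :=
    exists_singularLaplacian_eq_fourierInv (E := EuclideanSpace ℝ (Fin d)) h0 h2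
  refine ⟨c⁻¹, inv_ne_zero hc0.ne', fun u f hf hs => ?_⟩
  have h := (hc f hf hs).2.2.2
  have hc' : (c : ℂ) ≠ 0 := by exact_mod_cast hc0.ne'
  rw [← integral_const_mul, ← integral_complex_ofReal, fracLaplacianPairing]
  refine integral_congr_ae (ae_of_all _ fun x => ?_)
  simp only [fracLaplacian]
  push_cast
  rw [h x]
  field_simp

theorem rieszKernel_apply (s : ℝ) (z : EuclideanSpace ℝ (Fin d)) (i : Fin d) :
    rieszKernel s z i = inner ℝ (EuclideanSpace.single i (1 : ℝ)) z * ‖z‖ ^ (-(s - 1 + 2)) := by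
  rw [rieszKernel, PiLp.smul_apply, smul_eq_mul, EuclideanSpace.inner_single_left,
    Real.rpow_neg (norm_nonneg _)]
  simp only [map_one, one_mul]
  rw [mul_comm]
  congr 3
  ring

theorem integral_rieszKernel_mul (s : ℝ) (φ : EuclideanSpace ℝ (Fin d) → ℝ) (i : Fin d)
    (x : EuclideanSpace ℝ (Fin d)) : ∫ y, rieszKernel s (y - x) i * φ y =
      rieszTransform (s - 1) (EuclideanSpace.single i 1) φ x := by
  rw [rieszTransform, ← integral_add_left_eq_self (fun y => rieszKernel s (y - x) i * φ y) x]
  simp only [add_sub_cancel_left, rieszKernel_apply]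

/-- The product of the test function `χ` and a smooth function `g`, as a test function. -/
def mulTestFunction {E : Type} [NormedAddCommGroup E] [NormedSpace ℝ E] {U : Opens E} (χ : 𝓓(U, ℝ))
    {g : E → ℝ} (hg : ContDiff ℝ (⊤ : ℕ∞) g) : 𝓓(U, ℝ) :=
  ⟨fun x => χ x * g x, χ.contDiff.mul hg, χ.hasCompactSupport.mul_right,
    (tsupport_mul_subset_left (f := χ) (g := g)).trans χ.tsupport_subset⟩

theorem mulTestFunction_apply {E : Type} [NormedAddCommGroup E] [NormedSpace ℝ E] {U : Opens E}
    (χ : 𝓓(U, ℝ)) {g : E → ℝ} (hg : ContDiff ℝ (⊤ : ℕ∞) g) (x : E) :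
    mulTestFunction χ hg x = χ x * g x := rfl

theorem exists_testFunction_eq_one {K : Set (EuclideanSpace ℝ (Fin d))} (hK : IsCompact K) :
    ∃ χ : 𝓓((⊤ : Opens (EuclideanSpace ℝ (Fin d))), ℝ), ∀ᶠ x in 𝓝ˢ K, χ x = 1 := by
  obtain ⟨χ, h1, h2, -, h3⟩ := exists_smooth_cutoff hK isOpen_univ (Set.subset_univ _)
  exact ⟨⟨χ, h1, h2, fun _ _ => trivial⟩, h3⟩

theorem exists_norm_le_of_coord {G : EuclideanSpace ℝ (Fin d) → EuclideanSpace ℝ (Fin d)}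
    {C : Fin d → ℝ}
    (hC : ∀ i y, |G y i| ≤ C i) : ∃ N : ℝ, 0 ≤ N ∧ ∀ y, ‖G y‖ ≤ N := by
  refine ⟨√(∑ i, C i ^ 2), Real.sqrt_nonneg _, fun y => ?_⟩
  rw [EuclideanSpace.norm_eq]
  refine Real.sqrt_le_sqrt (Finset.sum_le_sum fun i _ => ?_)
  exact pow_le_pow_left₀ (norm_nonneg _) (hC i y) 2

/-- If `u` violates removability, with a test function `f₀`, then the distribution
`ψ ↦ ∫ u Λ(f₀ ψ)` is supported in `E`, has a bounded convolution with the Riesz kernel, and has a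
nonzero total mass `∫ u Λf₀`. A multiple of it shows that the capacity is positive. -/
theorem isLipRemovable_of_rieszCapacity_eq_zero (hd : 2 ≤ d) {α s : ℝ} (hα : α ∈ Set.Ioo (1 : ℝ) 2)
    (hs : s = (d : ℝ) - α + 1) {E : Set (EuclideanSpace ℝ (Fin d))} (hE : IsCompact E)
    (hcap : rieszCapacity s E = 0) : IsLipRemovable α E := by
  obtain ⟨h1, h2⟩ := hα
  have h0 : 0 < α := by linarith
  have := nontrivial_euclideanSpace (d := d) (by omega)
  have hd' : (2 : ℝ) ≤ d := by exact_mod_cast hd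
  have hfin : (Module.finrank ℝ (EuclideanSpace ℝ (Fin d)) : ℝ) = d := by
    rw [finrank_euclideanSpace_fin]
  have hps : (Module.finrank ℝ (EuclideanSpace ℝ (Fin d)) : ℝ) - α = s - 1 := by rw [hfin, hs]; ring
  have hp : 0 < s - 1 := by rw [hs]; linarith
  have hpn : s - 1 + 1 < Module.finrank ℝ (EuclideanSpace ℝ (Fin d)) := by
    rw [hfin, hs]; linarith
  obtain ⟨c, hc0, hc⟩ := exists_fracLaplacianPairing_eq (d := d) (by omega) h0 h2
  rintro U u hEU ⟨L, hL⟩ hint hzero f₀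
  by_contra hne
  rw [hc u f₀ f₀.contDiff f₀.hasCompactSupport] at hne
  set a : ℝ := ∫ x, u x * singularLaplacian α f₀ x with ha
  have ha0 : a ≠ 0 := by
    intro h
    rw [h, mul_zero, Complex.ofReal_zero] at hne
    exact hne rfl
  obtain ⟨F, g, ⟨L', hF⟩, hFs, hg, ⟨B, hB⟩, hpair⟩ := exists_pairing h0 h2 U.isOpen hL
    (by rw [hfin]; exact hint) (contDiff_infty.1 f₀.contDiff 2) f₀.hasCompactSupport
    f₀.tsupport_subset
  obtain ⟨T₀, hT₀⟩ := exists_distribution_eq_pairing h0 h2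
    (hF.continuous.integrable_of_hasCompactSupport hFs) hg
  have hT₀' : ∀ ψ : 𝓓((⊤ : Opens (EuclideanSpace ℝ (Fin d))), ℝ),
      T₀ ψ = ∫ x, u x * singularLaplacian α (fun y => f₀ y * ψ y) x := by
    intro ψ
    obtain ⟨A, M, hA, hM⟩ := (contDiff_infty.1 ψ.contDiff 2).exists_secondDiffBound
      ψ.hasCompactSupport
    rw [hT₀, hpair ψ (contDiff_infty.1 ψ.contDiff 2) ⟨A, hA⟩ ⟨M, hM⟩]
  have he : ∀ i : Fin d, ‖EuclideanSpace.single i (1 : ℝ)‖ ≤ 1 := fun i => by simp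
  have hG := fun i => exists_bounded_rieszTransform h1 h2 (by rw [hfin]; linarith) hF hg hB (he i)
  rw [hps] at hG
  choose G₀ hG₀m hG₀b hG₀ using hG
  choose C hC using hG₀b
  set G : EuclideanSpace ℝ (Fin d) → EuclideanSpace ℝ (Fin d) :=
    fun y => WithLp.toLp 2 fun i => G₀ i y with hGdef
  obtain ⟨N, hN0, hN⟩ := exists_norm_le_of_coord (G := G) hC
  have hGm : AEStronglyMeasurable G :=
    (PiLp.continuous_toLp 2 _).comp_aestronglyMeasurable
      (aemeasurable_pi_lambda _ fun i => (hG₀m i).aemeasurable).aestronglyMeasurable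
  -- the factor `k` makes the total mass positive and the bound of `K * T` at most `1`
  set k : ℝ := a / (|a| * (N + 1)) with hk
  have hapos : 0 < |a| := abs_pos.2 ha0
  have hka : 0 < k * a := by
    rw [hk, div_mul_eq_mul_div, ← abs_mul_abs_self a]
    positivity
  have hkN : |k| * N ≤ 1 := by
    rw [hk, abs_div, abs_mul, abs_abs, abs_of_nonneg (by linarith : 0 ≤ N + 1),
      div_mul_eq_mul_div, div_le_one (by positivity)]
    nlinarith
  obtain ⟨η, hη⟩ := exists_testFunction_eq_one (f₀.hasCompactSupport.isCompact.union hE)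
  rw [nhdsSet_union, Filter.eventually_sup] at hη
  have hη0 : ∀ x, f₀ x * η x = f₀ x := by
    intro x
    by_cases hx : x ∈ tsupport f₀
    · rw [hη.1.self_of_nhdsSet x hx, mul_one]
    · rw [image_eq_zero_of_notMem_tsupport hx, zero_mul]
  have hsupp : Distribution.dsupport (k • T₀) ⊆ E := by
    intro x hx
    by_contra hxE
    rw [Distribution.mem_dsupport_iff_not_isVanishingOn] at hx
    refine hx Eᶜ hxE hE.isClosed.isOpen_compl fun ψ hψ => ?_
    have h3 := hzero (mulTestFunction f₀ ψ.contDiff) ?_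
    · rw [hc u _ (mulTestFunction f₀ ψ.contDiff).contDiff
        (mulTestFunction f₀ ψ.contDiff).hasCompactSupport, Complex.ofReal_eq_zero,
        mul_eq_zero, or_iff_right hc0] at h3
      change k • T₀ ψ = 0
      rw [hT₀' ψ]
      exact (congrArg (k • ·) h3).trans (smul_zero k)
    · rw [← Set.disjoint_iff_inter_eq_empty, ← Set.subset_compl_iff_disjoint_right]
      exact (tsupport_mul_subset_right (f := f₀) (g := ψ)).trans hψ
  have hmem : ((k * a : ℝ) : EReal) ≤ rieszCapacity s E := by
    refine le_sSup ⟨k • T₀, k * a, hsupp, ⟨fun y => k • G y, ?_, ?_, fun φ i => ?_⟩, ⟨η, ?_, ?_⟩,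
      rfl⟩
    · exact memLp_top_of_bound (hGm.const_smul k) (|k| * N) (ae_of_all _ fun y => by
        rw [norm_smul]; exact mul_le_mul_of_nonneg_left (hN y) (norm_nonneg _))
    · refine (eLpNorm_le_of_ae_bound (C := 1) (ae_of_all _ fun y => ?_)).trans (by simp)
      rw [norm_smul]
      exact (mul_le_mul_of_nonneg_left (hN y) (norm_nonneg _)).trans hkN
    · obtain ⟨hψ, hψb, hψM⟩ := rieszTransform_bounds hp hpn φ.contDiff φ.hasCompactSupport (he i)
      refine ⟨mulTestFunction η hψ, ?_, ?_⟩
      · refine Filter.Eventually.filter_mono (nhdsSet_mono hsupp) (hη.2.mono fun x hx => ?_)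
        rw [mulTestFunction_apply, hx, one_mul]
        exact (integral_rieszKernel_mul s φ i x).symm
      · change k • T₀ (mulTestFunction η hψ) = _
        rw [hT₀']
        simp only [mulTestFunction_apply, ← mul_assoc, hη0]
        rw [hpair _ (contDiff_infty.1 hψ 2) hψb hψM, hG₀ i φ φ.contDiff φ.hasCompactSupport,
          smul_eq_mul, ← integral_const_mul]
        refine integral_congr_ae (ae_of_all _ fun y => ?_)
        simp [hGdef, mul_assoc]
    · exact Filter.Eventually.filter_mono (nhdsSet_mono hsupp) hη.2
    · change k • T₀ η = _
      rw [hT₀']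
      simp only [hη0]
      rw [smul_eq_mul]
  rw [hcap] at hmem
  have : k * a ≤ 0 := by exact_mod_cast hmem
  linarith

end Euclidean

/-! ### The Lipschitz potential of a distribution with bounded Riesz transform -/

section Potential

open Metric
open scoped Convolution

variable {E : Type} [NormedAddCommGroup E] [InnerProductSpace ℝ E] [FiniteDimensional ℝ E]
  [MeasurableSpace E] [BorelSpace E]

/-- The product of the test function `χ` and the translate `g (· - b)`, as a test function. -/
def mulTranslate (χ : 𝓓((⊤ : Opens E), ℝ)) {g : E → ℝ} (hg : ContDiff ℝ (⊤ : ℕ∞) g) (b : E) :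
    𝓓((⊤ : Opens E), ℝ) :=
  mulTestFunction χ (g := fun y => g (y - b)) (hg.comp (contDiff_id.sub contDiff_const))

theorem mulTranslate_apply (χ : 𝓓((⊤ : Opens E), ℝ)) {g : E → ℝ} (hg : ContDiff ℝ (⊤ : ℕ∞) g)
    (b y : E) : mulTranslate χ hg b y = χ y * g (y - b) := rfl

theorem exists_iteratedFDeriv_mulTranslate_le (χ : 𝓓((⊤ : Opens E), ℝ)) {g : E → ℝ}
    (hg : ContDiff ℝ (⊤ : ℕ∞) g) (hb : ∀ i, ∃ C, ∀ x, ‖iteratedFDeriv ℝ i g x‖ ≤ C) (i : ℕ) :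
    ∃ C, ∀ b y, ‖iteratedFDeriv ℝ i (mulTranslate χ hg b) y‖ ≤ C := by
  have hχ : ∀ i, ∃ C, ∀ x, ‖iteratedFDeriv ℝ i χ x‖ ≤ C := fun i =>
    Continuous.bounded_above_of_compact_support
      (χ.contDiff.continuous_iteratedFDeriv (by exact_mod_cast le_top))
      (χ.hasCompactSupport.iteratedFDeriv i)
  choose A hA using hχ
  choose B hB using hb
  refine ⟨∑ j ∈ Finset.range (i + 1), (i.choose j : ℝ) * A j * B (i - j), fun b y => ?_⟩
  have h1 := norm_iteratedFDeriv_mul_le (𝕜 := ℝ) (f := χ) (g := fun y => g (y - b)) (x := y)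
      (n := i)
    (N := (⊤ : ℕ∞)) χ.contDiff (hg.comp (contDiff_id.sub contDiff_const))
    (by exact_mod_cast le_top)
  refine h1.trans (Finset.sum_le_sum fun j _ => ?_)
  rw [iteratedFDeriv_comp_sub]
  have hA0 : 0 ≤ A j := (norm_nonneg _).trans (hA j y)
  gcongr
  · exact hA j y
  · exact hB (i - j) (y - b)

/-- A distribution commutes with averages of translates of a smooth function with bounded
derivatives. -/
theorem Distribution.apply_integral_mulTranslate {X : Type*} [NormedAddCommGroup X]
    [NormedSpace ℝ X] [MeasurableSpace X] [BorelSpace X] [SecondCountableTopology X]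
    (T : 𝓓'((⊤ : Opens E), ℝ)) (χ : 𝓓((⊤ : Opens E), ℝ)) {g : E → ℝ}
    (hg : ContDiff ℝ (⊤ : ℕ∞) g) (hb : ∀ i, ∃ C, ∀ x, ‖iteratedFDeriv ℝ i g x‖ ≤ C)
    {a : X → E} (ha : ContDiff ℝ (⊤ : ℕ∞) a) :
    Continuous (fun x => T (mulTranslate χ hg (a x))) ∧
      (∃ C, ∀ x, |T (mulTranslate χ hg (a x))| ≤ C) ∧
      ∀ (ν : Measure X) (w : X → ℝ), Integrable w ν → ∀ J : 𝓓((⊤ : Opens E), ℝ),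
        (∀ y, J y = χ y * ∫ x, w x * g (y - a x) ∂ν) →
        T J = ∫ x, w x * T (mulTranslate χ hg (a x)) ∂ν := by
  obtain ⟨h1, h2, h3⟩ := T.apply_integral_param (Φ := fun x => mulTranslate χ hg (a x))
    (K := ⟨tsupport χ, χ.hasCompactSupport⟩)
    ((χ.contDiff.comp contDiff_snd).mul (hg.comp (contDiff_snd.sub (ha.comp contDiff_fst))))
    (fun x y hy => subset_tsupport χ fun h0 => hy (by
      simp only [mulTranslate_apply]
      rw [h0, zero_mul]))
    (fun i => (exists_iteratedFDeriv_mulTranslate_le χ hg hb i).imp fun C hC x => hC (a x))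
  refine ⟨h1, h2, fun ν w hw J hJ => h3 ν w hw J fun y => ?_⟩
  rw [hJ, ← integral_const_mul]
  refine integral_congr_ae (ae_of_all _ fun x => ?_)
  simp only [mulTranslate_apply]
  ring

/-- Riesz potentials commute with derivatives. -/
theorem fderiv_rieszPotential [Nontrivial E] {p : ℝ} (hp : 0 ≤ p) (hpn : p < Module.finrank ℝ E)
    {φ : E → ℝ} (hφ : ContDiff ℝ (⊤ : ℕ∞) φ) (hs : HasCompactSupport φ) (x v : E) :
    fderiv ℝ (rieszPotential p φ) x v = rieszPotential p (fun y => fderiv ℝ φ y v) x := by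
  have hk := locallyIntegrable_norm_rpow (E := E) hp hpn
  rw [rieszPotential_eq_convolution, rieszPotential_eq_convolution,
    (hs.hasFDerivAt_convolution_right _ hk (contDiff_infty.1 hφ 1) x).fderiv,
    convolution_precompR_apply _ hk (hs.fderiv ℝ)
        ((contDiff_infty.1 hφ 1).continuous_fderiv (by simp))]

section

variable {T : 𝓓'((⊤ : Opens E), ℝ)} {χ : 𝓓((⊤ : Opens E), ℝ)} {p : ℝ}

/-- The mollified potential `x ↦ ⟨T, χ (P ρ)(· - x)⟩` is Lipschitz if the Riesz transform of `χ T`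
is bounded by one, a condition that `hT` expresses by duality. Its increment is an integral over a
segment. -/
theorem abs_apply_mulTranslate_sub_le [Nontrivial E] (hp : 0 ≤ p)
    (hpn : p < Module.finrank ℝ E)
    (hT : ∀ (ρ : E → ℝ), ContDiff ℝ (⊤ : ℕ∞) ρ → HasCompactSupport ρ → ∀ (v : E)
      (h : ContDiff ℝ (⊤ : ℕ∞) (rieszPotential p fun y => fderiv ℝ ρ y v)) (b : E),
      |T (mulTranslate χ h b)| ≤ p * ‖v‖ * ∫ x, |ρ x|)
    {ρ : E → ℝ} (hρ : ContDiff ℝ (⊤ : ℕ∞) ρ) (hs : HasCompactSupport ρ) (h1 : ∫ x, |ρ x| = 1)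
    (hP : ContDiff ℝ (⊤ : ℕ∞) (rieszPotential p ρ)) (x y : E) :
    |T (mulTranslate χ hP x) - T (mulTranslate χ hP y)| ≤ p * ‖x - y‖ := by
  set v := x - y with hv
  obtain ⟨hD, hDb⟩ := rieszPotential_smooth hp hpn (contDiff_fderiv_apply hρ v)
      (hs.fderiv_apply ℝ v)
  have h3 := (T.apply_integral_mulTranslate χ hD hDb (X := ℝ) (a := fun τ => y + τ • v)
    (by fun_prop)).2.2 (volume.restrict (Set.Ioc 0 1)) (fun _ => -1) (integrable_const _)
    (mulTranslate χ hP x - mulTranslate χ hP y) (fun z => ?_)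
  · rw [← map_sub, h3]
    have h4 : ∀ τ : ℝ, ‖-1 * T (mulTranslate χ hD (y + τ • v))‖ ≤ p * ‖v‖ := fun τ => by
      simpa [h1] using hT ρ hρ hs v hD (y + τ • v)
    simpa using norm_integral_le_of_norm_le_const (μ := volume.restrict (Set.Ioc (0 : ℝ) 1))
      (ae_of_all _ h4)
  · change χ z * _ - χ z * _ = _
    rw [← mul_sub, ← intervalIntegral.integral_of_le zero_le_one,
      intervalIntegral.integral_eq_sub_of_hasDerivAt
        (f := fun τ => rieszPotential p ρ (z - (y + τ • v)))]
    · simp [hv]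
    · intro τ _
      have h4 : HasDerivAt (fun τ : ℝ => z - (y + τ • v)) (-v) τ := by
        simpa using (((hasDerivAt_id τ).smul_const v).const_add y).const_sub z
      have h5 := ((hP.differentiable (by simp)) (z - (y + τ • v))).hasFDerivAt.comp_hasDerivAt τ h4
      rw [map_neg, fderiv_rieszPotential hp hpn hρ hs] at h5
      simpa [Function.comp_def] using h5
    · refine (Continuous.intervalIntegrable ?_ _ _)
      exact continuous_const.mul (hD.continuous.comp (by fun_prop))

/-- Averaging the function `x ↦ ⟨T, χ g(· - x)⟩` amounts to replacing `g` by a convolution. -/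
theorem Distribution.apply_convolution_mulTranslate {w g : E → ℝ} (hw : Continuous w)
    (hws : HasCompactSupport w) (hg : ContDiff ℝ (⊤ : ℕ∞) g)
    (hb : ∀ i, ∃ C, ∀ x, ‖iteratedFDeriv ℝ i g x‖ ≤ C)
    (h : ContDiff ℝ (⊤ : ℕ∞) (w ⋆[ContinuousLinearMap.lsmul ℝ ℝ] g)) (b : E) :
    T (mulTranslate χ h b) = ∫ x, w x * T (mulTranslate χ hg (b + x)) := by
  refine (T.apply_integral_mulTranslate χ hg hb (a := fun x => b + x) (by fun_prop)).2.2 volume w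
    (hw.integrable_of_hasCompactSupport hws) _ fun y => ?_
  rw [mulTranslate_apply, convolution_def]
  simp [sub_sub]

/-- Averaging over a ball of radius `ε` moves a function with Lipschitz constant `L` by at most
`L ε`. -/
theorem abs_sub_integral_mul_le {u ρ : E → ℝ} {L ε : ℝ} (hL : 0 ≤ L) (hu : Continuous u)
    (huL : ∀ x y, |u x - u y| ≤ L * ‖x - y‖) (hρ : Continuous ρ) (hs : HasCompactSupport ρ)
    (h0 : ∀ x, 0 ≤ ρ x) (h1 : ∫ x, ρ x = 1) (hε : ∀ x, ρ x ≠ 0 → ‖x‖ ≤ ε) (x : E) :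
    |u x - ∫ v, ρ v * u (x + v)| ≤ L * ε := by
  have hi : Integrable ρ := hρ.integrable_of_hasCompactSupport hs
  have hi' : Integrable fun v => ρ v * u (x + v) :=
    (hρ.mul (by fun_prop)).integrable_of_hasCompactSupport hs.mul_right
  have e : u x - ∫ v, ρ v * u (x + v) = ∫ v, ρ v * (u x - u (x + v)) := by
    simp only [mul_sub]
    rw [integral_sub (hi.mul_const _) hi', integral_mul_const, h1, one_mul]
  have e' : L * ε = ∫ v, ρ v * (L * ε) := by rw [integral_mul_const, h1, one_mul]
  rw [e, e', ← Real.norm_eq_abs]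
  refine norm_integral_le_of_norm_le (hi.mul_const _) (ae_of_all _ fun v => ?_)
  rw [norm_mul, Real.norm_of_nonneg (h0 v)]
  rcases eq_or_ne (ρ v) 0 with hv | hv
  · simp [hv]
  · refine mul_le_mul_of_nonneg_left ((huL _ _).trans ?_) (h0 v)
    rw [sub_add_cancel_left, norm_neg]
    exact mul_le_mul_of_nonneg_left (hε v hv) hL

/-- There is a sequence of smooth mollifiers of radius `1 / (n + 1)`. -/
theorem exists_mollifier : ∃ ρ : ℕ → E → ℝ, (∀ n, ContDiff ℝ (⊤ : ℕ∞) (ρ n)) ∧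
    (∀ n, HasCompactSupport (ρ n)) ∧ (∀ n x, 0 ≤ ρ n x) ∧ (∀ n, ∫ x, ρ n x = 1) ∧
    (∀ n x, ρ n x ≠ 0 → ‖x‖ ≤ 1 / ((n : ℝ) + 1)) ∧
    ∀ g : E → ℝ, Continuous g →
      Filter.Tendsto (fun n => ∫ x, ρ n x * g x) Filter.atTop (𝓝 (g 0)) := by
  let b : ℕ → ContDiffBump (0 : E) := fun n =>
    ⟨1 / ((n : ℝ) + 1) / 2, 1 / ((n : ℝ) + 1), by positivity, half_lt_self (by positivity)⟩
  refine ⟨fun n => (b n).normed volume, fun n => (b n).contDiff_normed,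
    fun n => (b n).hasCompactSupport_normed, fun n => (b n).nonneg_normed,
    fun n => (b n).integral_normed, fun n x hx => ?_, fun g hg => ?_⟩
  · have : x ∈ Function.support ((b n).normed volume) := hx
    rw [(b n).support_normed_eq, mem_ball_zero_iff] at this
    exact this.le
  · have h := ContDiffBump.convolution_tendsto_right_of_continuous (φ := b) (μ := volume)
      (l := Filter.atTop) tendsto_one_div_add_atTop_nhds_zero_nat (hg.comp continuous_neg) 0
    simpa [convolution_def] using h

/-- If the Riesz transform of `χ T` is bounded, then `χ T` is, up to a constant, the fractional
Laplacian of a bounded Lipschitz function `u`: the potential `⟨T, χ(y) ‖y - x‖^(-p)⟩` of `χ T`.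
The mollified potentials `U n` are uniformly Lipschitz; mollifying `U n` with `ρ m` and `U m` with
`ρ n` gives the same function, so that they converge uniformly. -/
theorem exists_lipschitz_potential [Nontrivial E] {α : ℝ} (h0 : 0 < α) (h2 : α < 2)
    (hn : α < Module.finrank ℝ E) (hp : p = Module.finrank ℝ E - α)
    (hT : ∀ (ρ : E → ℝ), ContDiff ℝ (⊤ : ℕ∞) ρ → HasCompactSupport ρ → ∀ (v : E)
      (h : ContDiff ℝ (⊤ : ℕ∞) (rieszPotential p fun y => fderiv ℝ ρ y v)) (b : E),
      |T (mulTranslate χ h b)| ≤ p * ‖v‖ * ∫ x, |ρ x|) :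
    ∃ C : ℝ, C ≠ 0 ∧ ∃ u : E → ℝ, (∀ x y, |u x - u y| ≤ p * ‖x - y‖) ∧ (∃ B, ∀ x, |u x| ≤ B) ∧
      ∀ f (hf : ContDiff ℝ (⊤ : ℕ∞) f), HasCompactSupport f →
        ∫ x, u x * singularLaplacian α f x = C * T (mulTestFunction χ hf) := by
  have hp0 : 0 ≤ p := by linarith
  have hpn : p < Module.finrank ℝ E := by linarith
  obtain ⟨C, hC, hPL⟩ := exists_rieszPotential_singularLaplacian (E := E) h0 h2 hn
  rw [← hp] at hPL
  obtain ⟨ρ, hρ, hs, hnn, hone, hsupp, hlim⟩ := exists_mollifier (E := E)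
  have hρi : ∀ n, Integrable (ρ n) := fun n =>
    (hρ n).continuous.integrable_of_hasCompactSupport (hs n)
  have hρb : ∀ n, ∃ A, ∀ x, |ρ n x| ≤ A := fun n =>
    (hρ n).continuous.bounded_above_of_compact_support (hs n)
  choose hP hPb using fun n => rieszPotential_smooth hp0 hpn (hρ n) (hs n)
  set U : ℕ → E → ℝ := fun n x => T (mulTranslate χ (hP n) x) with hU
  have habs : ∀ n, ∫ x, |ρ n x| = 1 := fun n => by simp only [abs_of_nonneg (hnn n _), hone]
  have hUL : ∀ n x y, |U n x - U n y| ≤ p * ‖x - y‖ := fun n =>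
    abs_apply_mulTranslate_sub_le hp0 hpn hT (hρ n) (hs n) (habs n) (hP n)
  have hUA := fun n => T.apply_integral_mulTranslate χ (hP n) (hPb n) (X := E) (a := id) contDiff_id
  have hUc : ∀ n, Continuous (U n) := fun n => (hUA n).1
  -- double mollification is symmetric in the two mollifiers, as `ρ m ⋆ P (ρ n) = ρ n ⋆ P (ρ m)`
  have hsymm : ∀ n m x, ∫ v, ρ m v * U n (x + v) = ∫ v, ρ n v * U m (x + v) := by
    intro n m x
    have hc : ∀ n m, ContDiff ℝ (⊤ : ℕ∞)
        (ρ m ⋆[ContinuousLinearMap.lsmul ℝ ℝ] rieszPotential p (ρ n)) := fun n m =>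
      (hs m).contDiff_convolution_left _ (hρ m) (hP n).continuous.locallyIntegrable
    rw [← Distribution.apply_convolution_mulTranslate (hρ m).continuous (hs m) (hP n) (hPb n)
      (hc n m), ← Distribution.apply_convolution_mulTranslate (hρ n).continuous (hs n) (hP m)
      (hPb m) (hc m n)]
    refine congrArg T (DFunLike.ext _ _ fun y => ?_)
    simp only [mulTranslate_apply, convolution_def, ContinuousLinearMap.lsmul_apply, smul_eq_mul]
    obtain ⟨A, hA⟩ := hρb n
    obtain ⟨B, hB⟩ := hρb m
    rw [integral_rieszPotential_mul_comm hp0 hpn (hρ n).continuous (hρi n) hA (hρi m) hB]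
  have hdist : ∀ n m x, |U n x - U m x| ≤ p * (1 / ((n : ℝ) + 1)) + p * (1 / ((m : ℝ) + 1)) := by
    intro n m x
    have e1 := abs_sub_integral_mul_le hp0 (hUc n) (hUL n) (hρ m).continuous (hs m) (hnn m) (hone m)
      (hsupp m) x
    have e2 := abs_sub_integral_mul_le hp0 (hUc m) (hUL m) (hρ n).continuous (hs n) (hnn n) (hone n)
      (hsupp n) x
    rw [hsymm, abs_sub_le_iff] at e1
    rw [abs_sub_le_iff] at e2 ⊢
    constructor <;> linarith
  have hε : Filter.Tendsto (fun n : ℕ => p * (1 / ((n : ℝ) + 1))) Filter.atTop (𝓝 0) := by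
    simpa using tendsto_one_div_add_atTop_nhds_zero_nat.const_mul p
  have hcauchy : ∀ x, ∃ l, Filter.Tendsto (fun n => U n x) Filter.atTop (𝓝 l) := by
    intro x
    refine cauchySeq_tendsto_of_complete (cauchySeq_of_le_tendsto_0
      (fun N : ℕ => p * (1 / ((N : ℝ) + 1)) + p * (1 / ((N : ℝ) + 1))) (fun n m N hn hm => ?_)
      (by simpa using hε.add hε))
    rw [Real.dist_eq]
    refine (hdist n m x).trans ?_
    have : (N : ℝ) ≤ n := by exact_mod_cast hn
    have : (N : ℝ) ≤ m := by exact_mod_cast hm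
    gcongr
  choose u hu using hcauchy
  have hudist : ∀ n x, |U n x - u x| ≤ p * (1 / ((n : ℝ) + 1)) := fun n x =>
    le_of_tendsto_of_tendsto' ((hu x).const_sub (U n x)).abs
      (by simpa using hε.const_add (p * (1 / ((n : ℝ) + 1)))) fun m => hdist n m x
  obtain ⟨B, hB⟩ := (hUA 0).2.1
  have hBn : ∀ n x, |U n x| ≤ B + p + p := by
    intro n x
    have e1 := hdist n 0 x
    have e2 : p * (1 / ((n : ℝ) + 1)) ≤ p :=
      mul_le_of_le_one_right hp0 (by rw [div_le_one (by positivity)]; simp)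
    have e3 : |U 0 x| ≤ B := hB x
    have e4 := abs_sub_abs_le_abs_sub (U n x) (U 0 x)
    simp only [Nat.cast_zero, zero_add, div_one, mul_one] at e1
    linarith
  refine ⟨C, hC.ne', u, fun x y => ?_, ⟨B + p + p, fun x => ?_⟩, fun f hf hfs => ?_⟩
  · exact le_of_tendsto' ((hu x).sub (hu y)).abs fun n => hUL n x y
  · exact le_of_tendsto' (hu x).abs fun n => hBn n x
  obtain ⟨A, M, hA, hM⟩ := (contDiff_infty.1 hf 2).exists_secondDiffBound hfs
  have hΛc := continuous_singularLaplacian h0 h2 hf.continuous hM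
  have hΛb := abs_singularLaplacian_le h0 h2 hM
  have hΛi := ContDiff.integrable_singularLaplacian h0 h2 (contDiff_infty.1 hf 2) hfs
  have hfA := T.apply_integral_mulTranslate χ hf (fun i =>
    (hf.continuous_iteratedFDeriv (by exact_mod_cast le_top)).bounded_above_of_compact_support
      (hfs.iteratedFDeriv i)) (X := E) (a := id) contDiff_id
  -- `ρ n ⋆ f` is recovered as the potential of its fractional Laplacian
  have hkey : ∀ n, ∫ x, U n x * singularLaplacian α f x =
      C * ∫ x, ρ n x * T (mulTranslate χ hf x) := by
    intro n
    obtain ⟨A', hA'⟩ := hρb n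
    have hc : ContDiff ℝ (⊤ : ℕ∞) (ρ n ⋆[ContinuousLinearMap.lsmul ℝ ℝ] f) :=
      (hs n).contDiff_convolution_left _ (hρ n) hf.continuous.locallyIntegrable
    have e1 := hfA.2.2 volume (ρ n) (hρi n) (mulTestFunction χ hc) fun y => by
      simp [mulTestFunction_apply, convolution_def]
    have e2 := (hUA n).2.2 volume _ hΛi (C • mulTestFunction χ hc) fun y => by
      simp only [id]
      rw [integral_rieszPotential_mul_comm hp0 hpn (hρ n).continuous (hρi n) hA' hΛi hΛb]
      simp only [hPL f hf hfs]
      change C * (χ y * _) = _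
      simp only [convolution_def, ContinuousLinearMap.lsmul_apply, smul_eq_mul, mul_left_comm _ C]
      rw [integral_const_mul]
      ring
    rw [map_smul, e1, smul_eq_mul] at e2
    simp only [id] at e2
    rw [e2]
    exact integral_congr_ae (ae_of_all _ fun x => mul_comm _ _)
  have hl1 : Filter.Tendsto (fun n => ∫ x, U n x * singularLaplacian α f x) Filter.atTop
      (𝓝 (∫ x, u x * singularLaplacian α f x)) := by
    refine tendsto_integral_of_dominated_convergence
      (fun x => (B + p + p) * |singularLaplacian α f x|)
      (fun n => ((hUc n).mul hΛc).aestronglyMeasurable) (hΛi.abs.const_mul _)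
      (fun n => ae_of_all _ fun x => ?_) (ae_of_all _ fun x => (hu x).mul_const _)
    rw [norm_mul]
    exact mul_le_mul_of_nonneg_right (hBn n x) (norm_nonneg _)
  have hl2 := (hlim _ hfA.1).const_mul C
  simp only [hkey] at hl1
  rw [tendsto_nhds_unique hl1 hl2]
  congr 2
  refine DFunLike.ext _ _ fun y => ?_
  simp [mulTranslate_apply, mulTestFunction_apply]

end

end Potential

/-! ### Removable sets have capacity zero -/

section Removable

open scoped RealInnerProductSpace

variable {d : ℕ}

/-- The pairing of `T` with a smooth function can be computed with any cutoff `χ`. -/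
theorem PairsTo.apply_mulTestFunction {T : 𝓓'((⊤ : Opens (EuclideanSpace ℝ (Fin d))), ℝ)}
    {χ : 𝓓((⊤ : Opens (EuclideanSpace ℝ (Fin d))), ℝ)}
    (hχ : ∀ᶠ x in 𝓝ˢ (Distribution.dsupport T), χ x = 1) {g : EuclideanSpace ℝ (Fin d) → ℝ} {c : ℝ}
    (h : PairsTo T g c) (hg : ContDiff ℝ (⊤ : ℕ∞) g) : T (mulTestFunction χ hg) = c := by
  obtain ⟨k, hk, rfl⟩ := h
  rw [← sub_eq_zero, ← map_sub]
  refine Distribution.apply_eq_zero_of_eventuallyEq_zero T _ ?_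
  filter_upwards [hχ, hk] with x h1 h2
  change χ x * g x - k x = 0
  rw [h1, h2, one_mul, sub_self]

theorem norm_le_one_of_eLpNorm_top_le {G : EuclideanSpace ℝ (Fin d) → EuclideanSpace ℝ (Fin d)}
    (hG : eLpNorm G ∞ volume ≤ 1) : ∀ᵐ x, ‖G x‖ ≤ 1 := by
  rw [eLpNorm_exponent_top] at hG
  filter_upwards [ae_le_eLpNormEssSup (f := G) (μ := volume)] with x hx
  have := hx.trans hG
  rwa [← ofReal_norm, ENNReal.ofReal_le_one] at this

/-- If `K * T` is bounded by one, then `⟨T, χ P(∂_v ρ)(· - b)⟩` is bounded by a multiple of the mass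
of `ρ`: it is a multiple of the pairing of the component of `K * T` in the direction `v` with a
translate of `ρ`. -/
theorem RieszConvEq.abs_apply_mulTranslate_le (hd : 0 < d) {s : ℝ} (hs : 1 < s) (hsd : s < d)
    {T : 𝓓'((⊤ : Opens (EuclideanSpace ℝ (Fin d))), ℝ)}
    {χ : 𝓓((⊤ : Opens (EuclideanSpace ℝ (Fin d))), ℝ)}
    (hχ : ∀ᶠ x in 𝓝ˢ (Distribution.dsupport T), χ x = 1)
    {G : EuclideanSpace ℝ (Fin d) → EuclideanSpace ℝ (Fin d)} (hG : MemLp G ∞ volume)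
    (hG1 : eLpNorm G ∞ volume ≤ 1) (hTG : RieszConvEq s T G)
    {ρ : EuclideanSpace ℝ (Fin d) → ℝ} (hρ : ContDiff ℝ (⊤ : ℕ∞) ρ) (hρs : HasCompactSupport ρ)
    (v : EuclideanSpace ℝ (Fin d))
    (h : ContDiff ℝ (⊤ : ℕ∞) (rieszPotential (s - 1) fun y => fderiv ℝ ρ y v))
    (b : EuclideanSpace ℝ (Fin d)) :
    |T (mulTranslate χ h b)| ≤ (s - 1) * ‖v‖ * ∫ x, |ρ x| := by
  have := nontrivial_euclideanSpace hd
  have hp : 0 < s - 1 := by linarith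
  have hpn : s - 1 + 1 < Module.finrank ℝ (EuclideanSpace ℝ (Fin d)) := by
    rw [finrank_euclideanSpace_fin]; linarith
  have hpn' : s - 1 < Module.finrank ℝ (EuclideanSpace ℝ (Fin d)) := by linarith
  have he : ∀ i : Fin d, ‖EuclideanSpace.single i (1 : ℝ)‖ ≤ 1 := fun i => by simp
  let θ : 𝓓((⊤ : Opens (EuclideanSpace ℝ (Fin d))), ℝ) :=
    ⟨fun y => ρ (y - b), hρ.comp (contDiff_id.sub contDiff_const),
      hρs.comp_homeomorph (Homeomorph.subRight b), fun _ _ => trivial⟩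
  have hR := fun i => (rieszTransform_bounds hp hpn θ.contDiff θ.hasCompactSupport (he i)).1
  have hval : ∀ i, T (mulTestFunction χ (hR i)) = ∫ y, G y i * θ y := fun i => by
    refine PairsTo.apply_mulTestFunction hχ ?_ (hR i)
    convert hTG θ i using 2
    exact (integral_rieszKernel_mul s θ i _).symm
  have hexp : mulTranslate χ h b = ∑ i, (v i * (s - 1)) • mulTestFunction χ (hR i) := by
    refine DFunLike.ext _ _ fun y => ?_
    have e1 : ∀ i, rieszTransform (s - 1) (EuclideanSpace.single i 1) θ y =
        (s - 1)⁻¹ * fderiv ℝ (rieszPotential (s - 1) ρ) (y - b) (EuclideanSpace.single i 1) := by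
      intro i
      rw [fderiv_rieszPotential hp.le hpn' hρ hρs, rieszPotential_fderiv hp.le hpn hρ hρs (he i),
        inv_mul_cancel_left₀ hp.ne', rieszTransform]
      refine integral_congr_ae (ae_of_all _ fun z => ?_)
      change _ * ρ (y + z - b) = _ * ρ (y - b + z)
      rw [sub_add_eq_add_sub y b z]
    -- the Riesz transforms are known in the coordinate directions only
    have e2 : v = ∑ i, v i • EuclideanSpace.single i (1 : ℝ) := by
      ext j
      simp [Finset.sum_apply, Pi.single_apply]
    have e3 : (∑ i, (v i * (s - 1)) • mulTestFunction χ (hR i)) y =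
        ∑ i, (v i * (s - 1)) * (χ y * rieszTransform (s - 1) (EuclideanSpace.single i 1) θ y) := by
      generalize (Finset.univ : Finset (Fin d)) = S
      induction S using Finset.induction_on with
      | empty => rfl
      | insert i S hi ih =>
        rw [Finset.sum_insert hi, Finset.sum_insert hi, ← ih]
        rfl
    rw [e3, mulTranslate_apply, ← fderiv_rieszPotential hp.le hpn' hρ hρs]
    conv_lhs => rw [e2]
    rw [map_sum, Finset.mul_sum]
    refine Finset.sum_congr rfl fun i _ => ?_
    rw [e1, map_smul, smul_eq_mul]
    field_simp
  have hθi : Integrable θ := θ.contDiff.continuous.integrable_of_hasCompactSupport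
      θ.hasCompactSupport
  have hG1' := norm_le_one_of_eLpNorm_top_le hG1
  have hGi : ∀ i, Integrable fun y => G y i * θ y := fun i =>
    hθi.bdd_mul (c := 1) ((EuclideanSpace.proj (𝕜 := ℝ) i).continuous.comp_aestronglyMeasurable
        hG.1)
      (hG1'.mono fun y hy => (PiLp.norm_apply_le (G y) i).trans hy)
  have hsum : T (mulTranslate χ h b) = ∫ y, (s - 1) * (⟪v, G y⟫ * θ y) := by
    rw [hexp, map_sum]
    simp only [map_smul, hval, smul_eq_mul, ← integral_const_mul]
    rw [← integral_finsetSum _ fun i _ => (hGi i).const_mul _]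
    refine integral_congr_ae (ae_of_all _ fun y => ?_)
    simp only [PiLp.inner_apply, RCLike.inner_apply, conj_trivial, Finset.sum_mul, Finset.mul_sum]
    exact Finset.sum_congr rfl fun i _ => by ring
  have hint : ∫ x, |ρ x| = ∫ y, |θ y| := (integral_sub_right_eq_self (fun y => |ρ y|) b).symm
  rw [hsum, hint, ← integral_const_mul, ← Real.norm_eq_abs]
  refine norm_integral_le_of_norm_le (hθi.abs.const_mul _) (hG1'.mono fun y hy => ?_)
  rw [norm_mul, norm_mul, Real.norm_of_nonneg hp.le, mul_assoc]
  refine mul_le_mul_of_nonneg_left (mul_le_mul_of_nonneg_right ?_ (norm_nonneg _)) hp.le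
  exact (abs_real_inner_le_norm v (G y)).trans (mul_le_of_le_one_right (norm_nonneg _) hy)

/-- If `E` is removable, no nonzero value is attained in the definition of the capacity. The
potential `u` of `T` is Lipschitz, and `Λu` is a multiple of `T`, which vanishes off `E`; by
removability in the whole space `T` vanishes on the cutoff `χ`, and `⟨T, χ⟩` is the total mass. -/
theorem IsLipRemovable.eq_zero_of_pairsTo (hd : 2 ≤ d) {α s : ℝ} (hα : α ∈ Set.Ioo (1 : ℝ) 2)
    (hs : s = (d : ℝ) - α + 1) {E : Set (EuclideanSpace ℝ (Fin d))} (hE : IsCompact E)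
    (hrem : IsLipRemovable α E) {T : 𝓓'((⊤ : Opens (EuclideanSpace ℝ (Fin d))), ℝ)}
    (hT : Distribution.dsupport T ⊆ E) {G : EuclideanSpace ℝ (Fin d) → EuclideanSpace ℝ (Fin d)}
    (hG : MemLp G ∞ volume) (hG1 : eLpNorm G ∞ volume ≤ 1) (hTG : RieszConvEq s T G) {t : ℝ}
    (ht : PairsTo T (fun _ => 1) t) : t = 0 := by
  obtain ⟨h1, h2⟩ := hα
  have h0 : 0 < α := by linarith
  have := nontrivial_euclideanSpace (d := d) (by omega)
  have hd' : (2 : ℝ) ≤ d := by exact_mod_cast hd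
  have hfin : (Module.finrank ℝ (EuclideanSpace ℝ (Fin d)) : ℝ) = d := by
    rw [finrank_euclideanSpace_fin]
  obtain ⟨χ, hχE⟩ := exists_testFunction_eq_one hE
  have hχ : ∀ᶠ x in 𝓝ˢ (Distribution.dsupport T), χ x = 1 := hχE.filter_mono (nhdsSet_mono hT)
  obtain ⟨C, hC, u, huL, ⟨B, hB⟩, hu⟩ := exists_lipschitz_potential (T := T) (χ := χ) (p := s - 1)
    h0 h2 (by rw [hfin]; linarith) (by rw [hfin, hs]; ring)
    fun ρ hρ hρs => RieszConvEq.abs_apply_mulTranslate_le (by omega) (by linarith) (by linarith) hχ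
      hG hG1 hTG hρ hρs
  obtain ⟨c, hc0, hc⟩ := exists_fracLaplacianPairing_eq (d := d) (by omega) h0 h2
  have hpair : ∀ f : 𝓓((⊤ : Opens (EuclideanSpace ℝ (Fin d))), ℝ), fracLaplacianPairing α u f = 0 ↔
      T (mulTestFunction χ f.contDiff) = 0 := by
    intro f
    rw [hc u f f.contDiff f.hasCompactSupport, hu f f.contDiff f.hasCompactSupport]
    norm_cast
    simp [hc0, hC]
  have hLip : LipschitzWith (s - 1).toNNReal u := LipschitzWith.of_dist_le_mul fun x y => by
    rw [Real.dist_eq, dist_eq_norm, Real.coe_toNNReal _ (by linarith)]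
    exact huL x y
  have hint : Integrable fun x => u x / (1 + ‖x‖) ^ ((d : ℝ) + α) := by
    have h3 := integrable_one_add_norm (E := EuclideanSpace ℝ (Fin d)) (μ := volume)
      (r := (d : ℝ) + α) (by rw [hfin]; linarith)
    refine (h3.bdd_mul hLip.continuous.aestronglyMeasurable (ae_of_all _ hB)).congr
      (ae_of_all _ fun x => ?_)
    simp only [Real.rpow_neg (by positivity : 0 ≤ 1 + ‖x‖), div_eq_mul_inv]
  have h3 := (hpair χ).1 (hrem ⊤ u (Set.subset_univ _) ⟨_, hLip.lipschitzOnWith⟩ hint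
    (fun f hf => (hpair f).2 ?_) χ)
  · have h4 : T χ = t := by
      refine Eq.trans (congrArg T (DFunLike.ext _ _ fun x => ?_))
        (ht.apply_mulTestFunction hχ contDiff_const)
      rw [mulTestFunction_apply, mul_one]
    rw [← h4, ← h3, ← sub_eq_zero, ← map_sub]
    refine Distribution.apply_eq_zero_of_eventuallyEq_zero T _ (hχ.mono fun x hx => ?_)
    change χ x - χ x * χ x = 0
    rw [hx]
    norm_num
  · refine Distribution.apply_eq_zero_of_eventuallyEq_zero T _ ?_
    have h5 : (tsupport f)ᶜ ∈ 𝓝ˢ (Distribution.dsupport T) := by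
      refine (isClosed_tsupport f).isOpen_compl.mem_nhdsSet.2 fun x hx hxf => ?_
      have : x ∈ tsupport f ∩ E := ⟨hxf, hT hx⟩
      rw [hf] at this
      exact this
    filter_upwards [h5] with x hx
    rw [mulTestFunction_apply, image_eq_zero_of_notMem_tsupport hx, mul_zero]

theorem IsLipRemovable.rieszCapacity_eq_zero (hd : 2 ≤ d) {α s : ℝ} (hα : α ∈ Set.Ioo (1 : ℝ) 2)
    (hs : s = (d : ℝ) - α + 1) {E : Set (EuclideanSpace ℝ (Fin d))} (hE : IsCompact E)
    (hrem : IsLipRemovable α E) : rieszCapacity s E = 0 := by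
  refine le_antisymm (sSup_le ?_) ?_
  · rintro _ ⟨T, t, hT, ⟨G, hG, hG1, hTG⟩, ht, rfl⟩
    rw [hrem.eq_zero_of_pairsTo hd hα hs hE hT hG hG1 hTG ht, EReal.coe_zero]
  · have hsupp : Distribution.dsupport (0 : 𝓓'((⊤ : Opens (EuclideanSpace ℝ (Fin d))), ℝ)) = ∅ := by
      refine Set.eq_empty_of_forall_notMem fun x hx => ?_
      rw [Distribution.mem_dsupport_iff_not_isVanishingOn] at hx
      exact hx Set.univ trivial isOpen_univ fun _ _ => rfl
    have hpair : ∀ g : EuclideanSpace ℝ (Fin d) → ℝ, PairsTo 0 g 0 := fun g =>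
      ⟨0, by rw [hsupp, nhdsSet_empty]; exact Filter.eventually_bot, rfl⟩
    refine le_sSup ⟨0, 0, hsupp.trans_subset (Set.empty_subset E), ⟨0, MemLp.zero, by simp,
      fun φ i => ?_⟩, hpair _, rfl⟩
    simpa using hpair _

end Removable

end

theorem mainTheorem5 (d : ℕ) (hd : 2 ≤ d) (α s : ℝ) (hα : α ∈ Set.Ioo (1 : ℝ) 2)
    (hs : s = (d : ℝ) - α + 1) (E : Set (EuclideanSpace ℝ (Fin d))) (hE : IsCompact E) :
    IsLipRemovable α E ↔ rieszCapacity s E = 0 :=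
  ⟨fun h => h.rieszCapacity_eq_zero hd hα hs hE,
    isLipRemovable_of_rieszCapacity_eq_zero hd hα hs hE⟩
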